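/- Let $K=\mathbb{Q}(t,q)$ and $\mathscr P_k^+=K[x_1,\dots,x_k]$. On polynomials put $T_if=s_if+(1-t)x_i\frac{f-s_if}{x_i-x_{i+1}}$, so that $(T_i-1)(T_i+t)=0$, and on $\mathscr P_k^+$ ($k\ge 1$) put $$\omega_k^{-1}f=f(x_2,\dots,x_k,qx_1),\qquad \widetilde\omega_k^{-1}=T_1\cdots T_{k-1}x_k,\qquad \varpi_k=\mathrm{pr}_1\,\omega_k^{-1},$$ $$\widetilde Y^{(k)}_1=t^k\varpi_kT_{k-1}^{-1}\cdots T_1^{-1},\qquad \widetilde Y^{(k)}_{i+1}=t^{-1}T_i\widetilde Y^{(k)}_iT_i\quad(1\le i\le k-1),$$ where $\mathrm{pr}_1$ is the identity on monomials divisible by $x_1$ and $0$ on the other monomials. Let $\mathscr P_\infty^+$ be the inverse limit of the graded rings $\mathscr P_k^+$ along $\pi_k:x_k\mapsto 0$ (sequences of bounded degree), with projections $\Pi_k:\mathscr P_\infty^+\to\mathscr P_k^+$. The $T_i$ induce operators $\mathscr T_i$ on $\mathscr P_\infty^+$ (with $\Pi_k\mathscr T_i=T_i\Pi_k$ for $k>i$),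 and $\mathscr X_i$ is multiplication by $x_i$. Let $\mathscr P(k)^+=\{F\in\mathscr P_\infty^+ : \mathscr T_iF=F \text{ for all } i>k\}$, $\mathscr P_{\rm as}^+=\bigcup_k\mathscr P(k)^+$ and $\mathrm{Sym}=\mathscr P(0)^+$. For $F\in\mathrm{Sym}$ let $F[\mathbf X_k]$ be $F$ evaluated at the alphabet $x_{k+1},x_{k+2},\dots$; multiplication gives $\mathscr P(k)^+\cong \mathscr P_k^+\otimes \mathrm{Sym}[\mathbf X_k]$. A sequence $a_k\in K$ converges to $a$ if the order of vanishing at $t=0$ of $a_k-a$ tends to $+\infty$. A sequence $f_k\in\mathscr P_k^+$ (defined for all large $k$) converges to $h+\sum_{i=1}^Na_ig_i\in\mathscr P_\infty^+$ if, for all large $k$, $f_k=\Pi_kh+\sum_{i=1}^N a_{i,k}\Pi_kg_i$ with $h\in\mathscr P_\infty^+$, $g_i\in\mathscr P_{\rm as}^+$ and $a_{i,k}\to a_i$ in $K$. Let $\mathscr Y_iF=\lim_k\widetilde Y_i^{(k)}\Pi_kF$ for $F\in\mathscr P_{\rm as}^+$. Let $\mathscr B_0$ be the operator on $\mathrm{Sym}$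 with $\mathscr B_0P_\mu(X;t^{-1})=t^{\ell(\mu)}P_\mu(X;t^{-1})$ for all Hall–Littlewood functions $P_\mu$, and $\mathscr B_{n+1}=[\mathscr B_\infty,\mathscr B_n]$, where $\mathscr B_\infty$ is multiplication by $e_1$. Extend $\omega_k^{-1}$ and $\widetilde\omega_k^{-1}$ to $\mathscr P(k)^+$ linearly over $\mathrm{Sym}[\mathbf X_k]$, let $\iota(k):\mathscr P(k)^+\to\mathscr P(k+1)^+$ be the inclusion, and define $$\partial_k=-\widetilde\omega^{-1}_{k+1}\iota(k),\qquad \partial^*_k=\omega_{k+1}^{-1}\iota(k):\ \mathscr P(k)^+\to\mathscr P(k+1)^+,$$ and $\partial^-_k:\mathscr P(k)^+\to\mathscr P(k-1)^+$ ($k\ge1$) as the $\mathscr P_{k-1}^+$-linear map with $\partial_k^-(x_k^nF[\mathbf X_k])=(\mathscr B_nF)[\mathbf X_{k-1}]$ for $n\ge 0$, $F\in\mathrm{Sym}$. The double Dyck path algebra $\mathbb A_{t,q}$ is the path algebra over $K$ of the quiver with vertices $k\in\mathbb Z_{\ge0}$, arrows $d_+,d_+^*:k\to k+1$, $d_-:k+1\to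 k$ and loops $T_1,\dots,T_{k-1}$ at $k$, modulo the following relations (between paths starting at $k$, read as compositions of operators): - $T_iT_j=T_jT_i$ ($|i-j|>1$), $T_iT_{i+1}T_i=T_{i+1}T_iT_{i+1}$, $(T_i-1)(T_i+t)=0$; - $d_-^2T_{k-1}=d_-^2$ ($k\ge 2$), $T_id_-=d_-T_i$ ($1\le i\le k-2$); - $T_1d_+^2=d_+^2$, $d_+T_i=T_{i+1}d_+$, $T_1(d_+^*)^2=(d_+^*)^2$, $d_+^*T_i=T_{i+1}d_+^*$ ($1\le i\le k-1$); - $d_-[d_+,d_-]T_{k-1}=t[d_+,d_-]d_-$ ($k\ge2$), $T_1[d_+,d_-]d_+=t\,d_+[d_+,d_-]$ ($k\ge1$); - $t\,d_-[d_+^*,d_-]=[d_+^*,d_-]d_-T_{k-1}$ ($k\ge2$), $t[d_+^*,d_-]d_+^*=T_1d_+^*[d_+^*,d_-]$ ($k\ge1$); - $d_+z_i=z_{i+1}d_+$, $d_+^*y_i=y_{i+1}d_+^*$ ($1\le i\le k-1$), $z_1d_+=-qt^{k+1}y_1d_+^*$, where $y_i,z_i$ ($1\le i\le k$) are the loops at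 $k$ given by $y_1=\frac{1}{t^{k-1}(t-1)}[d_+,d_-]T_{k-1}\cdots T_1$, $y_{i+1}=tT_i^{-1}y_iT_i^{-1}$, $z_1=\frac{t^k}{1-t}[d_+^*,d_-]T_{k-1}^{-1}\cdots T_1^{-1}$, $z_{i+1}=t^{-1}T_iz_iT_i$. **Theorem.** The limits defining the operators $\mathscr Y_i$ exist on $\mathscr P_{\rm as}^+$ and lie in $\mathscr P_{\rm as}^+$. The assignment $T_i\mapsto\mathscr T_i$, $d_+\mapsto\partial$, $d_+^*\mapsto\partial^*$, $d_-\mapsto\partial^-$ defines an $\mathbb A_{t,q}$-module structure (quiver representation) on $\mathscr P_\bullet=(\mathscr P(k)^+)_{k\ge0}$. Under this action the loops $y_i$, $z_i$ ($1\le i\le k$) at the vertex $k$ act on $\mathscr P(k)^+$ as the restrictions of the global operators $\mathscr X_i$, $\mathscr Y_i$. -/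

import Mathlib

/-!
Indexing convention: everything is indexed from `0`.  The variable `x_{i+1}` is `MvPolynomial.X i`,
and the operators / loops with subscript `i+1` (`T_{i+1}`, `X_{i+1}`, `Y_{i+1}`, `y_{i+1}`,
`z_{i+1}`) carry the index `i`.
-/

noncomputable section

namespace StableDAHA

open MvPolynomial Filter

/-! ### The field `ℚ(t,q)` and convergence in it -/

/-- The field `ℚ(t,q)` of rational functions in two parameters. -/
def QTQ : Type := FractionRing (MvPolynomial (Fin 2) ℚ)

instance : Field QTQ := inferInstanceAs (Field (FractionRing (MvPolynomial (Fin 2) ℚ)))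

instance : Algebra (MvPolynomial (Fin 2) ℚ) QTQ :=
  inferInstanceAs (Algebra (MvPolynomial (Fin 2) ℚ) (FractionRing (MvPolynomial (Fin 2) ℚ)))

instance : IsFractionRing (MvPolynomial (Fin 2) ℚ) QTQ :=
  inferInstanceAs (IsFractionRing (MvPolynomial (Fin 2) ℚ)
    (FractionRing (MvPolynomial (Fin 2) ℚ)))

/-- The parameter `t`. -/
def tc : QTQ := algebraMap (MvPolynomial (Fin 2) ℚ) QTQ (X 0)

/-- The parameter `q`. -/
def qc : QTQ := algebraMap (MvPolynomial (Fin 2) ℚ) QTQ (X 1)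

/-- `c` vanishes at `t = 0` to order at least `M`: `c = t ^ M * A / B` with polynomials `A`, `B`
such that `t` does not divide `B`. -/
def OrdGE (M : ℕ) (c : QTQ) : Prop :=
  ∃ A B : MvPolynomial (Fin 2) ℚ, ¬ (X 0 ∣ B) ∧
    c * algebraMap _ QTQ B = algebraMap _ QTQ (X 0 ^ M * A)

/-- `a n → b` for the order of vanishing at `t = 0`. -/
def CoeffTendsto (a : ℕ → QTQ) (b : QTQ) : Prop :=
  ∀ M : ℕ, ∀ᶠ n in atTop, OrdGE M (a n - b)

/-! ### Polynomials -/

/-- The polynomial ring `ℚ(t,q)[x_1, x_2, …]`; it contains all the rings `𝒫_k^+`. -/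
abbrev Poly : Type := MvPolynomial ℕ QTQ

/-- `𝒫_k^+ = ℚ(t,q)[x_1, …, x_k]`. -/
def PolyLT (k : ℕ) : Subalgebra QTQ Poly := MvPolynomial.supported QTQ {i | i < k}

/-- The specialization `x_{m+1} = x_{m+2} = ⋯ = 0`.  On `𝒫_{m+1}^+` it is the structure map
`π_{m+1} : 𝒫_{m+1}^+ → 𝒫_m^+`. -/
def trunc (m : ℕ) : Poly →ₐ[QTQ] Poly := aeval fun j => if j < m then X j else 0

/-- The simple transposition exchanging the variables of index `i` and `i + 1`. -/
def swapVar (i : ℕ) : Poly →ₐ[QTQ] Poly := rename (Equiv.swap i (i + 1))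

theorem X_sub_X_ne_zero (i : ℕ) : (X i - X (i + 1) : Poly) ≠ 0 := by
  rw [sub_ne_zero]
  intro h
  have := MvPolynomial.X_injective h
  omega

theorem dvd_sub_swapVar (i : ℕ) (f : Poly) : (X i - X (i + 1) : Poly) ∣ f - swapVar i f := by
  rw [← Ideal.mem_span_singleton, ← Ideal.Quotient.eq]
  have h : (Ideal.Quotient.mkₐ QTQ (Ideal.span {(X i - X (i + 1) : Poly)})) =
      (Ideal.Quotient.mkₐ QTQ (Ideal.span {(X i - X (i + 1) : Poly)})).comp (swapVar i) := by
    have key : Ideal.Quotient.mk (Ideal.span {(X i - X (i + 1) : Poly)}) (X i) =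
        Ideal.Quotient.mk (Ideal.span {(X i - X (i + 1) : Poly)}) (X (i + 1)) := by
      rw [Ideal.Quotient.eq]
      exact Ideal.mem_span_singleton_self _
    apply MvPolynomial.algHom_ext
    intro j
    simp only [AlgHom.comp_apply, swapVar, rename_X, Ideal.Quotient.mkₐ_eq_mk]
    rcases eq_or_ne j i with rfl | h1
    · rw [Equiv.swap_apply_left, key]
    · rcases eq_or_ne j (i + 1) with rfl | h2
      · rw [Equiv.swap_apply_right, key]
      · rw [Equiv.swap_apply_of_ne_of_ne h1 h2]
  exact congrArg (fun φ => φ f) h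

/-- The divided difference `(f - s_i f) / (x_i - x_{i+1})`. -/
def divDiff (i : ℕ) : Poly →ₗ[QTQ] Poly where
  toFun f := Classical.choose (dvd_sub_swapVar i f)
  map_add' f g := by
    apply mul_left_cancel₀ (X_sub_X_ne_zero i)
    rw [mul_add, ← Classical.choose_spec (dvd_sub_swapVar i (f + g)),
      ← Classical.choose_spec (dvd_sub_swapVar i f), ← Classical.choose_spec (dvd_sub_swapVar i g),
      map_add]
    ring
  map_smul' c f := by
    apply mul_left_cancel₀ (X_sub_X_ne_zero i)
    rw [RingHom.id_apply, mul_smul_comm, ← Classical.choose_spec (dvd_sub_swapVar i (c • f)),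
      ← Classical.choose_spec (dvd_sub_swapVar i f), map_smul, smul_sub]

theorem X_sub_X_mul_divDiff (i : ℕ) (f : Poly) :
    (X i - X (i + 1)) * divDiff i f = f - swapVar i f :=
  (Classical.choose_spec (dvd_sub_swapVar i f)).symm

/-- Multiplication by a variable. -/
def mulX (i : ℕ) : Poly →ₗ[QTQ] Poly := LinearMap.mulLeft QTQ (X i)

/-- `T_i f = s_i f + (1 - t) x_i (f - s_i f) / (x_i - x_{i+1})`. -/
def polyT (i : ℕ) : Poly →ₗ[QTQ] Poly :=
  (swapVar i).toLinearMap + (1 - tc) • (mulX i ∘ₗ divDiff i)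

/-- `T_i⁻¹ = t⁻¹ (T_i + t - 1)`, by the quadratic relation `(T_i - 1)(T_i + t) = 0`. -/
def polyTInv (i : ℕ) : Poly →ₗ[QTQ] Poly :=
  tc⁻¹ • (polyT i + (tc - 1) • LinearMap.id)

/-- `polyTAsc n = T_1 T_2 ⋯ T_n`. -/
def polyTAsc : ℕ → (Poly →ₗ[QTQ] Poly)
  | 0 => LinearMap.id
  | n + 1 => polyTAsc n ∘ₗ polyT n

/-- `polyTInvDesc n = T_n⁻¹ ⋯ T_2⁻¹ T_1⁻¹`. -/
def polyTInvDesc : ℕ → (Poly →ₗ[QTQ] Poly)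
  | 0 => LinearMap.id
  | n + 1 => polyTInv n ∘ₗ polyTInvDesc n

/-- The action of `ω_k⁻¹`, `k ≥ 1`, on `𝒫_k^+`: `f ↦ f(x_2, …, x_k, q x_1)`. -/
def omegaInv (k : ℕ) : Poly →ₗ[QTQ] Poly :=
  (aeval fun j => if j + 1 < k then X (j + 1) else if j + 1 = k then qc • X 0 else X j :
    Poly →ₐ[QTQ] Poly).toLinearMap

/-- The action of `ω̃_k⁻¹ = T_1 ⋯ T_{k-1} X_k`, `k ≥ 1`, on `𝒫_k^+`. -/
def omegaTildeInv (k : ℕ) : Poly →ₗ[QTQ] Poly := polyTAsc (k - 1) ∘ₗ mulX (k - 1)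

/-- The projection onto `x_1 𝒫_k^+` which kills the monomials not divisible by `x_1`. -/
def prFirst : Poly →ₗ[QTQ] Poly :=
  LinearMap.id - (aeval fun j => if j = 0 then 0 else X j : Poly →ₐ[QTQ] Poly).toLinearMap

/-- `ϖ_k f = pr_1 f(x_2, …, x_k, q x_1)`, `k ≥ 1`. -/
def varpi (k : ℕ) : Poly →ₗ[QTQ] Poly := prFirst ∘ₗ omegaInv k

/-- The deformed Cherednik operators on `𝒫_k^+`: `Ỹ_1 = t^k ϖ_k T_{k-1}⁻¹ ⋯ T_1⁻¹` and
`Ỹ_{i+1} = t⁻¹ T_i Ỹ_i T_i`.  Only the indices `i < k` are meaningful. -/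
def polyY (k : ℕ) : ℕ → (Poly →ₗ[QTQ] Poly)
  | 0 => tc ^ k • (varpi k ∘ₗ polyTInvDesc (k - 1))
  | i + 1 => tc⁻¹ • (polyT i ∘ₗ polyY k i ∘ₗ polyT i)

/-! ### The inverse limit `𝒫_∞^+` -/

theorem totalDegree_trunc_le (m : ℕ) (f : Poly) : (trunc m f).totalDegree ≤ f.totalDegree := by
  rw [trunc, aeval_def, eval₂_eq]
  refine (totalDegree_finsetSum _ _).trans (Finset.sup_le fun d hd => ?_)
  refine le_trans ?_ (le_totalDegree hd)
  refine (totalDegree_mul _ _).trans ?_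
  rw [algebraMap_eq, totalDegree_C, zero_add, Finsupp.sum]
  refine (totalDegree_finsetProd _ _).trans (Finset.sum_le_sum fun j _ => ?_)
  refine (totalDegree_pow _ _).trans ?_
  split_ifs <;> simp

theorem trunc_trunc (m n : ℕ) (f : Poly) : trunc m (trunc n f) = trunc (min m n) f := by
  have h : (trunc m).comp (trunc n) = trunc (min m n) := by
    apply MvPolynomial.algHom_ext
    intro j
    simp only [trunc, AlgHom.comp_apply, aeval_X]
    by_cases hn : j < n
    · by_cases hm : j < m <;> simp [hn, hm]
    · simp [hn]
  exact congrArg (fun φ => φ f) h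

/-- `𝒫_∞^+`: the inverse limit of the graded rings `𝒫_m^+`, that is, the sequences of polynomials
`(f_m)` with `f_m ∈ 𝒫_m^+` and `π_{m+1} f_{m+1} = f_m`, of bounded degree. -/
def pInfSubalgebra : Subalgebra QTQ (ℕ → Poly) where
  carrier := {f | (∀ m, trunc m (f (m + 1)) = f m) ∧ ∃ d : ℕ, ∀ m, (f m).totalDegree ≤ d}
  mul_mem' := by
    rintro f g ⟨hf, d, hd⟩ ⟨hg, e, he⟩
    exact ⟨fun m => by simp [hf, hg], d + e, fun m =>
      (totalDegree_mul _ _).trans (add_le_add (hd m) (he m))⟩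
  add_mem' := by
    rintro f g ⟨hf, d, hd⟩ ⟨hg, e, he⟩
    exact ⟨fun m => by simp [hf, hg], max d e, fun m =>
      (totalDegree_add _ _).trans (max_le_max (hd m) (he m))⟩
  algebraMap_mem' c := ⟨fun m => by simp, 0, fun m => by simp [MvPolynomial.algebraMap_eq]⟩

/-- The ring `𝒫_∞^+` as a type. -/
def PInf : Type := pInfSubalgebra

instance : CommRing PInf := inferInstanceAs (CommRing pInfSubalgebra)

instance : Algebra QTQ PInf := inferInstanceAs (Algebra QTQ pInfSubalgebra)

/-- The canonical map `Π_m : 𝒫_∞^+ → 𝒫_m^+`. -/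
def proj (F : PInf) (m : ℕ) : Poly := F.1 m

theorem trunc_proj (F : PInf) {m n : ℕ} (h : m ≤ n) : trunc m (proj F n) = proj F m := by
  induction n, h using Nat.le_induction with
  | base =>
    have h := F.2.1 m
    change trunc m (F.1 m) = F.1 m
    rw [← h, trunc_trunc, min_self]
  | succ n hmn ih =>
    have h := F.2.1 n
    change trunc m (F.1 (n + 1)) = F.1 m
    change trunc m (F.1 n) = F.1 m at ih
    rw [← ih, ← h, trunc_trunc, min_eq_left hmn]

/-- The canonical map from polynomials to `𝒫_∞^+` (on `𝒫_k^+` it is the map `J_k`). -/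
def ofPoly (p : Poly) : PInf :=
  ⟨fun m => trunc m p, fun m => by rw [trunc_trunc, min_eq_left (Nat.le_succ m)],
    p.totalDegree, fun m => totalDegree_trunc_le m p⟩

theorem trunc_swapVar {i m : ℕ} (h : i + 1 < m) (f : Poly) :
    trunc m (swapVar i f) = swapVar i (trunc m f) := by
  have : (trunc m).comp (swapVar i) = (swapVar i).comp (trunc m) := by
    apply MvPolynomial.algHom_ext
    intro j
    simp only [trunc, swapVar, AlgHom.comp_apply, aeval_X, rename_X]
    rcases eq_or_ne j i with rfl | h1
    · rw [Equiv.swap_apply_left, if_pos h, if_pos (by omega), rename_X, Equiv.swap_apply_left]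
    · rcases eq_or_ne j (i + 1) with rfl | h2
      · rw [Equiv.swap_apply_right, if_pos h, if_pos (by omega), rename_X, Equiv.swap_apply_right]
      · rw [Equiv.swap_apply_of_ne_of_ne h1 h2]
        split_ifs
        · rw [rename_X, Equiv.swap_apply_of_ne_of_ne h1 h2]
        · rw [map_zero]
  exact congrArg (fun φ => φ f) this

theorem trunc_polyT {i m : ℕ} (h : i + 1 < m) (f : Poly) :
    trunc m (polyT i f) = polyT i (trunc m f) := by
  have hX : ∀ j, j < m → trunc m (X j) = X j := fun j hj => by simp [trunc, hj]
  have hd : trunc m (divDiff i f) = divDiff i (trunc m f) := by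
    apply mul_left_cancel₀ (X_sub_X_ne_zero i)
    rw [X_sub_X_mul_divDiff, ← trunc_swapVar h, ← map_sub, ← X_sub_X_mul_divDiff, map_mul, map_sub,
      hX i (by omega), hX (i + 1) h]
  simp only [polyT, mulX, LinearMap.add_apply, LinearMap.smul_apply, LinearMap.comp_apply,
    AlgHom.toLinearMap_apply, LinearMap.mulLeft_apply, map_add, map_smul, map_mul, hd,
    trunc_swapVar h, hX i (by omega)]

theorem totalDegree_swapVar_le (i : ℕ) (f : Poly) : (swapVar i f).totalDegree ≤ f.totalDegree :=
  totalDegree_rename_le _ _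

theorem totalDegree_polyT_le (i : ℕ) (f : Poly) : (polyT i f).totalDegree ≤ f.totalDegree := by
  have hs := totalDegree_swapVar_le i f
  have h2 : (X i * divDiff i f).totalDegree ≤ f.totalDegree := by
    by_cases h0 : divDiff i f = 0
    · simp [h0]
    have h1 := totalDegree_mul_of_isDomain (X_sub_X_ne_zero i) h0
    rw [X_sub_X_mul_divDiff] at h1
    have h3 : (f - swapVar i f).totalDegree ≤ f.totalDegree :=
      (totalDegree_sub _ _).trans (max_le le_rfl hs)
    have h4 : 1 ≤ (X i - X (i + 1) : Poly).totalDegree := by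
      have hmem : Finsupp.single i 1 ∈ (X i - X (i + 1) : Poly).support := by
        have hne : Finsupp.single (i + 1) 1 ≠ Finsupp.single i 1 := fun h => by
          have := Finsupp.single_left_injective one_ne_zero h
          omega
        rw [mem_support_iff, coeff_sub, coeff_X, coeff_X, if_pos rfl, if_neg hne]
        simp
      simpa using le_totalDegree hmem
    refine (totalDegree_mul _ _).trans ?_
    rw [totalDegree_X]
    omega
  have h5 : polyT i f = swapVar i f + (1 - tc) • (X i * divDiff i f) := rfl
  rw [h5]
  exact (totalDegree_add _ _).trans (max_le hs ((totalDegree_smul_le _ _).trans h2))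

/-- The limit operator `𝒯_i` on `𝒫_∞^+`; see `proj_calT`. -/
def calT (i : ℕ) : PInf →ₗ[QTQ] PInf where
  toFun F := ⟨fun m => trunc m (polyT i (proj F (m + i + 2))), fun m => by
      beta_reduce
      rw [trunc_trunc, min_eq_left (Nat.le_succ m), ← trunc_proj F (show m + i + 2 ≤ m + 1 + i + 2
        by omega), ← trunc_polyT (by omega), trunc_trunc, min_eq_left (by omega)], by
      obtain ⟨d, hd⟩ := F.2.2
      exact ⟨d, fun m => (totalDegree_trunc_le _ _).trans
        ((totalDegree_polyT_le _ _).trans (hd _))⟩⟩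
  map_add' F G := by
    apply Subtype.ext
    funext m
    change trunc m (polyT i (proj F (m + i + 2) + proj G (m + i + 2))) = _
    rw [map_add, map_add]
    rfl
  map_smul' c F := by
    apply Subtype.ext
    funext m
    change trunc m (polyT i (c • proj F (m + i + 2))) = _
    rw [map_smul, map_smul]
    rfl

/-- `Π_m 𝒯_i = T_i Π_m` as soon as `𝒫_m^+` contains the two variables on which `T_i` acts. -/
theorem proj_calT {i m : ℕ} (h : i + 1 < m) (F : PInf) :
    proj (calT i F) m = polyT i (proj F m) := by
  change trunc m (polyT i (proj F (m + i + 2))) = _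
  rw [trunc_polyT h, trunc_proj F (by omega)]

/-- The limit operator `𝒳_i` on `𝒫_∞^+`: multiplication by the variable. -/
def calX (i : ℕ) : PInf →ₗ[QTQ] PInf := LinearMap.mulLeft QTQ (ofPoly (X i))

theorem polyT_eq_self_iff (i : ℕ) (f : Poly) : polyT i f = f ↔ swapVar i f = f := by
  have h5 : polyT i f = swapVar i f + (1 - tc) • (X i * divDiff i f) := rfl
  have h6 := X_sub_X_mul_divDiff i f
  constructor
  · intro h
    have h7 : (X (i + 1) - C tc * X i) * divDiff i f = 0 := by
      rw [h5, smul_eq_C_mul, C_sub, C_1] at h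
      linear_combination h - h6
    have h8 : (X (i + 1) - C tc * X i : Poly) ≠ 0 := by
      intro h0
      have := congrArg (coeff (Finsupp.single (i + 1) 1)) h0
      have hne : Finsupp.single i 1 ≠ Finsupp.single (i + 1) 1 := fun h => by
        have := Finsupp.single_left_injective one_ne_zero h
        omega
      rw [coeff_sub, coeff_X, coeff_C_mul, coeff_X, if_pos rfl, if_neg hne] at this
      simp at this
    rw [(mul_eq_zero.mp h7).resolve_left h8, mul_zero] at h6
    exact (sub_eq_zero.mp h6.symm).symm
  · intro h
    rw [h, sub_self] at h6
    rw [h5, h, (mul_eq_zero.mp h6).resolve_left (X_sub_X_ne_zero i), mul_zero, smul_zero, add_zero]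

theorem calT_eq_self_iff (i : ℕ) (F : PInf) :
    calT i F = F ↔ ∀ m, i + 1 < m → swapVar i (proj F m) = proj F m := by
  constructor
  · intro h m hm
    rw [← polyT_eq_self_iff, ← proj_calT hm, h]
  · intro h
    apply Subtype.ext
    funext m
    change trunc m (polyT i (proj F (m + i + 2))) = proj F m
    rw [(polyT_eq_self_iff _ _).mpr (h _ (by omega)), trunc_proj F (by omega)]

/-- `𝒫(k)^+ = {F ∈ 𝒫_∞^+ : 𝒯_i F = F for all i > k}` (in `1`-based indexing). -/
def PSym (k : ℕ) : Subalgebra QTQ PInf where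
  carrier := {F | ∀ i, k ≤ i → calT i F = F}
  mul_mem' {F G} hF hG i hi := by
    rw [calT_eq_self_iff]
    intro m hm
    change swapVar i (proj F m * proj G m) = proj F m * proj G m
    rw [map_mul, (calT_eq_self_iff i F).mp (hF i hi) m hm,
      (calT_eq_self_iff i G).mp (hG i hi) m hm]
  add_mem' {F G} hF hG i hi := by
    rw [map_add, hF i hi, hG i hi]
  algebraMap_mem' c i hi := by
    rw [calT_eq_self_iff]
    intro m hm
    exact (swapVar i).commutes c

theorem PSym_le_succ (k : ℕ) : PSym k ≤ PSym (k + 1) :=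
  fun _ hF i hi => hF i ((Nat.le_succ k).trans hi)

/-- The canonical inclusion `𝒫(k)^+ → 𝒫(k+1)^+`. -/
def incl (k : ℕ) : PSym k →ₗ[QTQ] PSym (k + 1) :=
  (Subalgebra.inclusion (PSym_le_succ k)).toLinearMap

/-- The almost symmetric module `𝒫_as^+ = ⋃_k 𝒫(k)^+`. -/
def PAs : Set PInf := {F | ∃ k, F ∈ PSym k}

/-- The ring `Sym[X] = 𝒫(0)^+` of symmetric functions. -/
abbrev SymFn : Type := PSym 0

/-- The alphabet shift `F[X] ↦ F[x_{k+1} + x_{k+2} + ⋯]`. -/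
def shift (k : ℕ) (F : PInf) : PInf :=
  ⟨fun m => rename (fun j => j + k) (proj F (m - k)), by
    intro m
    have key : ∀ n : ℕ, ∀ f : Poly, trunc n (rename (fun j => j + k) f) =
        rename (fun j => j + k) (trunc (n - k) f) := by
      intro n f
      have : (trunc n).comp (rename (fun j => j + k)) =
          (rename (fun j => j + k)).comp (trunc (n - k)) := by
        apply MvPolynomial.algHom_ext
        intro j
        simp only [trunc, AlgHom.comp_apply, aeval_X, rename_X]
        by_cases h : j + k < n
        · rw [if_pos h, if_pos (by omega), rename_X]
        · rw [if_neg h, if_neg (by omega), map_zero]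
      exact congrArg (fun φ => φ f) this
    rw [key, trunc_proj F (by omega)], by
    obtain ⟨d, hd⟩ := F.2.2
    exact ⟨d, fun m => (totalDegree_rename_le _ _).trans (hd _)⟩⟩

/-! ### The stable limit and the limit Cherednik operators -/

/-- The sequence of polynomials `f m ∈ 𝒫_m^+` converges to `F ∈ 𝒫_∞^+`:
`f m = h_m + ∑ a_{i,m} g_{i,m}` where `h = (h_m)` is in `𝒫_∞^+`, the finitely many `g_i = (g_{i,m})`
are in `𝒫_as^+`, the coefficients `a_{i,m}` converge to `b_i`, and `F = h + ∑ b_i g_i`.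
Finitely many terms of the sequence are irrelevant. -/
def HasStableLimit (f : ℕ → Poly) (F : PInf) : Prop :=
  ∃ (N : ℕ) (h : PInf) (g : Fin N → PInf) (a : Fin N → ℕ → QTQ) (b : Fin N → QTQ),
    (∀ i, g i ∈ PAs) ∧ (∀ i, CoeffTendsto (a i) (b i)) ∧
    (∀ᶠ m in atTop, f m = proj h m + ∑ i, a i m • proj (g i) m) ∧
    F = h + ∑ i, b i • g i

open Classical in
/-- The limit Cherednik operator `𝒴_i F = lim_m Ỹ_i^{(m)} Π_m F` (meaningful when the limit exists,
in particular on `𝒫_as^+`). -/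
def calY (i : ℕ) (F : PInf) : PInf :=
  if h : ∃ G, HasStableLimit (fun m => polyY m i (proj F m)) G then Classical.choose h else 0

/-! ### Hall–Littlewood functions and the operators `ℬ_n` -/

/-- `v_m(s) = ∏_{i=1}^m (1 - s^i) / (1 - s)`. -/
def vFact (s : QTQ) (m : ℕ) : QTQ := ∏ i ∈ Finset.range m, ∑ j ∈ Finset.range (i + 1), s ^ j

/-- `F` is the Hall–Littlewood symmetric function `P_μ(X; s)` of the partition
`μ 0 ≥ μ 1 ≥ ⋯` of length `ℓ`: for all `n ≥ ℓ`, in `n` variables,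
`P_μ = v_μ(s)⁻¹ ∑_{w ∈ S_n} w (x^μ ∏_{i<j} (x_i - s x_j) / (x_i - x_j))`, where `v_μ(s)` is the
product of the `v_m(s)` over the multiplicities `m` of the entries of `(μ 0, …, μ (n-1))`.
The formula is stated after multiplication by `v_μ(s) ∏_{i<j} (x_i - x_j)`. -/
def IsHallLittlewood (s : QTQ) (μ : ℕ → ℕ) (ℓ : ℕ) (F : SymFn) : Prop :=
  ∀ n, ℓ ≤ n →
    (∏ a ∈ (Finset.range n).image μ, vFact s ((Finset.range n).filter (fun i => μ i = a)).card) •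
        (proj F.1 n * ∏ i : Fin n, ∏ j ∈ Finset.Ioi i, (X (i : ℕ) - X (j : ℕ))) =
      ∑ w : Equiv.Perm (Fin n), ((Equiv.Perm.sign w : ℤ) : Poly) *
        ((∏ i : Fin n, X (w i : ℕ) ^ μ i) *
          ∏ i : Fin n, ∏ j ∈ Finset.Ioi i, (X (w i : ℕ) - C s * X (w j : ℕ)))

/-- `B₀` is the operator `ℬ_0`: the (unique) operator with `ℬ_0 P_μ(X; t⁻¹) = t^{ℓ(μ)} P_μ(X; t⁻¹)` for all
partitions `μ`. -/
def IsHLZero (B₀ : Module.End QTQ SymFn) : Prop :=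
  ∀ (μ : ℕ → ℕ) (ℓ : ℕ), Antitone μ → (∀ i, μ i = 0 ↔ ℓ ≤ i) →
    ∀ F : SymFn, IsHallLittlewood tc⁻¹ μ ℓ F → B₀ F = tc ^ ℓ • F

/-- The element `x_1 + x_2 + ⋯` of `𝒫_∞^+`. -/
def e1Inf : PInf :=
  ⟨fun m => ∑ i ∈ Finset.range m, X i, fun m => by
    beta_reduce
    rw [map_sum, Finset.sum_range_succ]
    have h1 : ∀ i ∈ Finset.range m, trunc m (X i : Poly) = X i := fun i hi => by
      rw [trunc, aeval_X, if_pos (Finset.mem_range.mp hi)]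
    have h2 : trunc m (X m : Poly) = 0 := by
      rw [trunc, aeval_X, if_neg (lt_irrefl m)]
    rw [Finset.sum_congr rfl h1, h2, add_zero], 1, fun m =>
      (totalDegree_finsetSum _ _).trans (Finset.sup_le fun i _ => by rw [totalDegree_X])⟩

theorem e1Inf_mem : e1Inf ∈ PSym 0 := by
  intro i _
  rw [calT_eq_self_iff]
  intro m hm
  change swapVar i (∑ j ∈ Finset.range m, X j) = ∑ j ∈ Finset.range m, X j
  rw [map_sum]
  simp only [swapVar, rename_X]
  refine Finset.sum_equiv (Equiv.swap i (i + 1)) (fun j => ?_) (fun _ _ => rfl)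
  simp only [Finset.mem_range]
  rcases eq_or_ne j i with rfl | h1
  · rw [Equiv.swap_apply_left]; omega
  · rcases eq_or_ne j (i + 1) with rfl | h2
    · rw [Equiv.swap_apply_right]; omega
    · rw [Equiv.swap_apply_of_ne_of_ne h1 h2]

/-- The symmetric function `e_1 = x_1 + x_2 + ⋯`. -/
def e1 : SymFn := ⟨e1Inf, e1Inf_mem⟩

/-- `ℬ_∞`, multiplication by `e_1`. -/
def hlInf : Module.End QTQ SymFn := LinearMap.mulLeft QTQ e1

/-- The operators `ℬ_n` built from `ℬ_0` by `ℬ_{n+1} = [ℬ_∞, ℬ_n]`. -/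
def hlOp (B₀ : Module.End QTQ SymFn) : ℕ → Module.End QTQ SymFn
  | 0 => B₀
  | n + 1 => hlInf * hlOp B₀ n - hlOp B₀ n * hlInf

/-! ### The operators between the spaces `𝒫(k)^+` -/

/-- `A` is the (unique) extension of the operator `a` on `𝒫_k^+` to an operator on
`𝒫(k)^+ = 𝒫_k^+ ⊗ Sym[x_{k+1} + x_{k+2} + ⋯]`, linear over the second factor. -/
def IsSymLinearExt (k : ℕ) (a : Poly →ₗ[QTQ] Poly) (A : PSym k →ₗ[QTQ] PSym k) : Prop :=
  ∀ p ∈ PolyLT k, ∀ (G : SymFn) (F : PSym k), F.1 = ofPoly p * shift k G.1 →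
    (A F).1 = ofPoly (a p) * shift k G.1

/-- `D` is the (unique) operator `∂^-_{k+1} : 𝒫(k+1)^+ → 𝒫(k)^+` attached to a family of operators `B n` on
symmetric functions: the `𝒫_k^+`-linear map with
`x_{k+1}^n G[x_{k+2} + x_{k+3} + ⋯] ↦ (B n G)[x_{k+1} + x_{k+2} + ⋯]`. -/
def IsPartialMinus (B : ℕ → Module.End QTQ SymFn) (k : ℕ)
    (D : PSym (k + 1) →ₗ[QTQ] PSym k) : Prop :=
  ∀ p ∈ PolyLT k, ∀ (n : ℕ) (G : SymFn) (F : PSym (k + 1)),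
    F.1 = ofPoly p * ofPoly (X k) ^ n * shift (k + 1) G.1 →
      (D F).1 = ofPoly p * shift k (B n G).1

/-! ### The double Dyck path algebra -/

/-- The arrows of the quiver with vertex set `ℕ`. -/
inductive Arrow : ℕ → ℕ → Type
  | dPlus (k : ℕ) : Arrow k (k + 1)
  | dStar (k : ℕ) : Arrow k (k + 1)
  | dMinus (k : ℕ) : Arrow (k + 1) k
  | loopT (k i : ℕ) (h : i + 1 < k) : Arrow k k

/-- Generators of the path algebra: the trivial paths and the arrows. -/
inductive Gen : Type
  | vertex (k : ℕ) : Gen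
  | arrow {k l : ℕ} (a : Arrow k l) : Gen

/-- The free unital algebra on the generators. -/
abbrev FreeGen : Type := FreeAlgebra QTQ Gen

namespace FreeGen

/-- The trivial path at `k`. -/
def e (k : ℕ) : FreeGen := FreeAlgebra.ι QTQ (Gen.vertex k)

/-- `d_+ : k → k + 1`. -/
def dP (k : ℕ) : FreeGen := FreeAlgebra.ι QTQ (Gen.arrow (Arrow.dPlus k))

/-- `d_+^* : k → k + 1`. -/
def dS (k : ℕ) : FreeGen := FreeAlgebra.ι QTQ (Gen.arrow (Arrow.dStar k))

/-- `d_- : k + 1 → k`. -/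
def dM (k : ℕ) : FreeGen := FreeAlgebra.ι QTQ (Gen.arrow (Arrow.dMinus k))

/-- The loop `T_{i+1}` at `k` (for `i + 1 < k`). -/
def T (k i : ℕ) : FreeGen :=
  if h : i + 1 < k then FreeAlgebra.ι QTQ (Gen.arrow (Arrow.loopT k i h)) else 0

/-- The inverse `t⁻¹ (T_{i+1} + t - 1)` of the loop `T_{i+1}` at `k`. -/
def TInv (k i : ℕ) : FreeGen := tc⁻¹ • (T k i + (tc - 1) • e k)

/-- `T_n ⋯ T_1` at `k`. -/
def TDesc (k : ℕ) : ℕ → FreeGen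
  | 0 => 1
  | n + 1 => T k n * TDesc k n

/-- `T_n⁻¹ ⋯ T_1⁻¹` at `k`. -/
def TInvDesc (k : ℕ) : ℕ → FreeGen
  | 0 => 1
  | n + 1 => TInv k n * TInvDesc k n

/-- `[d_+, d_-]` at the vertex `k + 1`. -/
def commP (k : ℕ) : FreeGen := dP k * dM k - dM (k + 1) * dP (k + 1)

/-- `[d_+^*, d_-]` at the vertex `k + 1`. -/
def commS (k : ℕ) : FreeGen := dS k * dM k - dM (k + 1) * dS (k + 1)

/-- The loop `y_{i+1}` at the vertex `k + 1` (for `i ≤ k`). -/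
def y (k : ℕ) : ℕ → FreeGen
  | 0 => (tc ^ k * (tc - 1))⁻¹ • (commP k * TDesc (k + 1) k)
  | i + 1 => tc • (TInv (k + 1) i * y k i * TInv (k + 1) i)

/-- The loop `z_{i+1}` at the vertex `k + 1` (for `i ≤ k`). -/
def z (k : ℕ) : ℕ → FreeGen
  | 0 => (tc ^ (k + 1) / (1 - tc)) • (commS k * TInvDesc (k + 1) k)
  | i + 1 => tc⁻¹ • (T (k + 1) i * z k i * T (k + 1) i)

/-- The defining relations of the double Dyck path algebra.  A product of paths is read as a
composition of operators, from right to left.  The first four relations are those of the path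
algebra of the quiver. -/
inductive Rel : FreeGen → FreeGen → Prop
  | vertex_sq (k : ℕ) : Rel (e k * e k) (e k)
  | vertex_ne (k l : ℕ) (h : k ≠ l) : Rel (e k * e l) 0
  | source {k l : ℕ} (a : Arrow k l) :
      Rel (FreeAlgebra.ι QTQ (Gen.arrow a) * e k) (FreeAlgebra.ι QTQ (Gen.arrow a))
  | target {k l : ℕ} (a : Arrow k l) :
      Rel (e l * FreeAlgebra.ι QTQ (Gen.arrow a)) (FreeAlgebra.ι QTQ (Gen.arrow a))
  | T_comm (k i j : ℕ) (hij : i + 1 < j) (hj : j + 1 < k) :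
      Rel (T k i * T k j) (T k j * T k i)
  | T_braid (k i : ℕ) (hi : i + 2 < k) :
      Rel (T k i * T k (i + 1) * T k i) (T k (i + 1) * T k i * T k (i + 1))
  | T_quad (k i : ℕ) (hi : i + 1 < k) :
      Rel ((T k i - e k) * (T k i + tc • e k)) 0
  | dM_dM_T (k : ℕ) : Rel (dM k * dM (k + 1) * T (k + 2) k) (dM k * dM (k + 1))
  | T_dM (k i : ℕ) (hi : i + 1 < k) : Rel (T k i * dM k) (dM k * T (k + 1) i)
  | T_dP_dP (k : ℕ) : Rel (T (k + 2) 0 * dP (k + 1) * dP k) (dP (k + 1) * dP k)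
  | dP_T (k i : ℕ) (hi : i + 1 < k) : Rel (dP k * T k i) (T (k + 1) (i + 1) * dP k)
  | dM_commP (k : ℕ) :
      Rel (dM (k + 1) * commP (k + 1) * T (k + 2) k) (tc • (commP k * dM (k + 1)))
  | commP_dP (k : ℕ) :
      Rel (T (k + 2) 0 * commP (k + 1) * dP (k + 1)) (tc • (dP (k + 1) * commP k))
  | T_dS_dS (k : ℕ) : Rel (T (k + 2) 0 * dS (k + 1) * dS k) (dS (k + 1) * dS k)
  | dS_T (k i : ℕ) (hi : i + 1 < k) : Rel (dS k * T k i) (T (k + 1) (i + 1) * dS k)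
  | dM_commS (k : ℕ) :
      Rel (tc • (dM (k + 1) * commS (k + 1))) (commS k * dM (k + 1) * T (k + 2) k)
  | commS_dS (k : ℕ) :
      Rel (tc • (commS (k + 1) * dS (k + 1))) (T (k + 2) 0 * dS (k + 1) * commS k)
  | dP_z (k i : ℕ) (hi : i < k) : Rel (dP (k + 1) * z k i) (z (k + 1) (i + 1) * dP (k + 1))
  | dS_y (k i : ℕ) (hi : i < k) : Rel (dS (k + 1) * y k i) (y (k + 1) (i + 1) * dS (k + 1))
  | z_dP (k : ℕ) : Rel (z k 0 * dP k) (-(qc * tc ^ (k + 1)) • (y k 0 * dS k))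

end FreeGen

/-- The double Dyck path algebra `𝔸_{t,q}`: the path algebra of the quiver modulo the relations.
As the quiver has infinitely many vertices, its path algebra has no unit; here a unit is adjoined,
so that modules over the path algebra are the unital modules over `DDPA`. -/
def DDPA : Type := RingQuot FreeGen.Rel

instance : Ring DDPA := inferInstanceAs (Ring (RingQuot FreeGen.Rel))

instance : Algebra QTQ DDPA := inferInstanceAs (Algebra QTQ (RingQuot FreeGen.Rel))

/-- The class of an element of the free algebra in the double Dyck path algebra. -/
def DDPA.mk : FreeGen →ₐ[QTQ] DDPA := RingQuot.mkAlgHom QTQ FreeGen.Rel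

/-! ### The space `𝒫_•` -/

/-- The total space `⨁_k 𝒫(k)^+` of `𝒫_•`. -/
abbrev PBullet : Type := DirectSum ℕ fun k => PSym k

/-- The inclusion of the `k`-th summand. -/
def PBullet.single (k : ℕ) : PSym k →ₗ[QTQ] PBullet := DirectSum.lof QTQ ℕ (fun k => PSym k) k

/-- The operator on `𝒫_•` which is `φ` on `𝒫(k)^+`, with values in `𝒫(l)^+`, and zero on the other
summands. -/
def PBullet.map {k l : ℕ} (φ : PSym k →ₗ[QTQ] PSym l) : Module.End QTQ PBullet :=
  PBullet.single l ∘ₗ φ ∘ₗ DirectSum.component QTQ ℕ (fun k => PSym k) k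

/-- The operator `Φ` on `𝒫_•` maps `𝒫(k)^+` to itself by the restriction of the global operator `f`
(which therefore preserves `𝒫(k)^+`), and is zero on the other summands. -/
def ActsGloballyBy (Φ : Module.End QTQ PBullet) (k : ℕ) (f : PInf → PInf) : Prop :=
  ∃ φ : PSym k →ₗ[QTQ] PSym k, (∀ F : PSym k, (φ F).1 = f F.1) ∧ Φ = PBullet.map φ

end StableDAHA

end

open StableDAHA

noncomputable section

namespace StableDAHA

open MvPolynomial Filter

/-! ### The field of parameters and `t`-adic convergence -/

/-! The proof rests on a closed form for `∂^-`. An element of `𝒫(k+1)^+` can be expanded over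
`Sym[x_{k+2} + ⋯]`, as in the definition of `∂^-`, but also uniquely as a polynomial in `x_{k+1}`
with coefficients in `𝒫(k)^+` (`exists_decomp`, `PSym_induction`, `evalLast_injective`). In the
second expansion `∂^-` is the `𝒫(k)^+`-linear map `x_{k+1}^n ↦ Q_n[x_{k+1} + x_{k+2} + ⋯]`, where `∑
Q_n u^n = ∏ (1 - t x u) / (1 - x u)`. This map is `dMinus`. Splitting one variable off the product
gives the recursion `qFn_succ_sub`, from which the relations involving `∂^-` follow.

Agreement with the operators `ℬ_n`: multiplication by `e_1` commutes with `dMinus 0`, while the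
shift of alphabet turns `e_1` into `e_1 - x_1`. Each commutator with `ℬ_∞` therefore inserts one
factor `x_1` (`hlOp_apply`), and only `ℬ_0` has to be identified. In finitely many variables a
partial fraction expansion writes `dMinus 0` as a sum over the variables (`algebraMap_proj_dMinus`).
Applied to a shifted Hall–Littlewood function, this sum is the decomposition of the symmetrization
according to the variable put in last position (`sum_hlTerm_succ`), and the scalars add up to `t^ℓ`
(`isHLZero_opB0`).

Relations: `[∂, ∂^-]` equals `(t - 1) T_1 ⋯ T_k x_{k+1}` (`commPlus_eq`), so that `y_i` is
multiplication by `x_i` and the relations for `∂` become Hecke algebra. The commutator `[∂^*, ∂^-]`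
kills `𝒫(k)^+`, and `commStar_xv_mul` describes its effect after multiplication by `x_{k+1}`; its
relations with `∂^-` and `∂^*` follow by induction on the degree in the last variable.

Limit operators: for `F` in `𝒫(k+1)^+` and every `m ≥ k + 1` there is an exact formula `Ỹ_i^{(m)}
Π_m F = Π_m z_i F + t^m Π_m g`, with `g` independent of `m` (`polyY_zero_proj`, `polyY_proj`). The
limit thus exists and equals `z_i F`. Since stable limits are unique (`HasStableLimit.unique`),
`𝒴_i` restricts to the action of `z_i`.

All operators are linear endomorphisms of the domain `𝒫_∞^+`; the spaces `𝒫(k)^+` enter only as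
hypotheses, until the identities are transported to `⨁_k 𝒫(k)^+` by `MapsBy`. -/

theorem algebraMap_QTQ_injective :
    Function.Injective (algebraMap (MvPolynomial (Fin 2) ℚ) QTQ) :=
  IsFractionRing.injective _ _

theorem tc_ne_zero : tc ≠ 0 := by
  intro h
  have := algebraMap_QTQ_injective (h.trans (map_zero _).symm)
  exact X_ne_zero 0 this

theorem tc_pow_ne_one {n : ℕ} (hn : n ≠ 0) : tc ^ n ≠ 1 := by
  intro h
  have h1 : (X 0 ^ n : MvPolynomial (Fin 2) ℚ) = 1 := by
    apply algebraMap_QTQ_injective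
    rw [map_pow, map_one]
    exact h
  have h2 := congrArg totalDegree h1
  rw [totalDegree_X_pow, totalDegree_one] at h2
  exact hn h2

theorem one_sub_tc_ne_zero : 1 - tc ≠ 0 := by
  intro h
  exact tc_pow_ne_one one_ne_zero (by rw [pow_one]; exact (sub_eq_zero.mp h).symm)

theorem prime_t : Prime (X 0 : MvPolynomial (Fin 2) ℚ) := MvPolynomial.X_prime

theorem OrdGE.add {M : ℕ} {c d : QTQ} (hc : OrdGE M c) (hd : OrdGE M d) : OrdGE M (c + d) := by
  obtain ⟨A, B, hB, h⟩ := hc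
  obtain ⟨A', B', hB', h'⟩ := hd
  refine ⟨A * B' + A' * B, B * B', prime_t.not_dvd_mul hB hB', ?_⟩
  simp only [map_mul, map_add] at h h' ⊢
  linear_combination algebraMap _ QTQ B' * h + algebraMap _ QTQ B * h'

theorem OrdGE.zero (M : ℕ) : OrdGE M 0 :=
  ⟨0, 1, prime_t.not_dvd_one, by simp⟩

theorem OrdGE.mono {M N : ℕ} (h : M ≤ N) {c : QTQ} (hc : OrdGE N c) : OrdGE M c := by
  obtain ⟨A, B, hB, e⟩ := hc
  refine ⟨X 0 ^ (N - M) * A, B, hB, ?_⟩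
  rw [e, ← mul_assoc, ← pow_add, Nat.add_sub_cancel' h]

theorem ordGE_tc_pow (M : ℕ) : OrdGE M (tc ^ M) :=
  ⟨1, 1, prime_t.not_dvd_one, by simp [tc]⟩

/-- Multiplication by a fixed scalar lowers the order at `t = 0` by at most the order of its pole;
`N` is the exponent of `t` in a denominator of `d`. This makes `t`-adic convergence compatible with
scalar multiples. -/
theorem exists_ordGE_mul (d : QTQ) : ∃ N, ∀ M c, OrdGE (M + N) c → OrdGE M (d * c) := by
  obtain ⟨P, R, hR, rfl⟩ := IsFractionRing.div_surjective (A := MvPolynomial (Fin 2) ℚ) d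
  have hR0 : R ≠ 0 := nonZeroDivisors.ne_zero hR
  obtain ⟨N, B', hB', hRB⟩ := WfDvdMonoid.max_power_factor hR0 prime_t.irreducible
  refine ⟨N, fun M c ⟨A, B, hB, h⟩ => ⟨P * A, B' * B, prime_t.not_dvd_mul hB' hB, ?_⟩⟩
  have hR1 : algebraMap (MvPolynomial (Fin 2) ℚ) QTQ R ≠ 0 :=
    (map_ne_zero_iff _ algebraMap_QTQ_injective).mpr hR0
  have ht : algebraMap (MvPolynomial (Fin 2) ℚ) QTQ (X 0) ≠ 0 := tc_ne_zero
  rw [div_mul_eq_mul_div, div_mul_eq_mul_div, div_eq_iff hR1, hRB]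
  simp only [map_mul, map_pow] at h ⊢
  rw [pow_add] at h
  linear_combination (algebraMap _ QTQ P * algebraMap _ QTQ B') * h

/-- The `t`-adic topology is separated: a numerator of `c` would be divisible by every power of the
prime `t`. -/
theorem eq_zero_of_forall_ordGE {c : QTQ} (h : ∀ M, OrdGE M c) : c = 0 := by
  obtain ⟨P, R, hR, rfl⟩ := IsFractionRing.div_surjective (A := MvPolynomial (Fin 2) ℚ) c
  have hR0 : R ≠ 0 := nonZeroDivisors.ne_zero hR
  have hR1 : algebraMap (MvPolynomial (Fin 2) ℚ) QTQ R ≠ 0 :=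
    (map_ne_zero_iff _ algebraMap_QTQ_injective).mpr hR0
  by_contra hc
  have hP : P ≠ 0 := by
    rintro rfl
    simp at hc
  have hd : ∀ M, (X 0 : MvPolynomial (Fin 2) ℚ) ^ M ∣ P := by
    intro M
    obtain ⟨A, B, hB, e⟩ := h M
    rw [div_mul_eq_mul_div, div_eq_iff hR1, ← map_mul, ← map_mul] at e
    have e' := algebraMap_QTQ_injective e
    refine prime_t.pow_dvd_of_dvd_mul_right M hB ⟨A * R, ?_⟩
    rw [e']; ring
  obtain ⟨N, B', hB', hPB⟩ := WfDvdMonoid.max_power_factor hP prime_t.irreducible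
  have := hd (N + 1)
  rw [hPB, pow_succ] at this
  exact hB' ((mul_dvd_mul_iff_left (pow_ne_zero N (X_ne_zero 0))).mp this)

theorem coeffTendsto_const (c : QTQ) : CoeffTendsto (fun _ => c) c :=
  fun M => Eventually.of_forall fun _ => by rw [sub_self]; exact OrdGE.zero M

theorem CoeffTendsto.add {a a' : ℕ → QTQ} {b b' : QTQ} (h : CoeffTendsto a b)
    (h' : CoeffTendsto a' b') : CoeffTendsto (fun n => a n + a' n) (b + b') := fun M => by
  filter_upwards [h M, h' M] with n h1 h2
  have := h1.add h2
  rwa [sub_add_sub_comm] at this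

theorem CoeffTendsto.const_mul {a : ℕ → QTQ} {b : QTQ} (h : CoeffTendsto a b) (d : QTQ) :
    CoeffTendsto (fun n => d * a n) (d * b) := fun M => by
  obtain ⟨N, hN⟩ := exists_ordGE_mul d
  filter_upwards [h (M + N)] with n h1
  rw [← mul_sub]
  exact hN M _ h1

theorem CoeffTendsto.sum {ι : Type*} (s : Finset ι) {a : ι → ℕ → QTQ} {b : ι → QTQ}
    (h : ∀ i, CoeffTendsto (a i) (b i)) :
    CoeffTendsto (fun n => ∑ i ∈ s, a i n) (∑ i ∈ s, b i) := by
  classical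
  induction s using Finset.induction_on with
  | empty => simpa using coeffTendsto_const 0
  | insert i s hi ih =>
    simp only [Finset.sum_insert hi]
    exact (h i).add ih

theorem CoeffTendsto.congr' {a a' : ℕ → QTQ} {b : QTQ} (h : CoeffTendsto a b)
    (e : ∀ᶠ n in atTop, a n = a' n) : CoeffTendsto a' b := fun M => by
  filter_upwards [h M, e] with n h1 h2
  rwa [← h2]

theorem CoeffTendsto.unique {a : ℕ → QTQ} {b b' : QTQ} (h : CoeffTendsto a b)
    (h' : CoeffTendsto a b') : b = b' := by
  rw [← sub_eq_zero]
  apply eq_zero_of_forall_ordGE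
  have h1 := ((h.const_mul (-1)).add h')
  intro M
  obtain ⟨n, hn⟩ := (h1 M).exists
  convert hn using 1
  ring

theorem coeffTendsto_tc_pow : CoeffTendsto (fun m => tc ^ m) 0 := fun M => by
  filter_upwards [eventually_ge_atTop M] with n hn
  rw [sub_zero]
  exact (ordGE_tc_pow n).mono hn

/-! ### The ring `𝒫_∞^+` -/

theorem PInf.ext {F G : PInf} (h : ∀ m, proj F m = proj G m) : F = G :=
  Subtype.ext (funext h)

/-- Elements of `𝒫_∞^+` are determined by their images in rings of large rank. -/
theorem PInf.ext_of_le (N : ℕ) {F G : PInf} (h : ∀ m, N ≤ m → proj F m = proj G m) : F = G :=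
  PInf.ext fun m => by
    rw [← trunc_proj F (le_max_left m N), ← trunc_proj G (le_max_left m N),
      h _ (le_max_right m N)]

/-- `Π_m` as an algebra homomorphism. -/
def projHom (m : ℕ) : PInf →ₐ[QTQ] Poly where
  toFun F := proj F m
  map_one' := rfl
  map_mul' _ _ := rfl
  map_zero' := rfl
  map_add' _ _ := rfl
  commutes' _ := rfl

@[simp] theorem proj_add (F G : PInf) (m : ℕ) : proj (F + G) m = proj F m + proj G m := rfl
@[simp] theorem proj_sub (F G : PInf) (m : ℕ) : proj (F - G) m = proj F m - proj G m := rfl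
@[simp] theorem proj_mul (F G : PInf) (m : ℕ) : proj (F * G) m = proj F m * proj G m := rfl
@[simp] theorem proj_smul (c : QTQ) (F : PInf) (m : ℕ) : proj (c • F) m = c • proj F m := rfl
@[simp] theorem proj_zero (m : ℕ) : proj 0 m = 0 := rfl
@[simp] theorem proj_one (m : ℕ) : proj 1 m = 1 := rfl
@[simp] theorem proj_pow (F : PInf) (n m : ℕ) : proj (F ^ n) m = proj F m ^ n :=
  map_pow (projHom m) F n
@[simp] theorem proj_sum {ι : Type*} (s : Finset ι) (F : ι → PInf) (m : ℕ) :
    proj (∑ i ∈ s, F i) m = ∑ i ∈ s, proj (F i) m :=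
  map_sum (projHom m) F s

theorem proj_ofPoly (p : Poly) (m : ℕ) : proj (ofPoly p) m = trunc m p := rfl

theorem trunc_X_of_lt {j m : ℕ} (h : j < m) : trunc m (X j) = X j := by simp [trunc, h]

theorem trunc_X_of_le {j m : ℕ} (h : m ≤ j) : trunc m (X j) = 0 := by
  simp [trunc, Nat.not_lt.mpr h]

/-- The variable `x_{j+1}` as an element of `𝒫_∞^+`. -/
def xv (j : ℕ) : PInf := ofPoly (X j)

theorem proj_xv_of_lt {j m : ℕ} (h : j < m) : proj (xv j) m = X j := trunc_X_of_lt h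

/-- The map `𝒫 → 𝒫_∞^+` as an algebra homomorphism. -/
def ofPolyHom : Poly →ₐ[QTQ] PInf where
  toFun := ofPoly
  map_one' := PInf.ext fun m => map_one (trunc m)
  map_mul' _ _ := PInf.ext fun m => map_mul (trunc m) _ _
  map_zero' := PInf.ext fun m => map_zero (trunc m)
  map_add' _ _ := PInf.ext fun m => map_add (trunc m) _ _
  commutes' c := PInf.ext fun m => (trunc m).commutes c

instance : Nontrivial PInf :=
  ⟨0, 1, fun h => zero_ne_one (α := Poly) (congrArg (fun F => proj F 0) h)⟩

/-- A nonzero `Π_m F` forces `Π_n F ≠ 0` for all `n ≥ m`, and then `Π_n G = 0` for these `n`.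
Cancellation in `𝒫_∞^+` is what allows identities of Hecke operators to be proved after clearing the
denominators `x_i - x_j`. -/
instance : NoZeroDivisors PInf where
  eq_zero_or_eq_zero_of_mul_eq_zero {F G} h := by
    by_contra! hne
    obtain ⟨hF, hG⟩ := hne
    have h1 : ∃ m, proj F m ≠ 0 := by
      by_contra! h0
      exact hF (PInf.ext h0)
    obtain ⟨m, hm⟩ := h1
    apply hG
    apply PInf.ext_of_le m
    intro n hn
    have h2 : proj F n * proj G n = 0 := congrArg (fun F => proj F n) h
    refine (mul_eq_zero.mp h2).resolve_left fun h3 => hm ?_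
    rw [← trunc_proj F hn, h3, map_zero]

instance : IsDomain PInf := NoZeroDivisors.to_isDomain _

theorem xv_injective : Function.Injective xv := fun i j h => by
  have := congrArg (fun F => proj F (i + j + 1)) h
  beta_reduce at this
  rw [proj_xv_of_lt (by omega), proj_xv_of_lt (by omega)] at this
  exact X_injective this

/-! ### Coefficients of elements of the inverse limit and uniqueness of stable limits -/

theorem coeff_proj_of_le (F : PInf) {m n : ℕ} (h : m ≤ n) {d : ℕ →₀ ℕ}
    (hd : ∀ i ∈ d.support, i < m) : coeff d (proj F n) = coeff d (proj F m) := by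
  have key : ∀ f : Poly, coeff d (trunc m f) = coeff d f := by
    intro f
    induction f using MvPolynomial.induction_on' with
    | add p r hp hr => rw [map_add, coeff_add, coeff_add, hp, hr]
    | monomial e b =>
      by_cases he : ∀ i ∈ e.support, i < m
      · congr 1
        rw [trunc, aeval_monomial, monomial_eq, algebraMap_eq]
        congr 1
        exact Finset.prod_congr rfl fun i hi => by beta_reduce; rw [if_pos (he i hi)]
      · push Not at he
        obtain ⟨i, hi, hmi⟩ := he
        have hde : e ≠ d := by
          rintro rfl
          exact absurd (hd i hi) (by omega)
        rw [coeff_monomial, if_neg hde, trunc, aeval_monomial, Finsupp.prod,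
          Finset.prod_eq_zero hi, mul_zero, coeff_zero]
        rw [if_neg (by omega), zero_pow (Finsupp.mem_support_iff.mp hi)]
  rw [← trunc_proj F h, key]

/-- A stable limit is also a coefficientwise `t`-adic limit, because each coefficient of `Π_m F` is
independent of `m` once its variables are present. Uniqueness is then inherited from the field. -/
theorem HasStableLimit.unique {f : ℕ → Poly} {F G : PInf} (hF : HasStableLimit f F)
    (hG : HasStableLimit f G) : F = G := by
  have key : ∀ {F : PInf}, HasStableLimit f F → ∀ (d : ℕ →₀ ℕ) (n : ℕ),
      (∀ i ∈ d.support, i < n) → CoeffTendsto (fun m => coeff d (f m)) (coeff d (proj F n)) := by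
    rintro F ⟨N, h, g, a, b, -, hab, hf, rfl⟩ d n hd
    have h1 := (coeffTendsto_const (coeff d (proj h n))).add
      (CoeffTendsto.sum Finset.univ fun i => (hab i).const_mul (coeff d (proj (g i) n)))
    have h2 := h1.congr' (a' := fun m => coeff d (f m)) (by
      filter_upwards [hf, eventually_ge_atTop n] with m hm hn
      rw [hm, coeff_add, coeff_sum, coeff_proj_of_le h hn hd]
      congr 1
      refine Finset.sum_congr rfl fun i _ => ?_
      rw [coeff_smul, coeff_proj_of_le (g i) hn hd, smul_eq_mul, mul_comm])
    convert h2 using 1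
    rw [proj_add, proj_sum, coeff_add, coeff_sum]
    congr 1
    refine Finset.sum_congr rfl fun i _ => ?_
    rw [proj_smul, coeff_smul, smul_eq_mul, mul_comm]
  apply PInf.ext
  intro m
  ext d
  by_cases hd : ∀ i ∈ d.support, i < m
  · exact (key hF d m hd).unique (key hG d m hd)
  -- A monomial containing a variable beyond the first `m` cannot occur in `Π_m F`, which is fixed
  -- by the truncation.
  · have h0 : ∀ F : PInf, coeff d (proj F m) = 0 := by
      intro F
      push Not at hd
      obtain ⟨i, hi, hmi⟩ := hd
      by_contra hne
      have hv : i ∈ (proj F m).vars := by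
        rw [mem_vars_iff_mem_support]
        exact ⟨d, mem_support_iff.mpr hne, hi⟩
      rw [← trunc_proj F le_rfl, trunc, aeval_eq_bind₁] at hv
      have := vars_bind₁ (R := QTQ) (fun j => if j < m then X j else 0) (proj F m) hv
      rw [Finset.mem_biUnion] at this
      obtain ⟨j, -, hj⟩ := this
      split_ifs at hj
      · rw [vars_X, Finset.mem_singleton] at hj
        omega
      · simp at hj
    rw [h0, h0]

theorem calY_eq {i : ℕ} {F G : PInf} (h : HasStableLimit (fun m => polyY m i (proj F m)) G) :
    calY i F = G := by
  have hex : ∃ G, HasStableLimit (fun m => polyY m i (proj F m)) G := ⟨G, h⟩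
  rw [calY, dif_pos hex]
  exact (Classical.choose_spec hex).unique h

/-! ### Substitutions in `𝒫_∞^+` -/

/-- The substitution `x_{j+1} ↦ φ j` makes sense on `𝒫_∞^+`. -/
structure Admissible (φ : ℕ → Poly) : Prop where
  totalDegree_le : ∀ j, (φ j).totalDegree ≤ 1
  exists_tail : ∃ s, ∀ m j, m + s ≤ j → trunc m (φ j) = 0

theorem totalDegree_aeval_le {φ : ℕ → Poly} (h : ∀ j, (φ j).totalDegree ≤ 1) (f : Poly) :
    (aeval φ f).totalDegree ≤ f.totalDegree := by
  rw [aeval_def, eval₂_eq]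
  refine (totalDegree_finsetSum _ _).trans (Finset.sup_le fun d hd => ?_)
  refine le_trans ?_ (le_totalDegree hd)
  refine (totalDegree_mul _ _).trans ?_
  rw [algebraMap_eq, totalDegree_C, zero_add, Finsupp.sum]
  refine (totalDegree_finsetProd _ _).trans (Finset.sum_le_sum fun j _ => ?_)
  refine (totalDegree_pow _ _).trans ?_
  simpa using Nat.mul_le_mul_left (d j) (h j)

/-- Both sides are algebra homomorphisms in `f`, and the variables lost on the left are sent to zero
on the right. This is why an admissible substitution descends to the inverse limit. -/
theorem trunc_aeval_trunc {φ : ℕ → Poly} {m n : ℕ} (h : ∀ j, n ≤ j → trunc m (φ j) = 0)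
    (f : Poly) : trunc m (aeval φ (trunc n f)) = trunc m (aeval φ f) := by
  have : ((trunc m).comp (aeval φ)).comp (trunc n) = (trunc m).comp (aeval φ) := by
    apply MvPolynomial.algHom_ext
    intro j
    simp only [AlgHom.comp_apply, trunc, aeval_X]
    split_ifs with hj
    · rw [aeval_X]
    · have := h j (by omega)
      rw [trunc] at this
      rw [map_zero, map_zero, this]
  exact congrArg (fun ψ => ψ f) this

/-- The substitution `x_{j+1} ↦ φ j` on `𝒫_∞^+`. -/
def subst (φ : ℕ → Poly) (h : Admissible φ) : PInf →ₐ[QTQ] PInf where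
  toFun F := ⟨fun m => trunc m (aeval φ (proj F (m + h.exists_tail.choose))), fun m => by
      have hs := h.exists_tail.choose_spec
      beta_reduce
      rw [trunc_trunc, min_eq_left (Nat.le_succ m),
        ← trunc_aeval_trunc (n := m + h.exists_tail.choose) (hs m), trunc_proj F (by omega)], by
      obtain ⟨d, hd⟩ := F.2.2
      exact ⟨d, fun m => (totalDegree_trunc_le _ _).trans
        ((totalDegree_aeval_le h.totalDegree_le _).trans (hd _))⟩⟩
  map_one' := PInf.ext fun m => by
    change trunc m (aeval φ (1 : Poly)) = 1
    rw [map_one, map_one]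
  map_mul' F G := PInf.ext fun m => by
    change trunc m (aeval φ (_ * _)) = _
    rw [map_mul, map_mul]
    rfl
  map_zero' := PInf.ext fun m => by
    change trunc m (aeval φ (0 : Poly)) = 0
    rw [map_zero, map_zero]
  map_add' F G := PInf.ext fun m => by
    change trunc m (aeval φ (_ + _)) = _
    rw [map_add, map_add]
    rfl
  commutes' c := PInf.ext fun m => ((trunc m).comp (aeval φ)).commutes c

/-- The cutoff inside `subst` comes from a choice; any other valid cutoff gives the same result, by
comparison with the larger of the two. -/
theorem proj_subst {φ : ℕ → Poly} (h : Admissible φ) {m n : ℕ}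
    (hn : ∀ j, n ≤ j → trunc m (φ j) = 0) (F : PInf) :
    proj (subst φ h F) m = trunc m (aeval φ (proj F n)) := by
  have hs := h.exists_tail.choose_spec m
  change trunc m (aeval φ (proj F (m + h.exists_tail.choose))) = _
  set s := m + h.exists_tail.choose
  rw [← trunc_proj F (le_max_left s n), ← trunc_proj F (le_max_right s n),
    trunc_aeval_trunc hs, trunc_aeval_trunc hn]

/-- A substitution which permutes the variables of `𝒫_m^+` up to scalars is computed in `𝒫_m^+`. -/
theorem proj_subst_self {φ : ℕ → Poly} (h : Admissible φ) {m : ℕ}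
    (hn : ∀ j, m ≤ j → trunc m (φ j) = 0) (hm : ∀ j, j < m → trunc m (φ j) = φ j) (F : PInf) :
    proj (subst φ h F) m = aeval φ (proj F m) := by
  rw [proj_subst h hn, ← trunc_proj F le_rfl]
  have : ((trunc m).comp (aeval φ)).comp (trunc m) = (aeval φ).comp (trunc m) := by
    apply MvPolynomial.algHom_ext
    intro j
    simp only [AlgHom.comp_apply]
    by_cases hj : j < m
    · rw [trunc_X_of_lt hj, aeval_X, hm j hj]
    · rw [trunc_X_of_le (by omega), map_zero, map_zero]
  exact congrArg (fun ψ => ψ (proj F m)) this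

theorem subst_ofPoly {φ : ℕ → Poly} (h : Admissible φ) (p : Poly) :
    subst φ h (ofPoly p) = ofPoly (aeval φ p) := by
  obtain ⟨s, hs⟩ := h.exists_tail
  refine PInf.ext fun m => ?_
  rw [proj_subst h (hs m), proj_ofPoly, trunc_aeval_trunc (hs m), proj_ofPoly]

theorem subst_xv {φ : ℕ → Poly} (h : Admissible φ) (j : ℕ) : subst φ h (xv j) = ofPoly (φ j) := by
  rw [xv, subst_ofPoly, aeval_X]

/-- Reduces identities between composite substitutions on `𝒫_∞^+`, which is not generated by the
variables, to a check on the variables. -/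
theorem subst_subst {φ ψ χ : ℕ → Poly} (hφ : Admissible φ) (hψ : Admissible ψ)
    (hχ : Admissible χ) (h : ∀ j, aeval φ (ψ j) = χ j) (F : PInf) :
    subst φ hφ (subst ψ hψ F) = subst χ hχ F := by
  obtain ⟨s, hs⟩ := hφ.exists_tail
  obtain ⟨s', hs'⟩ := hψ.exists_tail
  obtain ⟨s'', hs''⟩ := hχ.exists_tail
  refine PInf.ext fun m => ?_
  have e : (aeval φ : Poly →ₐ[QTQ] Poly).comp (aeval ψ) = aeval χ := by
    apply MvPolynomial.algHom_ext
    intro j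
    rw [AlgHom.comp_apply, aeval_X, aeval_X, h]
  rw [proj_subst hφ (hs m), proj_subst (n := m + s + s' + s'') hψ
    (fun j hj => hs' _ j (by omega)), trunc_aeval_trunc (hs m),
    proj_subst (n := m + s + s' + s'') hχ (fun j hj => hs'' _ j (by omega)), ← e,
    AlgHom.comp_apply]

theorem admissible_of_X {φ : ℕ → Poly} (s : ℕ)
    (h : ∀ j, (∃ i, j ≤ i + s ∧ φ j = X i) ∨ (φ j).totalDegree ≤ 1 ∧ j < s) : Admissible φ where
  totalDegree_le j := by
    rcases h j with ⟨i, -, h⟩ | ⟨h, -⟩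
    · rw [h, totalDegree_X]
    · exact h
  exists_tail := ⟨s, fun m j hj => by
    rcases h j with ⟨i, hi, h⟩ | ⟨-, h⟩
    · rw [h, trunc_X_of_le (by omega)]
    · omega⟩

theorem admissible_X : Admissible (X : ℕ → Poly) :=
  admissible_of_X 0 fun j => Or.inl ⟨j, le_rfl, rfl⟩

theorem subst_X (F : PInf) : subst X admissible_X F = F := by
  refine PInf.ext fun m => ?_
  rw [proj_subst (n := m) admissible_X fun j hj => trunc_X_of_le hj, aeval_X_left_apply,
    trunc_proj F le_rfl]

/-! #### Permutations of the variables -/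

theorem admissible_swap (i : ℕ) : Admissible (fun j => X (Equiv.swap i (i + 1) j)) :=
  admissible_of_X 1 fun j => Or.inl ⟨_, by
    rcases eq_or_ne j i with rfl | h1
    · rw [Equiv.swap_apply_left]; omega
    · rcases eq_or_ne j (i + 1) with rfl | h2
      · rw [Equiv.swap_apply_right]
      · rw [Equiv.swap_apply_of_ne_of_ne h1 h2]; omega, rfl⟩

/-- The simple transposition exchanging `x_{i+1}` and `x_{i+2}` on `𝒫_∞^+`. -/
def swp (i : ℕ) : PInf →ₐ[QTQ] PInf := subst _ (admissible_swap i)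

theorem swap_lt {i j m : ℕ} (h : i + 1 < m) (hj : j < m) : Equiv.swap i (i + 1) j < m := by
  rcases eq_or_ne j i with rfl | h1
  · rwa [Equiv.swap_apply_left]
  · rcases eq_or_ne j (i + 1) with rfl | h2
    · rw [Equiv.swap_apply_right]; omega
    · rwa [Equiv.swap_apply_of_ne_of_ne h1 h2]

theorem swapVar_eq_aeval (i : ℕ) : swapVar i = aeval fun j => X (Equiv.swap i (i + 1) j) := by
  apply MvPolynomial.algHom_ext
  intro j
  rw [swapVar, rename_X, aeval_X]

theorem proj_swp {i m : ℕ} (h : i + 1 < m) (F : PInf) : proj (swp i F) m = swapVar i (proj F m) := by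
  rw [swp, proj_subst_self, swapVar_eq_aeval]
  · intro j hj
    rw [Equiv.swap_apply_of_ne_of_ne (by omega) (by omega), trunc_X_of_le hj]
  · intro j hj
    exact trunc_X_of_lt (swap_lt h hj)

theorem swp_xv (i j : ℕ) : swp i (xv j) = xv (Equiv.swap i (i + 1) j) := subst_xv _ _

@[simp] theorem swp_xv_left (i : ℕ) : swp i (xv i) = xv (i + 1) := by
  rw [swp_xv, Equiv.swap_apply_left]

@[simp] theorem swp_xv_right (i : ℕ) : swp i (xv (i + 1)) = xv i := by
  rw [swp_xv, Equiv.swap_apply_right]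

theorem swp_xv_of_ne {i j : ℕ} (h1 : j ≠ i) (h2 : j ≠ i + 1) : swp i (xv j) = xv j := by
  rw [swp_xv, Equiv.swap_apply_of_ne_of_ne h1 h2]

theorem swp_swp (i : ℕ) (F : PInf) : swp i (swp i F) = F := by
  rw [swp, subst_subst _ _ admissible_X (fun j => ?_), subst_X]
  rw [aeval_X, Equiv.swap_apply_self]

theorem swp_comm {i j : ℕ} (h : i + 1 < j) (F : PInf) :
    swp i (swp j F) = swp j (swp i F) := by
  apply PInf.ext_of_le (j + 2)
  intro m hm
  rw [proj_swp (by omega), proj_swp (by omega), proj_swp (by omega), proj_swp (by omega),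
    swapVar, swapVar, rename_rename, rename_rename]
  congr 2
  funext a
  simp only [Function.comp, Equiv.swap_apply_def]
  grind

theorem swp_braid (i : ℕ) (F : PInf) :
    swp i (swp (i + 1) (swp i F)) = swp (i + 1) (swp i (swp (i + 1) F)) := by
  apply PInf.ext_of_le (i + 3)
  intro m hm
  simp only [proj_swp (show i + 1 < m by omega), proj_swp (show i + 1 + 1 < m by omega)]
  rw [swapVar, swapVar, rename_rename, rename_rename, rename_rename, rename_rename]
  congr 2
  funext a
  simp only [Function.comp, Equiv.swap_apply_def]
  grind

/-! ### The Hecke operators on `𝒫_∞^+` -/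

theorem xv_sub_ne_zero {i j : ℕ} (h : i ≠ j) : xv i - xv j ≠ 0 :=
  sub_ne_zero.mpr fun e => h (xv_injective e)

/-- The form of the Hecke operator without divided differences. As `𝒫_∞^+` is a domain it
characterizes `T_i` (`eq_calT`), and the Hecke relations become polynomial identities in the
variables and the permuted copies of `F`. -/
theorem calT_spec (i : ℕ) (F : PInf) :
    (xv i - xv (i + 1)) * calT i F =
      (tc • xv i - xv (i + 1)) * swp i F + (1 - tc) • (xv i * F) := by
  apply PInf.ext_of_le (i + 2)
  intro m hm
  simp only [proj_mul, proj_sub, proj_add, proj_smul, proj_xv_of_lt (show i < m by omega),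
    proj_xv_of_lt (show i + 1 < m by omega), proj_swp (show i + 1 < m by omega),
    proj_calT (show i + 1 < m by omega)]
  have h5 : polyT i (proj F m) = swapVar i (proj F m) + (1 - tc) • (X i * divDiff i (proj F m)) :=
    rfl
  have h6 := X_sub_X_mul_divDiff i (proj F m)
  rw [h5]
  simp only [smul_eq_C_mul, C_sub, C_1]
  linear_combination (1 - C tc) * X i * h6

theorem eq_calT {i : ℕ} {F G : PInf} (h : (xv i - xv (i + 1)) * G =
      (tc • xv i - xv (i + 1)) * swp i F + (1 - tc) • (xv i * F)) : G = calT i F := by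
  apply mul_left_cancel₀ (xv_sub_ne_zero (show i ≠ i + 1 by omega))
  rw [h, calT_spec]

theorem calT_mul_of_swp {i : ℕ} {c : PInf} (hc : swp i c = c) (F : PInf) :
    calT i (c * F) = c * calT i F := by
  symm
  apply eq_calT
  have := calT_spec i F
  rw [map_mul, hc]
  simp only [Algebra.smul_def] at *
  linear_combination c * this

theorem calT_eq_self_iff_swp (i : ℕ) (F : PInf) : calT i F = F ↔ swp i F = F := by
  rw [calT_eq_self_iff]
  constructor
  · intro h
    refine PInf.ext_of_le (i + 2) fun m hm => ?_
    rw [proj_swp (by omega), h m (by omega)]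
  · intro h m hm
    rw [← proj_swp hm, h]

/-- `T_i x_{i+1} = x_i (T_i + t - 1)`. -/
theorem calT_xv_succ_mul (i : ℕ) (F : PInf) :
    calT i (xv (i + 1) * F) = xv i * (calT i F + (tc - 1) • F) := by
  symm
  apply eq_calT
  have := calT_spec i F
  rw [map_mul, swp_xv_right]
  simp only [Algebra.smul_def, map_sub, map_one] at *
  linear_combination xv i * this

/-- `T_i x_i = x_{i+1} T_i + (1 - t) x_i`. -/
theorem calT_xv_mul (i : ℕ) (F : PInf) :
    calT i (xv i * F) = xv (i + 1) * calT i F + (1 - tc) • (xv i * F) := by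
  symm
  apply eq_calT
  have := calT_spec i F
  rw [map_mul, swp_xv_left]
  simp only [Algebra.smul_def, map_sub, map_one] at *
  linear_combination xv (i + 1) * this

theorem calT_xv_mul_of_ne {i j : ℕ} (h1 : j ≠ i) (h2 : j ≠ i + 1) (F : PInf) :
    calT i (xv j * F) = xv j * calT i F :=
  calT_mul_of_swp (swp_xv_of_ne h1 h2) F

theorem swp_calT (i : ℕ) (F : PInf) :
    (xv (i + 1) - xv i) * swp i (calT i F) =
      (tc • xv (i + 1) - xv i) * F + (1 - tc) • (xv (i + 1) * swp i F) := by
  have := congrArg (swp i) (calT_spec i F)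
  simpa only [map_mul, map_sub, map_add, map_smul, swp_xv_left, swp_xv_right, swp_swp] using this

theorem calT_quad (i : ℕ) (F : PInf) :
    calT i (calT i F) = (1 - tc) • calT i F + tc • F := by
  symm
  apply eq_calT
  apply mul_left_cancel₀ (xv_sub_ne_zero (show i ≠ i + 1 by omega))
  have h1 := calT_spec i F
  have h2 := swp_calT i F
  simp only [Algebra.smul_def, map_sub, map_one] at *
  set t := algebraMap QTQ PInf tc
  linear_combination (t * xv i - xv (i+1)) * h2 + ((1-t) * (xv i - xv (i+1)) - (1-t) * xv i) * h1

theorem swp_calT_comm {i j : ℕ} (h : i + 1 < j ∨ j + 1 < i) (F : PInf) :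
    swp i (calT j F) = calT j (swp i F) := by
  apply eq_calT
  have := congrArg (swp i) (calT_spec j F)
  have e : swp i (swp j F) = swp j (swp i F) := by
    rcases h with h | h
    · exact swp_comm h F
    · exact (swp_comm h F).symm
  simpa only [map_mul, map_sub, map_add, map_smul, swp_xv_of_ne (show j ≠ i by omega)
    (show j ≠ i + 1 by omega), swp_xv_of_ne (show j + 1 ≠ i by omega)
    (show j + 1 ≠ i + 1 by omega), e] using this

theorem calT_comm {i j : ℕ} (h : i + 1 < j ∨ j + 1 < i) (F : PInf) :
    calT i (calT j F) = calT j (calT i F) := by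
  apply mul_left_cancel₀ (xv_sub_ne_zero (show i ≠ i + 1 by omega))
  rw [← calT_mul_of_swp (i := j) (c := xv i - xv (i + 1)), calT_spec, calT_spec, map_add,
    map_smul, calT_mul_of_swp, calT_mul_of_swp, swp_calT_comm h]
  · exact swp_xv_of_ne (by omega) (by omega)
  · rw [map_sub, map_smul, swp_xv_of_ne (by omega) (by omega), swp_xv_of_ne (by omega) (by omega)]
  · rw [map_sub, swp_xv_of_ne (by omega) (by omega), swp_xv_of_ne (by omega) (by omega)]

/-- Each side is expanded as a combination of the images of `F` under the symmetric group on three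
letters. The instances `a_j` and `b_j` of `calT_spec`, with their images under the transpositions,
supply all intermediate terms; the braid relation of the symmetric group merges the two longest
words. -/
theorem calT_braid (i : ℕ) (F : PInf) :
    calT i (calT (i + 1) (calT i F)) = calT (i + 1) (calT i (calT (i + 1) F)) := by
  have hbr := swp_braid i F
  have hA : ∀ G, (xv i - xv (i + 1)) * calT i G =
      (tc • xv i - xv (i + 1)) * swp i G + (1 - tc) • (xv i * G) := calT_spec i
  have hB : ∀ G, (xv (i + 1) - xv (i + 2)) * calT (i + 1) G =
      (tc • xv (i + 1) - xv (i + 2)) * swp (i + 1) G + (1 - tc) • (xv (i + 1) * G) :=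
    calT_spec (i + 1)
  have e1 : swp i (xv (i + 2)) = xv (i + 2) := swp_xv_of_ne (by omega) (by omega)
  have e2 : swp (i + 1) (xv i) = xv i := swp_xv_of_ne (by omega) (by omega)
  have e3 : swp (i + 1) (xv (i + 1)) = xv (i + 2) := swp_xv_left _
  have e4 : swp (i + 1) (xv (i + 2)) = xv (i + 1) := swp_xv_right _
  have e5 : swp i (xv i) = xv (i + 1) := swp_xv_left _
  have e6 : swp i (xv (i + 1)) = xv i := swp_xv_right _
  have hxy := xv_sub_ne_zero (show i ≠ i + 1 by omega)
  have hyz := xv_sub_ne_zero (show i + 1 ≠ i + 2 by omega)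
  have hxz := xv_sub_ne_zero (show i ≠ i + 2 by omega)
  have a1 := hA F
  have a2 := congrArg (swp i) a1
  have a3 := congrArg (swp (i + 1)) a1
  have a4 := congrArg (swp i) a3
  have a5 := hB (calT i F)
  have a6 := congrArg (swp i) a5
  have a7 := hA (calT (i + 1) (calT i F))
  have b1 := hB F
  have b2 := congrArg (swp (i + 1)) b1
  have b3 := congrArg (swp i) b1
  have b4 := congrArg (swp (i + 1)) b3
  have b5 := hA (calT (i + 1) F)
  have b6 := congrArg (swp (i + 1)) b5
  have b7 := hB (calT i (calT (i + 1) F))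
  simp only [map_mul, map_sub, map_add, map_smul, swp_swp, e1, e2, e3, e4, e5, e6]
    at a2 a3 a4 a6 b2 b3 b4 b6
  rw [hbr] at a4
  simp only [Algebra.smul_def, map_sub, map_one] at *
  clear hA hB e1 e2 e3 e4 e5 e6 hbr
  set t := algebraMap QTQ PInf tc
  generalize xv i = x at *
  generalize xv (i + 1) = y at *
  generalize xv (i + 2) = z at *
  -- Expansions with cleared denominators of both two-letter words; the primed versions are their
  -- images under the next transposition.
  have hG2 : (x - y) * (x - z) * ((y - z) * calT (i + 1) (calT i F)) =
      (t * y - z) * (x - y) * ((t * x - z) * swp (i + 1) (swp i F) + (1 - t) * (x * swp (i + 1) F))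
      + (1 - t) * y * (x - z) * ((t * x - y) * swp i F + (1 - t) * (x * F)) := by
    linear_combination (x - y) * (x - z) * a5 + (t * y - z) * (x - y) * a3
      + (1 - t) * y * (x - z) * a1
  have hG2' : (x - y) * (y - z) * ((x - z) * swp i (calT (i + 1) (calT i F))) =
      (t * x - z) * (x - y) * ((t * y - z) * swp (i + 1) (swp i (swp (i + 1) F))
        + (1 - t) * (y * swp i (swp (i + 1) F)))
      - (1 - t) * x * (y - z) * ((t * y - x) * F + (1 - t) * (y * swp i F)) := by
    linear_combination (x - y) * (y - z) * a6 + (t * x - z) * (x - y) * a4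
      - (1 - t) * x * (y - z) * a2
  have hH2 : (y - z) * (x - z) * ((x - y) * calT i (calT (i + 1) F)) =
      (t * x - y) * (y - z) * ((t * x - z) * swp i (swp (i + 1) F) + (1 - t) * (x * swp i F))
      + (1 - t) * x * (x - z) * ((t * y - z) * swp (i + 1) F + (1 - t) * (y * F)) := by
    linear_combination (y - z) * (x - z) * b5 + (t * x - y) * (y - z) * b3
      + (1 - t) * x * (x - z) * b1
  have hH2' : (y - z) * (x - y) * ((x - z) * swp (i + 1) (calT i (calT (i + 1) F))) =
      (t * x - z) * (y - z) * ((t * x - y) * swp (i + 1) (swp i (swp (i + 1) F))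
        + (1 - t) * (x * swp (i + 1) (swp i F)))
      - (1 - t) * x * (x - y) * ((t * z - y) * F + (1 - t) * (z * swp (i + 1) F)) := by
    linear_combination (y - z) * (x - y) * b6 + (t * x - z) * (y - z) * b4
      - (1 - t) * x * (x - y) * b2
  apply mul_left_cancel₀ (mul_ne_zero (mul_ne_zero (mul_ne_zero hxy hxy) (mul_ne_zero hyz hyz)) hxz)
  linear_combination (x - y) * (y - z) ^ 2 * (x - z) * a7
    + (t * x - y) * (y - z) * hG2' + (1 - t) * x * (y - z) * hG2
    - (x - y) ^ 2 * (y - z) * (x - z) * b7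
    - (t * y - z) * (x - y) * hH2' - (1 - t) * y * (x - y) * hH2

/-! #### The Hecke algebra -/

/-- `T_i⁻¹ = t⁻¹ (T_i + t - 1)` on `𝒫_∞^+`. -/
def calTInv (i : ℕ) : PInf →ₗ[QTQ] PInf := tc⁻¹ • (calT i + (tc - 1) • LinearMap.id)

theorem calTInv_apply (i : ℕ) (F : PInf) : calTInv i F = tc⁻¹ • (calT i F + (tc - 1) • F) := rfl

theorem calTInv_calT (i : ℕ) (F : PInf) : calTInv i (calT i F) = F := by
  rw [calTInv_apply, calT_quad, inv_smul_eq_iff₀ tc_ne_zero]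
  module

theorem calT_calTInv (i : ℕ) (F : PInf) : calT i (calTInv i F) = F := by
  rw [calTInv_apply, map_smul, map_add, map_smul, calT_quad, inv_smul_eq_iff₀ tc_ne_zero]
  module

theorem tc_smul_calTInv (i : ℕ) (F : PInf) : tc • calTInv i F = calT i F + (tc - 1) • F := by
  rw [calTInv_apply, smul_inv_smul₀ tc_ne_zero]

/-- `T_1 T_2 ⋯ T_n` on `𝒫_∞^+`. -/
def calTAsc : ℕ → (PInf →ₗ[QTQ] PInf)
  | 0 => LinearMap.id
  | n + 1 => calTAsc n ∘ₗ calT n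

/-- `T_n ⋯ T_2 T_1` on `𝒫_∞^+`. -/
def calTDesc : ℕ → (PInf →ₗ[QTQ] PInf)
  | 0 => LinearMap.id
  | n + 1 => calT n ∘ₗ calTDesc n

/-- `T_n⁻¹ ⋯ T_2⁻¹ T_1⁻¹` on `𝒫_∞^+`. -/
def calTInvDesc : ℕ → (PInf →ₗ[QTQ] PInf)
  | 0 => LinearMap.id
  | n + 1 => calTInv n ∘ₗ calTInvDesc n

theorem calTAsc_succ (n : ℕ) (F : PInf) : calTAsc (n + 1) F = calTAsc n (calT n F) := rfl
theorem calTDesc_succ (n : ℕ) (F : PInf) : calTDesc (n + 1) F = calT n (calTDesc n F) := rfl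
theorem calTInvDesc_succ (n : ℕ) (F : PInf) :
    calTInvDesc (n + 1) F = calTInv n (calTInvDesc n F) := rfl

theorem calTInvDesc_calTAsc (n : ℕ) (F : PInf) : calTInvDesc n (calTAsc n F) = F := by
  induction n generalizing F with
  | zero => rfl
  | succ n ih => rw [calTAsc_succ, calTInvDesc_succ, ih, calTInv_calT]

theorem calTAsc_calTInvDesc (n : ℕ) (F : PInf) : calTAsc n (calTInvDesc n F) = F := by
  induction n generalizing F with
  | zero => rfl
  | succ n ih => rw [calTAsc_succ, calTInvDesc_succ, calT_calTInv, ih]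

/-- Multiplication by a function of the later variables commutes with `T_1 ⋯ T_n`. -/
theorem calTAsc_mul {n : ℕ} {c : PInf} (hc : ∀ i, i < n → swp i c = c) (F : PInf) :
    calTAsc n (c * F) = c * calTAsc n F := by
  induction n generalizing F with
  | zero => rfl
  | succ n ih =>
    rw [calTAsc_succ, calT_mul_of_swp (hc n (by omega)), ih fun i hi => hc i (by omega)]
    rfl

theorem calTAsc_xv_mul {n j : ℕ} (h : n < j) (F : PInf) :
    calTAsc n (xv j * F) = xv j * calTAsc n F :=
  calTAsc_mul (fun i hi => swp_xv_of_ne (by omega) (by omega)) F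

theorem calTAsc_calT_of_lt {n i : ℕ} (h : n < i) (F : PInf) :
    calTAsc n (calT i F) = calT i (calTAsc n F) := by
  induction n generalizing F with
  | zero => rfl
  | succ n ih => rw [calTAsc_succ, calT_comm (Or.inl (by omega)), ih (by omega), calTAsc_succ]

/-- Far commutation moves `T_{i+1}` to the left until it meets `T_{i+1} T_{i+2}`; there the braid
relation raises its index by one. -/
theorem calTAsc_calT {n i : ℕ} (h : i + 1 < n) (F : PInf) :
    calTAsc n (calT i F) = calT (i + 1) (calTAsc n F) := by
  induction n generalizing F with
  | zero => omega
  | succ n ih =>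
    rw [calTAsc_succ, calTAsc_succ]
    rcases Nat.lt_or_ge (i + 1) n with hi | hi
    · rw [calT_comm (Or.inr hi), ih hi]
    · obtain rfl : n = i + 1 := by omega
      rw [calTAsc_succ, calTAsc_succ, calT_braid, calTAsc_calT_of_lt (Nat.lt_succ_self i)]

/-- `T_1 (T_1 ⋯ T_{k+1}) (T_1 ⋯ T_k) = (T_1 ⋯ T_{k+1}) (T_1 ⋯ T_k) T_{k+1}`. -/
theorem calT_calTAsc_calTAsc (k : ℕ) (F : PInf) :
    calT 0 (calTAsc (k + 1) (calTAsc k F)) = calTAsc (k + 1) (calTAsc k (calT k F)) := by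
  induction k generalizing F with
  | zero => rfl
  | succ k ih =>
    have hc : ∀ G, calT (k + 1) (calTAsc k G) = calTAsc k (calT (k + 1) G) :=
      fun G => (calTAsc_calT_of_lt (Nat.lt_succ_self k) G).symm
    rw [calTAsc_succ (k + 1), calTAsc_succ (k + 1), calTAsc_succ k F,
      calTAsc_succ k (calT (k + 1) F), hc, hc, ih, calT_braid]

/-- `T_1 ⋯ T_n x_{n+1} = t^n x_1 T_1⁻¹ ⋯ T_n⁻¹`, applied to `T_n ⋯ T_1`. -/
theorem calTAsc_xv_calTDesc (n : ℕ) (F : PInf) :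
    calTAsc n (xv n * calTDesc n F) = tc ^ n • (xv 0 * F) := by
  induction n generalizing F with
  | zero => simp [calTAsc, calTDesc]
  | succ n ih =>
    rw [calTAsc_succ, calTDesc_succ, calT_xv_succ_mul, calT_quad]
    have : (1 - tc) • calT n (calTDesc n F) + tc • calTDesc n F +
        (tc - 1) • calT n (calTDesc n F) = tc • calTDesc n F := by module
    rw [this, mul_smul_comm, map_smul, ih, smul_smul, pow_succ']

theorem Admissible.comp {φ ψ : ℕ → Poly} (hφ : Admissible φ) (hψ : Admissible ψ) :
    Admissible fun j => aeval φ (ψ j) where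
  totalDegree_le j := (totalDegree_aeval_le hφ.totalDegree_le _).trans (hψ.totalDegree_le j)
  exists_tail := by
    obtain ⟨s, hs⟩ := hφ.exists_tail
    obtain ⟨s', hs'⟩ := hψ.exists_tail
    refine ⟨s + s', fun m j hj => ?_⟩
    rw [← trunc_aeval_trunc (hs m), hs' _ _ (by omega), map_zero, map_zero]

theorem subst_subst_comm {φ ψ φ' ψ' : ℕ → Poly} (hφ : Admissible φ) (hψ : Admissible ψ)
    (hφ' : Admissible φ') (hψ' : Admissible ψ')
    (h : ∀ j, aeval φ (ψ j) = aeval φ' (ψ' j)) (F : PInf) :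
    subst φ hφ (subst ψ hψ F) = subst φ' hφ' (subst ψ' hψ' F) := by
  rw [subst_subst hφ hψ (hφ'.comp hψ') h, subst_subst hφ' hψ' (hφ'.comp hψ') fun _ => rfl]

/-! ### The spaces `𝒫(k)^+` -/

theorem mem_PSym {k : ℕ} {F : PInf} : F ∈ PSym k ↔ ∀ i, k ≤ i → swp i F = F := by
  constructor
  · intro h i hi
    exact (calT_eq_self_iff_swp i F).mp (h i hi)
  · intro h i hi
    exact (calT_eq_self_iff_swp i F).mpr (h i hi)

theorem swp_of_mem {k i : ℕ} {F : PInf} (hF : F ∈ PSym k) (hi : k ≤ i) : swp i F = F :=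
  mem_PSym.mp hF i hi

theorem calT_of_mem {k i : ℕ} {F : PInf} (hF : F ∈ PSym k) (hi : k ≤ i) : calT i F = F := hF i hi

theorem PSym_mono {k l : ℕ} (h : k ≤ l) : PSym k ≤ PSym l :=
  fun _ hF i hi => hF i (h.trans hi)

theorem mem_succ {k : ℕ} {F : PInf} (hF : F ∈ PSym k) : F ∈ PSym (k + 1) := PSym_le_succ k hF

theorem xv_mem {j k : ℕ} (h : j < k) : xv j ∈ PSym k :=
  mem_PSym.mpr fun i hi => swp_xv_of_ne (by omega) (by omega)

theorem calT_mem {i k : ℕ} (h : i + 1 < k) {F : PInf} (hF : F ∈ PSym k) : calT i F ∈ PSym k :=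
  fun j hj => by rw [calT_comm (Or.inr (by omega)), hF j hj]

theorem calTInv_mem {i k : ℕ} (h : i + 1 < k) {F : PInf} (hF : F ∈ PSym k) :
    calTInv i F ∈ PSym k :=
  (PSym k).smul_mem ((PSym k).add_mem (calT_mem h hF) ((PSym k).smul_mem hF _)) _

theorem calTAsc_mem {n k : ℕ} (h : n < k) {F : PInf} (hF : F ∈ PSym k) :
    calTAsc n F ∈ PSym k := by
  induction n generalizing F with
  | zero => exact hF
  | succ n ih => exact ih (by omega) (calT_mem h hF)

theorem calTInvDesc_mem {n k : ℕ} (h : n < k) {F : PInf} (hF : F ∈ PSym k) :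
    calTInvDesc n F ∈ PSym k := by
  induction n with
  | zero => exact hF
  | succ n ih => exact calTInv_mem h (ih (by omega))

/-! ### The cyclic shift -/

theorem admissible_omega (k : ℕ) : Admissible (fun j =>
    if j + 1 < k then X (j + 1) else if j + 1 = k then qc • X 0 else X j) :=
  admissible_of_X k fun j => by
    by_cases h1 : j + 1 < k
    · exact Or.inl ⟨j + 1, by omega, by rw [if_pos h1]⟩
    · by_cases h2 : j + 1 = k
      · refine Or.inr ⟨?_, by omega⟩
        rw [if_neg h1, if_pos h2]
        exact (totalDegree_smul_le _ _).trans (totalDegree_X _).le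
      · exact Or.inl ⟨j, by omega, by rw [if_neg h1, if_neg h2]⟩

/-- The substitution `(x_1, …, x_k) ↦ (x_2, …, x_k, q x_1)` on `𝒫_∞^+`. -/
def om (k : ℕ) : PInf →ₐ[QTQ] PInf := subst _ (admissible_omega k)

theorem proj_om {k m : ℕ} (h : k ≤ m) (F : PInf) : proj (om k F) m = omegaInv k (proj F m) := by
  rw [om, proj_subst_self]
  · rfl
  · intro j hj
    rw [if_neg (by omega), if_neg (by omega), trunc_X_of_le hj]
  · intro j hj
    split_ifs
    · exact trunc_X_of_lt (by omega)
    · rw [map_smul, trunc_X_of_lt (by omega)]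
    · exact trunc_X_of_lt hj

theorem om_xv_of_lt {j k : ℕ} (h : j + 1 < k) : om k (xv j) = xv (j + 1) := by
  rw [om, subst_xv, if_pos h]
  rfl

theorem om_xv_last (k : ℕ) : om (k + 1) (xv k) = qc • xv 0 := by
  rw [om, subst_xv, if_neg (by omega), if_pos rfl]
  exact map_smul ofPolyHom _ _

theorem swp_om_of_le {k i : ℕ} (h : k ≤ i) (F : PInf) : swp i (om k F) = om k (swp i F) := by
  refine subst_subst_comm _ _ _ _ (fun j => ?_) F
  simp only [aeval_X, Equiv.swap_apply_def]
  split_ifs <;> simp <;> grind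

theorem om_swp {k i : ℕ} (h : i + 2 < k) (F : PInf) : om k (swp i F) = swp (i + 1) (om k F) := by
  refine subst_subst_comm _ _ _ _ (fun j => ?_) F
  simp only [aeval_X, Equiv.swap_apply_def]
  split_ifs <;> simp <;> grind

theorem om_succ_eq (k : ℕ) (F : PInf) : om (k + 2) F = om (k + 1) (swp k F) := by
  rw [om, om, swp, subst_subst _ _ (admissible_omega (k + 2)) fun j => ?_]
  simp only [aeval_X, Equiv.swap_apply_def]
  grind

theorem omega_comp_omega (k j : ℕ) :
    aeval (fun j => if j + 1 < k + 2 then X (j + 1) else if j + 1 = k + 2 then qc • X 0 else X j)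
      (if j + 1 < k + 1 then X (j + 1) else if j + 1 = k + 1 then qc • X 0 else X j : Poly) =
    (if j < k then X (j + 2) else if j = k then qc • X 1 else if j = k + 1 then qc • X 0
      else X j : Poly) := by
  rcases lt_trichotomy j k with h | rfl | h
  · rw [if_pos (by omega), if_pos h, aeval_X, if_pos (by omega)]
  · rw [if_neg (by omega), if_pos rfl, if_neg (by omega), if_pos rfl, map_smul, aeval_X,
      if_pos (by omega)]
  · rw [if_neg (by omega), if_neg (by omega), if_neg (by omega), if_neg (by omega), aeval_X,
      if_neg (by omega)]
    grind

/-- The double shift sends `x_{k+1}` to `q x_2` and `x_{k+2}` to `q x_1`, so exchanging the last two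
variables before it amounts to exchanging the first two after it. This is the source of `T_1 (∂^*)^2
= (∂^*)^2`. -/
theorem swp_om_om (k : ℕ) (F : PInf) :
    swp 0 (om (k + 2) (om (k + 1) F)) = om (k + 2) (om (k + 1) (swp k F)) := by
  have hχ := (admissible_omega (k + 2)).comp (admissible_omega (k + 1))
  simp only [omega_comp_omega] at hχ
  have e : ∀ F, om (k + 2) (om (k + 1) F) = subst _ hχ F :=
    fun F => subst_subst _ _ hχ (omega_comp_omega k) F
  rw [e, e]
  refine subst_subst_comm _ _ _ _ (fun j => ?_) F
  simp only [aeval_X, Equiv.swap_apply_def]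
  split_ifs <;> simp <;> grind

theorem om_mem {k : ℕ} {F : PInf} (hF : F ∈ PSym k) : om k F ∈ PSym k :=
  mem_PSym.mpr fun i hi => by rw [swp_om_of_le hi, swp_of_mem hF hi]

theorem om_succ_mem {k : ℕ} {F : PInf} (hF : F ∈ PSym k) : om (k + 1) F ∈ PSym (k + 1) :=
  om_mem (mem_succ hF)

/-- On `𝒫(k)^+` the cyclic shifts of larger rank agree. -/
theorem om_stable {k : ℕ} {F : PInf} (hF : F ∈ PSym k) : om (k + 2) F = om (k + 1) F := by
  rw [om_succ_eq, swp_of_mem hF le_rfl]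

theorem om_eq_of_le {k m : ℕ} (h : k + 1 ≤ m) {F : PInf} (hF : F ∈ PSym k) :
    om m F = om (k + 1) F := by
  induction m, h using Nat.le_induction with
  | base => rfl
  | succ m hm ih =>
    obtain ⟨n, rfl⟩ : ∃ n, m = n + 1 := ⟨m - 1, by omega⟩
    rw [om_stable (PSym_mono (by omega) hF), ih]

theorem calT_om {k i : ℕ} (h : i + 2 < k) (F : PInf) :
    om k (calT i F) = calT (i + 1) (om k F) := by
  apply eq_calT
  have := congrArg (om k) (calT_spec i F)
  simpa only [map_mul, map_sub, map_add, map_smul, om_xv_of_lt (show i + 1 < k by omega),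
    om_xv_of_lt (show i + 1 + 1 < k by omega), om_swp h] using this

/-! ### `𝒫(k+1)^+` is a polynomial ring over `𝒫(k)^+` -/

theorem admissible_contract (k : ℕ) : Admissible (fun j =>
    if j < k then X j else if j = k then 0 else X (j - 1)) :=
  admissible_of_X (k + 1) fun j => by
    by_cases h1 : j < k
    · exact Or.inl ⟨j, by omega, by rw [if_pos h1]⟩
    · by_cases h2 : j = k
      · refine Or.inr ⟨?_, by omega⟩
        rw [if_neg h1, if_pos h2]
        simp
      · exact Or.inl ⟨j - 1, by omega, by rw [if_neg h1, if_neg h2]⟩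

/-- The substitution `F ↦ F(x_1, …, x_k, 0, x_{k+1}, x_{k+2}, …)`. -/
def contract (k : ℕ) : PInf →ₐ[QTQ] PInf := subst _ (admissible_contract k)

theorem swp_contract {k i : ℕ} (h : k ≤ i) (F : PInf) :
    swp i (contract k F) = contract k (swp (i + 1) F) := by
  refine subst_subst_comm _ _ _ _ (fun j => ?_) F
  simp only [aeval_X, Equiv.swap_apply_def]
  split_ifs <;> simp <;> grind

theorem contract_mem {k : ℕ} {F : PInf} (hF : F ∈ PSym (k + 1)) : contract k F ∈ PSym k :=
  mem_PSym.mpr fun i hi => by rw [swp_contract hi, swp_of_mem hF (by omega)]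

theorem contract_succ_swp (k : ℕ) (F : PInf) : contract (k + 1) (swp k F) = contract k F := by
  rw [contract, contract, swp, subst_subst _ _ (admissible_contract k) fun j => ?_]
  simp only [aeval_X, Equiv.swap_apply_def]
  grind

/-- By symmetry the variable set to zero may be moved arbitrarily far to the right, where `Π_m` no
longer sees it. -/
theorem contract_of_mem {k : ℕ} {F : PInf} (hF : F ∈ PSym k) : contract k F = F := by
  have h : ∀ n, contract k F = contract (k + n) F := by
    intro n
    induction n with
    | zero => rfl
    | succ n ih => rw [ih, ← contract_succ_swp, swp_of_mem hF (by omega)]; rfl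
  refine PInf.ext fun m => ?_
  rw [h m, contract, proj_subst (n := m), ← trunc_proj F le_rfl]
  · have : ((trunc m).comp (aeval fun j => if j < k + m then X j else if j = k + m then 0
        else X (j - 1))).comp (trunc m) = trunc m := by
      apply MvPolynomial.algHom_ext
      intro j
      simp only [AlgHom.comp_apply]
      by_cases hj : j < m
      · rw [trunc_X_of_lt hj, aeval_X, if_pos (by omega), trunc_X_of_lt hj]
      · rw [trunc_X_of_le (by omega), map_zero, map_zero]
    rw [← AlgHom.comp_apply, ← AlgHom.comp_apply, this, trunc_proj F le_rfl]
  · intro j hj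
    split_ifs
    · exact trunc_X_of_le hj
    · exact map_zero _
    · exact trunc_X_of_le (by omega)

theorem admissible_kill (k : ℕ) : Admissible (fun j => if j = k then 0 else X j) :=
  admissible_of_X (k + 1) fun j => by
    by_cases h2 : j = k
    · refine Or.inr ⟨?_, by omega⟩
      rw [if_pos h2]
      simp
    · exact Or.inl ⟨j, by omega, by rw [if_neg h2]⟩

/-- The substitution `x_{k+1} ↦ 0`. -/
def kill (k : ℕ) : PInf →ₐ[QTQ] PInf := subst _ (admissible_kill k)

theorem proj_kill (k m : ℕ) (F : PInf) :
    proj (kill k F) m = aeval (fun j => if j = k then 0 else X j) (proj F m) := by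
  rw [kill, proj_subst_self]
  · intro j hj
    split_ifs
    · exact map_zero _
    · exact trunc_X_of_le hj
  · intro j hj
    split_ifs
    · exact map_zero _
    · exact trunc_X_of_lt hj

/-- Since `F` is symmetric from `x_{k+2}` on, inserting a zero after `x_{k+1}` does not change it;
after `x_{k+1} ↦ 0` it is irrelevant in which of the two places the zero was inserted. Hence `F -
contract k F` is divisible by `x_{k+1}`. -/
theorem kill_contract {k : ℕ} {F : PInf} (hF : F ∈ PSym (k + 1)) :
    kill k (contract k F) = kill k F := by
  conv_rhs => rw [← contract_of_mem hF]
  refine subst_subst_comm _ _ _ _ (fun j => ?_) F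
  split_ifs <;> simp <;> grind

theorem X_dvd_sub_kill (k : ℕ) (f : Poly) :
    (X k : Poly) ∣ f - aeval (fun j => if j = k then 0 else X j) f := by
  rw [← Ideal.mem_span_singleton, ← Ideal.Quotient.eq]
  have h : (Ideal.Quotient.mkₐ QTQ (Ideal.span {(X k : Poly)})) =
      (Ideal.Quotient.mkₐ QTQ (Ideal.span {(X k : Poly)})).comp
        (aeval (fun j => if j = k then 0 else X j)) := by
    apply MvPolynomial.algHom_ext
    intro j
    rw [AlgHom.comp_apply, aeval_X]
    split_ifs with hj
    · rw [map_zero, hj]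
      exact Ideal.Quotient.eq_zero_iff_mem.mpr (Ideal.mem_span_singleton_self _)
    · rfl
  exact congrArg (fun φ => φ f) h

/-- The quotients at the finite levels are unique, hence compatible. The degree bound drops by one,
which drives the induction over `𝒫(k+1)^+`; the clause for `d = 0` covers its start, where `d - 1`
is truncated to `0`. -/
theorem exists_eq_xv_mul {k : ℕ} {G : PInf} (hG : kill k G = 0) {d : ℕ}
    (hd : ∀ m, (proj G m).totalDegree ≤ d) :
    ∃ H, G = xv k * H ∧ (∀ m, (proj H m).totalDegree ≤ d - 1) ∧ (d = 0 → H = 0) := by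
  -- The levels are shifted by `k + 1` so that `x_{k+1}` is always among the variables.
  have h1 : ∀ m, ∃ f, proj G (m + k + 1) = X k * f := by
    intro m
    have := X_dvd_sub_kill k (proj G (m + k + 1))
    rwa [← proj_kill, hG, proj_zero, sub_zero] at this
  choose f hf using h1
  have htr : ∀ m, trunc (m + k + 1) (f (m + 1)) = f m := by
    intro m
    apply mul_left_cancel₀ (X_ne_zero (R := QTQ) k)
    rw [← hf m, ← trunc_proj G (show m + k + 1 ≤ m + 1 + k + 1 by omega), hf (m + 1), map_mul,
      trunc_X_of_lt (by omega)]
  have hdeg : ∀ m, (f m).totalDegree ≤ d - 1 ∧ (d = 0 → f m = 0) := by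
    intro m
    by_cases h0 : f m = 0
    · simp [h0]
    have := totalDegree_mul_of_isDomain (X_ne_zero (R := QTQ) k) h0
    rw [← hf m, totalDegree_X] at this
    have := hd (m + k + 1)
    exact ⟨by omega, by omega⟩
  let H : PInf := ⟨fun m => trunc m (f m), fun m => by
    beta_reduce
    rw [trunc_trunc, min_eq_left (Nat.le_succ m), ← htr m, trunc_trunc,
      min_eq_left (by omega)], d - 1, fun m => (totalDegree_trunc_le _ _).trans (hdeg m).1⟩
  refine ⟨H, ?_, fun m => (totalDegree_trunc_le _ _).trans (hdeg m).1, fun h0 => PInf.ext fun m => ?_⟩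
  · refine PInf.ext fun m => ?_
    rw [← trunc_proj G (show m ≤ m + k + 1 by omega), hf m, map_mul, proj_mul]
    rfl
  · change trunc m (f m) = 0
    rw [(hdeg m).2 h0, map_zero]

theorem totalDegree_proj_subst_le {φ : ℕ → Poly} (h : Admissible φ) {F : PInf} {d : ℕ}
    (hd : ∀ m, (proj F m).totalDegree ≤ d) (m : ℕ) :
    (proj (subst φ h F) m).totalDegree ≤ d :=
  (totalDegree_trunc_le _ _).trans ((totalDegree_aeval_le h.totalDegree_le _).trans (hd _))

/-- `𝒫(k+1)^+` is generated by `x_{k+1}` over `𝒫(k)^+`. -/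
theorem exists_decomp {k : ℕ} {F : PInf} (hF : F ∈ PSym (k + 1)) :
    ∃ G ∈ PSym (k + 1), F = contract k F + xv k * G := by
  obtain ⟨d, hd⟩ := F.2.2
  have h0 : kill k (F - contract k F) = 0 := by rw [map_sub, kill_contract hF, sub_self]
  obtain ⟨G, hG, -⟩ := exists_eq_xv_mul (d := d) h0 fun m => by
    rw [proj_sub]
    exact (totalDegree_sub _ _).trans (max_le (hd m) (totalDegree_proj_subst_le _ hd m))
  refine ⟨G, mem_PSym.mpr fun i hi => ?_, by rw [← hG]; ring⟩
  apply mul_left_cancel₀ (a := xv k) (fun h => ?_)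
  · conv_lhs => rw [← swp_xv_of_ne (show k ≠ i by omega) (show k ≠ i + 1 by omega), ← map_mul, ← hG]
    rw [map_sub, swp_of_mem hF hi, swp_of_mem (contract_mem hF) (by omega), hG]
  · have := congrArg (fun F => proj F (k + 1)) h
    beta_reduce at this
    rw [proj_xv_of_lt (by omega)] at this
    exact X_ne_zero k this

/-- Induction on a uniform degree bound: `F` is the sum of an element of `𝒫(k)^+` and `x_{k+1} G`,
where `G` has a smaller bound. -/
theorem PSym_induction {k : ℕ} {p : PInf → Prop} (base : ∀ c ∈ PSym k, p c)
    (add : ∀ F ∈ PSym (k + 1), ∀ G ∈ PSym (k + 1), p F → p G → p (F + G))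
    (step : ∀ F ∈ PSym (k + 1), p F → p (xv k * F)) {F : PInf} (hF : F ∈ PSym (k + 1)) : p F := by
  obtain ⟨d, hd⟩ := F.2.2
  change ∀ m, (proj F m).totalDegree ≤ d at hd
  have hx : xv k ≠ 0 := fun h => by
    have := congrArg (fun F => proj F (k + 1)) h
    beta_reduce at this
    rw [proj_xv_of_lt (by omega)] at this
    exact X_ne_zero k this
  induction d generalizing F with
  | zero =>
    have h0 : kill k (F - contract k F) = 0 := by rw [map_sub, kill_contract hF, sub_self]
    obtain ⟨G, hG, -, hG0⟩ := exists_eq_xv_mul (d := 0) h0 fun m => by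
      rw [proj_sub]
      exact (totalDegree_sub _ _).trans (max_le (hd m) (totalDegree_proj_subst_le _ hd m))
    rw [hG0 rfl, mul_zero, sub_eq_zero] at hG
    rw [hG]
    exact base _ (contract_mem hF)
  | succ d ih =>
    obtain ⟨G, hG, e⟩ := exists_decomp hF
    have h0 : kill k (F - contract k F) = 0 := by rw [map_sub, kill_contract hF, sub_self]
    obtain ⟨G', hG', hdeg, -⟩ := exists_eq_xv_mul (d := d + 1) h0 fun m => by
      rw [proj_sub]
      exact (totalDegree_sub _ _).trans (max_le (hd m) (totalDegree_proj_subst_le _ hd m))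
    have : G = G' := mul_left_cancel₀ hx (by rw [← hG', ← sub_eq_iff_eq_add'.mpr e])
    subst this
    rw [e]
    exact add _ (mem_succ (contract_mem hF)) _ ((PSym (k + 1)).mul_mem (xv_mem (by omega)) hG)
      (base _ (contract_mem hF)) (step _ hG (ih hG hdeg))

/-- Evaluation of polynomials over `𝒫(k)^+` at `x_{k+1}`. -/
def evalLast (k : ℕ) : Polynomial (PSym k) →ₗ[QTQ] PInf :=
  ((Polynomial.aeval (xv k) : Polynomial (PSym k) →ₐ[PSym k] PInf).restrictScalars
    QTQ).toLinearMap

theorem evalLast_apply (k : ℕ) (f : Polynomial (PSym k)) :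
    evalLast k f = Polynomial.eval₂ (PSym k).val.toRingHom (xv k) f := rfl

/-- The coefficients are symmetric in `x_{k+1}, x_{k+2}, …`, so transpositions carry a relation at
`x_{k+1}` to the same relation at every later variable. A polynomial over a domain with infinitely
many roots is zero. -/
theorem evalLast_injective (k : ℕ) : Function.Injective (evalLast k) := by
  rw [← LinearMap.ker_eq_bot, LinearMap.ker_eq_bot']
  intro f hf
  rw [evalLast_apply] at hf
  have h1 : ∀ n, Polynomial.eval₂ (PSym k).val.toRingHom (xv (k + n)) f = 0 := by
    intro n
    induction n with
    | zero => exact hf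
    | succ n ih =>
      have := congrArg (swp (k + n)).toRingHom ih
      rw [Polynomial.hom_eval₂, map_zero] at this
      have e : (swp (k + n)).toRingHom.comp (PSym k).val.toRingHom = (PSym k).val.toRingHom :=
        RingHom.ext fun c => swp_of_mem c.2 (by omega)
      rw [e] at this
      rw [← this]
      congr 1
      exact (swp_xv_left (k + n)).symm
  have h2 : f.map (PSym k).val.toRingHom = 0 := by
    apply Polynomial.eq_zero_of_infinite_isRoot
    refine Set.infinite_of_injective_forall_mem (f := fun n => xv (k + n))
      (fun a b h => by have := xv_injective h; omega) fun n => ?_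
    rw [Set.mem_ofPred_eq, Polynomial.IsRoot, Polynomial.eval_map]
    exact h1 n
  exact (Polynomial.map_eq_zero_iff (f := (PSym k).val.toRingHom) Subtype.val_injective).mp h2

/-! ### The symmetric functions `Q_n` -/

/-- The power series `(1 - t x u) / (1 - x u)` in `u`, for the variable `x = x_{i+1}`. -/
def qFactor (i : ℕ) : PowerSeries Poly :=
  PowerSeries.mk fun n => if n = 0 then 1 else (1 - tc) • X i ^ n

/-- The product of the series `(1 - t x_{i+1} u) / (1 - x_{i+1} u)` over `k ≤ i < m`. -/
def qSeries (k m : ℕ) : PowerSeries Poly := ∏ i ∈ Finset.Ico k m, qFactor i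

theorem qFactor_spec (i : ℕ) :
    (1 - PowerSeries.C (X i) * PowerSeries.X) * qFactor i =
      1 - PowerSeries.C (C tc * X i) * PowerSeries.X := by
  ext1 n
  rw [sub_mul, one_mul, mul_assoc, map_sub, map_sub, PowerSeries.coeff_C_mul,
    PowerSeries.coeff_C_mul]
  rcases n with _ | _ | n
  · simp [qFactor]
  · rw [PowerSeries.coeff_succ_X_mul, PowerSeries.coeff_one_X, qFactor, PowerSeries.coeff_mk,
      PowerSeries.coeff_mk, PowerSeries.coeff_one]
    simp [smul_eq_C_mul]
    ring
  · rw [PowerSeries.coeff_succ_X_mul, PowerSeries.coeff_X, qFactor, PowerSeries.coeff_mk,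
      PowerSeries.coeff_mk, PowerSeries.coeff_one]
    simp [smul_eq_C_mul]
    ring

theorem map_qFactor (φ : Poly →ₐ[QTQ] Poly) {i j : ℕ} (h : φ (X i) = X j) :
    PowerSeries.map φ.toRingHom (qFactor i) = qFactor j := by
  ext1 n
  rw [PowerSeries.coeff_map, qFactor, qFactor, PowerSeries.coeff_mk, PowerSeries.coeff_mk]
  split_ifs
  · exact map_one _
  · change φ _ = _
    rw [map_smul, map_pow, h]

theorem map_qFactor_eq_one (φ : Poly →ₐ[QTQ] Poly) {i : ℕ} (h : φ (X i) = 0) :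
    PowerSeries.map φ.toRingHom (qFactor i) = 1 := by
  ext1 n
  rw [PowerSeries.coeff_map, qFactor, PowerSeries.coeff_mk, PowerSeries.coeff_one]
  split_ifs with hn
  · exact map_one _
  · change φ _ = _
    rw [map_smul, map_pow, h, zero_pow hn, smul_zero]

theorem totalDegree_coeff_qSeries_le (k m n : ℕ) :
    (PowerSeries.coeff n (qSeries k m)).totalDegree ≤ n := by
  rw [qSeries]
  induction Finset.Ico k m using Finset.induction_on generalizing n with
  | empty =>
    rw [Finset.prod_empty, PowerSeries.coeff_one]
    split_ifs <;> simp
  | insert i s hi ih =>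
    rw [Finset.prod_insert hi, PowerSeries.coeff_mul]
    refine (totalDegree_finsetSum _ _).trans (Finset.sup_le fun p hp => ?_)
    rw [Finset.HasAntidiagonal.mem_antidiagonal] at hp
    refine (totalDegree_mul _ _).trans ?_
    have h1 := ih p.2
    have h2 : (PowerSeries.coeff p.1 (qFactor i)).totalDegree ≤ p.1 := by
      rw [qFactor, PowerSeries.coeff_mk]
      split_ifs
      · simp
      · exact (totalDegree_smul_le _ _).trans (totalDegree_X_pow _ _).le
    omega

/-- The symmetric function `Q_n[x_{k+1} + x_{k+2} + ⋯]`, where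
`∑ Q_n u^n = ∏ (1 - t x u) / (1 - x u)`. -/
def qFn (k n : ℕ) : PInf :=
  ⟨fun m => PowerSeries.coeff n (qSeries k m), fun m => by
    beta_reduce
    change (trunc m).toRingHom _ = _
    rw [← PowerSeries.coeff_map, qSeries, qSeries, map_prod]
    rcases Nat.lt_or_ge m k with h | h
    · rw [Finset.Ico_eq_empty (by omega), Finset.Ico_eq_empty (by omega)]
      simp
    · rw [Finset.prod_Ico_succ_top h, map_qFactor_eq_one _ (trunc_X_of_le le_rfl), mul_one]
      congr 1
      refine Finset.prod_congr rfl fun i hi => map_qFactor _ (trunc_X_of_lt ?_)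
      exact (Finset.mem_Ico.mp hi).2, n, fun m => totalDegree_coeff_qSeries_le k m n⟩

theorem proj_qFn (k n m : ℕ) : proj (qFn k n) m = PowerSeries.coeff n (qSeries k m) := rfl

theorem qFn_zero (k : ℕ) : qFn k 0 = 1 := by
  refine PInf.ext fun m => ?_
  rw [proj_qFn, qSeries, PowerSeries.coeff_zero_eq_constantCoeff_apply, map_prod, proj_one]
  refine Finset.prod_eq_one fun i _ => ?_
  rw [← PowerSeries.coeff_zero_eq_constantCoeff_apply, qFactor, PowerSeries.coeff_mk, if_pos rfl]

/-- Separate the factor of `x_{k+1}` in the generating series, multiply by `1 - x_{k+1} u` and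
compare coefficients of `u^{n+1}`. -/
theorem qFn_succ_sub (k n : ℕ) :
    qFn k (n + 1) - xv k * qFn k n = qFn (k + 1) (n + 1) - tc • (xv k * qFn (k + 1) n) := by
  apply PInf.ext_of_le (k + 1)
  intro m hm
  simp only [proj_sub, proj_mul, proj_smul, proj_xv_of_lt (show k < m by omega), proj_qFn]
  have h : (1 - PowerSeries.C (X k) * PowerSeries.X) * qSeries k m =
      (1 - PowerSeries.C (C tc * X k) * PowerSeries.X) * qSeries (k + 1) m := by
    rw [qSeries, Finset.prod_eq_prod_Ico_succ_bot (by omega), ← mul_assoc, qFactor_spec]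
    rfl
  have h2 := congrArg (PowerSeries.coeff (n + 1)) h
  simp only [sub_mul, one_mul, mul_assoc, map_sub, PowerSeries.coeff_C_mul,
    PowerSeries.coeff_succ_X_mul] at h2
  rw [h2, smul_eq_C_mul]

theorem qFn_mem (k n : ℕ) : qFn k n ∈ PSym k := by
  refine mem_PSym.mpr fun i hi => PInf.ext_of_le (i + 2) fun m hm => ?_
  rw [proj_swp (by omega), proj_qFn]
  change (swapVar i).toRingHom _ = _
  rw [← PowerSeries.coeff_map, qSeries, map_prod]
  congr 1
  refine Finset.prod_equiv (Equiv.swap i (i + 1)) (fun j => ?_) fun j _ => ?_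
  · simp only [Finset.mem_Ico, Equiv.swap_apply_def]
    grind
  · exact map_qFactor _ (by rw [swapVar, rename_X])

theorem swp_qFn_of_lt {i k : ℕ} (h : i + 1 < k) (n : ℕ) : swp i (qFn k n) = qFn k n := by
  refine PInf.ext_of_le (i + 2) fun m hm => ?_
  rw [proj_swp (by omega), proj_qFn]
  change (swapVar i).toRingHom _ = _
  rw [← PowerSeries.coeff_map, qSeries, map_prod]
  congr 1
  refine Finset.prod_congr rfl fun j hj => map_qFactor _ ?_
  have := (Finset.mem_Ico.mp hj).1
  rw [swapVar, rename_X, Equiv.swap_apply_of_ne_of_ne (by omega) (by omega)]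

theorem proj_qFn_self (m n : ℕ) (hn : n ≠ 0) : proj (qFn m n) m = 0 := by
  rw [proj_qFn, qSeries, Finset.Ico_self, Finset.prod_empty, PowerSeries.coeff_one, if_neg hn]

theorem proj_qFn_succ (m n : ℕ) (hn : n ≠ 0) :
    proj (qFn m n) (m + 1) = (1 - tc) • X m ^ n := by
  rw [proj_qFn, qSeries, Nat.Ico_succ_singleton, Finset.prod_singleton, qFactor,
    PowerSeries.coeff_mk, if_neg hn]

/-! ### The operators `∂^-` -/

/-- The `𝒫(k)^+`-linear map `x_{k+1}^n ↦ Q_n[x_{k+1} + x_{k+2} + ⋯]`. -/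
def qEval (k : ℕ) : Polynomial (PSym k) →ₗ[QTQ] PInf where
  toFun f := f.sum fun n c => c.1 * qFn k n
  map_add' f g := Polynomial.sum_add_index _ _ _ (fun _ => zero_mul _) fun _ _ _ => add_mul _ _ _
  map_smul' r f := by
    rw [Polynomial.sum_smul_index' _ _ _ (fun _ => zero_mul _), Polynomial.sum_def,
      Polynomial.sum_def, RingHom.id_apply, Finset.smul_sum]
    exact Finset.sum_congr rfl fun n _ => smul_mul_assoc _ _ _

/-- An operator on `𝒫_∞^+` extending `∂^-_{k+1} : 𝒫(k+1)^+ → 𝒫(k)^+`. -/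
def dMinus (k : ℕ) : PInf →ₗ[QTQ] PInf :=
  qEval k ∘ₗ (LinearMap.exists_leftInverse_of_injective (evalLast k)
    (LinearMap.ker_eq_bot.mpr (evalLast_injective k))).choose

/-- The left inverse used to define `dMinus` is arbitrary off the image of `evalLast`; besides
linearity, this is all that is used about it. -/
theorem dMinus_evalLast (k : ℕ) (f : Polynomial (PSym k)) :
    dMinus k (evalLast k f) = qEval k f := by
  have h := (LinearMap.exists_leftInverse_of_injective (evalLast k)
    (LinearMap.ker_eq_bot.mpr (evalLast_injective k))).choose_spec
  rw [dMinus, LinearMap.comp_apply]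
  congr 1
  exact congrArg (fun φ => φ f) h

theorem dMinus_mul_pow {k : ℕ} {c : PInf} (hc : c ∈ PSym k) (n : ℕ) :
    dMinus k (c * xv k ^ n) = c * qFn k n := by
  have h := dMinus_evalLast k (Polynomial.monomial n (⟨c, hc⟩ : PSym k))
  rw [evalLast_apply, Polynomial.eval₂_monomial] at h
  refine h.trans ?_
  exact Polynomial.sum_monomial_index _ (fun n (c : PSym k) => c.1 * qFn k n) (zero_mul _)

theorem dMinus_of_mem {k : ℕ} {c : PInf} (hc : c ∈ PSym k) : dMinus k c = c := by
  have := dMinus_mul_pow hc 0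
  rwa [pow_zero, mul_one, qFn_zero, mul_one] at this

/-- `𝒫(k+1)^+` is spanned by the products `c x_{k+1}^n` with `c ∈ 𝒫(k)^+`. -/
theorem PSym_span {k : ℕ} {p : PInf → Prop} (base : ∀ c ∈ PSym k, ∀ n, p (c * xv k ^ n))
    (add : ∀ F ∈ PSym (k + 1), ∀ G ∈ PSym (k + 1), p F → p G → p (F + G))
    {F : PInf} (hF : F ∈ PSym (k + 1)) : p F := by
  have h : ∀ n, p (F * xv k ^ n) := by
    refine PSym_induction (p := fun F => ∀ n, p (F * xv k ^ n)) base ?_ ?_ hF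
    · intro F hF G hG h1 h2 n
      rw [add_mul]
      have hx : xv k ^ n ∈ PSym (k + 1) := (PSym (k + 1)).pow_mem (xv_mem (Nat.lt_succ_self k)) n
      exact add _ ((PSym (k + 1)).mul_mem hF hx) _ ((PSym (k + 1)).mul_mem hG hx) (h1 n) (h2 n)
    · intro F _ h n
      have := h (n + 1)
      rwa [pow_succ', ← mul_assoc, mul_comm F] at this
  simpa using h 0

theorem dMinus_mem {k : ℕ} {F : PInf} (hF : F ∈ PSym (k + 1)) : dMinus k F ∈ PSym k := by
  refine PSym_span (p := fun F => dMinus k F ∈ PSym k) (fun c hc n => ?_)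
    (fun F _ G _ h1 h2 => ?_) hF
  · rw [dMinus_mul_pow hc]
    exact (PSym k).mul_mem hc (qFn_mem k n)
  · rw [map_add]
    exact (PSym k).add_mem h1 h2

/-- Linearity over all of `𝒫(k)^+`, not just over `𝒫_k^+`. In particular symmetric functions of the
full alphabet pass through, which the definition by the `ℬ_n` does not show. -/
theorem dMinus_mul {k : ℕ} {c F : PInf} (hc : c ∈ PSym k) (hF : F ∈ PSym (k + 1)) :
    dMinus k (c * F) = c * dMinus k F := by
  refine PSym_span (p := fun F => dMinus k (c * F) = c * dMinus k F) (fun c' hc' n => ?_) (fun F _ G _ h1 h2 => ?_) hF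
  · rw [← mul_assoc, dMinus_mul_pow ((PSym k).mul_mem hc hc'), dMinus_mul_pow hc', mul_assoc]
  · rw [mul_add, map_add, map_add, h1, h2, mul_add]

theorem dMinus_calT {k i : ℕ} (h : i + 1 < k) {F : PInf} (hF : F ∈ PSym (k + 1)) :
    dMinus k (calT i F) = calT i (dMinus k F) := by
  refine PSym_span (p := fun F => dMinus k (calT i F) = calT i (dMinus k F)) (fun c hc n => ?_)
    (fun F _ G _ h1 h2 => ?_) hF
  · have e1 : swp i (xv k ^ n) = xv k ^ n := by
      rw [map_pow, swp_xv_of_ne (by omega) (by omega)]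
    rw [dMinus_mul_pow hc, mul_comm c, calT_mul_of_swp e1, mul_comm,
      dMinus_mul_pow (calT_mem h hc), mul_comm c, calT_mul_of_swp (swp_qFn_of_lt h n), mul_comm]
  · rw [map_add, map_add, map_add, map_add, h1, h2]

/-! ### Properties of `∂^-` -/

theorem om_qFn (k n : ℕ) : om k (qFn k n) = qFn k n := by
  refine PInf.ext_of_le k fun m hm => ?_
  rw [proj_om hm, proj_qFn]
  change (aeval fun j => if j + 1 < k then X (j + 1) else if j + 1 = k then qc • X 0 else X j :
    Poly →ₐ[QTQ] Poly).toRingHom _ = _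
  rw [← PowerSeries.coeff_map, qSeries, map_prod]
  congr 1
  refine Finset.prod_congr rfl fun j hj => map_qFactor _ ?_
  have := (Finset.mem_Ico.mp hj).1
  rw [aeval_X, if_neg (by omega), if_neg (by omega)]

theorem om_qFn_succ (k n : ℕ) :
    om (k + 1) (qFn k (n + 1)) - qc • (xv 0 * om (k + 1) (qFn k n)) =
      qFn (k + 1) (n + 1) - tc • (qc • (xv 0 * qFn (k + 1) n)) := by
  have := congrArg (om (k + 1)) (qFn_succ_sub k n)
  simpa only [map_sub, map_mul, map_smul, om_xv_last, om_qFn, smul_mul_assoc] using this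

theorem calT_xv_pow (k n : ℕ) : calT k (xv k ^ n) =
    xv (k + 1) ^ n + (1 - tc) • ∑ j ∈ Finset.range n, xv k ^ (n - j) * xv (k + 1) ^ j := by
  induction n with
  | zero =>
    rw [pow_zero, pow_zero, Finset.sum_range_zero, smul_zero, add_zero]
    exact calT_of_mem (PSym k).one_mem le_rfl
  | succ n ih =>
    have e : ∑ j ∈ Finset.range (n + 1), xv k ^ (n + 1 - j) * xv (k + 1) ^ j =
        xv (k + 1) * ∑ j ∈ Finset.range n, xv k ^ (n - j) * xv (k + 1) ^ j + xv k * xv k ^ n := by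
      rw [Finset.sum_range_succ', Finset.mul_sum, pow_zero, mul_one, Nat.sub_zero, pow_succ']
      congr 1
      refine Finset.sum_congr rfl fun j _ => ?_
      rw [Nat.add_sub_add_right]
      ring
    rw [pow_succ', calT_xv_mul, ih, e]
    simp only [Algebra.smul_def]
    ring

/-- The unrolled recursion. It has the shape of `calT_xv_pow` with `x_{k+2}^j` replaced by
`Q_j[x_{k+2} + ⋯]`, which is exactly how `∂^-` absorbs the Hecke operator in `dMinus_succ_calT`. -/
theorem qFn_eq_sum (k n : ℕ) : qFn k n =
    qFn (k + 1) n + (1 - tc) • ∑ j ∈ Finset.range n, xv k ^ (n - j) * qFn (k + 1) j := by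
  induction n with
  | zero => simp [qFn_zero]
  | succ n ih =>
    have h := qFn_succ_sub k n
    have e : ∑ j ∈ Finset.range n, xv k ^ (n + 1 - j) * qFn (k + 1) j =
        xv k * ∑ j ∈ Finset.range n, xv k ^ (n - j) * qFn (k + 1) j := by
      rw [Finset.mul_sum]
      refine Finset.sum_congr rfl fun j hj => ?_
      rw [Nat.succ_sub (Finset.mem_range.mp hj).le, pow_succ']
      ring
    rw [Finset.sum_range_succ, e, Nat.add_sub_cancel_left, pow_one]
    simp only [Algebra.smul_def, map_sub, map_one] at *
    linear_combination h + xv k * ih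

/-- `∂^-_{k+2} T_{k+1} = ∂^-_{k+1}` on `𝒫(k+1)^+`. -/
theorem dMinus_succ_calT {k : ℕ} {F : PInf} (hF : F ∈ PSym (k + 1)) :
    dMinus (k + 1) (calT k F) = dMinus k F := by
  refine PSym_span (p := fun F => dMinus (k + 1) (calT k F) = dMinus k F) (fun c hc n => ?_)
    (fun F _ G _ h1 h2 => ?_) hF
  · rw [calT_mul_of_swp (swp_of_mem hc le_rfl), dMinus_mul_pow hc, calT_xv_pow, mul_add, map_add,
      dMinus_mul_pow (mem_succ hc), mul_smul_comm, map_smul, Finset.mul_sum, map_sum, qFn_eq_sum k,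
      mul_add, mul_smul_comm, Finset.mul_sum]
    have e : ∀ j ∈ Finset.range n, dMinus (k + 1) (c * (xv k ^ (n - j) * xv (k + 1) ^ j)) =
        c * (xv k ^ (n - j) * qFn (k + 1) j) := fun j _ => by
      rw [← mul_assoc, dMinus_mul_pow, mul_assoc]
      exact (PSym (k + 1)).mul_mem (mem_succ hc) ((PSym (k + 1)).pow_mem (xv_mem (by omega)) _)
    rw [Finset.sum_congr rfl e]
  · rw [map_add, map_add, map_add, h1, h2]

theorem dMinus_calTAsc {n k : ℕ} (h : n < k) {F : PInf} (hF : F ∈ PSym (k + 1)) :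
    dMinus k (calTAsc n F) = calTAsc n (dMinus k F) := by
  induction n generalizing F with
  | zero => rfl
  | succ n ih =>
    rw [calTAsc_succ, ih (by omega) (calT_mem (by omega) hF), dMinus_calT h hF]
    rfl

/-- The divisibility passes from `F` to sums and to `x_{k+1} F` and `x_{k+2} F`, and holds trivially
on `𝒫(k)^+`; two inductions reach `𝒫(k+2)^+`. -/
theorem xv_sub_xv_dvd {k : ℕ} {F : PInf} (hF : F ∈ PSym (k + 2)) :
    (xv k - xv (k + 1)) ∣ F - swp k F := by
  have step : ∀ F : PInf, (xv k - xv (k + 1)) ∣ F - swp k F →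
      (xv k - xv (k + 1)) ∣ xv k * F - swp k (xv k * F) ∧
      (xv k - xv (k + 1)) ∣ xv (k + 1) * F - swp k (xv (k + 1) * F) := by
    rintro F ⟨G, hG⟩
    rw [map_mul, swp_xv_left, map_mul, swp_xv_right]
    exact ⟨⟨xv k * G + swp k F, by linear_combination xv k * hG⟩,
      ⟨xv (k + 1) * G - swp k F, by linear_combination xv (k + 1) * hG⟩⟩
  have add : ∀ F G : PInf, (xv k - xv (k + 1)) ∣ F - swp k F →
      (xv k - xv (k + 1)) ∣ G - swp k G → (xv k - xv (k + 1)) ∣ F + G - swp k (F + G) := by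
    intro F G h1 h2
    rw [map_add, add_sub_add_comm]
    exact dvd_add h1 h2
  refine PSym_induction (p := fun F => (xv k - xv (k + 1)) ∣ F - swp k F) (fun c hc => ?_)
    (fun F _ G _ => add F G) (fun F _ h => (step F h).2) hF
  refine PSym_induction (p := fun F => (xv k - xv (k + 1)) ∣ F - swp k F) (fun c hc => ?_)
    (fun F _ G _ => add F G) (fun F _ h => (step F h).1) hc
  rw [swp_of_mem hc le_rfl, sub_self]
  exact dvd_zero _

/-- The witness is the divided difference of `F`, which is invariant under the transposition. -/
theorem exists_calT_sub_eq {k : ℕ} {F : PInf} (hF : F ∈ PSym (k + 2)) :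
    ∃ G ∈ PSym (k + 2), swp k G = G ∧ calT k F - F = (xv (k + 1) - tc • xv k) * G := by
  obtain ⟨G, hG⟩ := xv_sub_xv_dvd hF
  have hne := xv_sub_ne_zero (show k ≠ k + 1 by omega)
  refine ⟨G, mem_PSym.mpr fun i hi => ?_, ?_, ?_⟩
  · apply mul_left_cancel₀ hne
    have := congrArg (swp i) hG
    rw [map_mul, map_sub, map_sub, ← swp_comm (show k + 1 < i by omega), swp_of_mem hF hi,
      swp_xv_of_ne (by omega) (by omega), swp_xv_of_ne (by omega) (by omega), hG] at this
    exact this.symm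
  · apply mul_left_cancel₀ hne
    have := congrArg (swp k) hG
    rw [map_mul, map_sub, map_sub, swp_swp, swp_xv_left, swp_xv_right] at this
    linear_combination this + hG
  · apply mul_left_cancel₀ hne
    have := calT_spec k F
    simp only [Algebra.smul_def, map_sub, map_one] at *
    linear_combination this + (xv (k + 1) - algebraMap QTQ PInf tc * xv k) * hG

/-- On `c x_{k+1}^a x_{k+2}^b` the right-hand expression without its sign is `c (Q_a Q_{b+1} -
Q_{a+1} Q_b)`, which changes sign when `a` and `b` are exchanged. -/
theorem dMinus_dMinus_antisymm {k : ℕ} {G : PInf} (hG : G ∈ PSym (k + 2)) :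
    dMinus k (dMinus (k + 1) ((xv (k + 1) - tc • xv k) * swp k G)) =
      - dMinus k (dMinus (k + 1) ((xv (k + 1) - tc • xv k) * G)) := by
  have add : ∀ F G : PInf,
      dMinus k (dMinus (k + 1) ((xv (k + 1) - tc • xv k) * swp k F)) =
      - dMinus k (dMinus (k + 1) ((xv (k + 1) - tc • xv k) * F)) →
      dMinus k (dMinus (k + 1) ((xv (k + 1) - tc • xv k) * swp k G)) =
      - dMinus k (dMinus (k + 1) ((xv (k + 1) - tc • xv k) * G)) →
      dMinus k (dMinus (k + 1) ((xv (k + 1) - tc • xv k) * swp k (F + G))) =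
      - dMinus k (dMinus (k + 1) ((xv (k + 1) - tc • xv k) * (F + G))) := by
    intro F G h1 h2
    simp only [mul_add, map_add, h1, h2]
    ring
  have key : ∀ c ∈ PSym k, ∀ a b : ℕ,
      dMinus k (dMinus (k + 1) ((xv (k + 1) - tc • xv k) * (c * xv k ^ a * xv (k + 1) ^ b))) =
        c * (qFn k a * qFn k (b + 1) - qFn k (a + 1) * qFn k b) := by
    intro c hc a b
    have hca : ∀ a, c * xv k ^ a ∈ PSym (k + 1) := fun a =>
      (PSym (k + 1)).mul_mem (mem_succ hc) ((PSym (k + 1)).pow_mem (xv_mem (by omega)) _)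
    have e1 : (xv (k + 1) - tc • xv k) * (c * xv k ^ a * xv (k + 1) ^ b) =
        c * xv k ^ a * xv (k + 1) ^ (b + 1) - tc • (c * xv k ^ (a + 1) * xv (k + 1) ^ b) := by
      simp only [Algebra.smul_def]
      ring
    -- The factor `x_{k+2} - t x_{k+1}` is chosen so that the recursion replaces functions of
    -- `x_{k+2} + ⋯` by functions of `x_{k+1} + ⋯`, which are scalars for the second `∂^-`.
    have e2 : c * xv k ^ a * qFn (k + 1) (b + 1) - tc • (c * xv k ^ (a + 1) * qFn (k + 1) b) =
        c * qFn k (b + 1) * xv k ^ a - c * qFn k b * xv k ^ (a + 1) := by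
      have := qFn_succ_sub k b
      simp only [Algebra.smul_def] at *
      linear_combination - c * xv k ^ a * this
    rw [e1, map_sub, map_smul, dMinus_mul_pow (hca a), dMinus_mul_pow (hca (a + 1)), e2, map_sub,
      dMinus_mul_pow ((PSym k).mul_mem hc (qFn_mem _ _)),
      dMinus_mul_pow ((PSym k).mul_mem hc (qFn_mem _ _))]
    ring
  refine PSym_span (p := fun G => dMinus k (dMinus (k + 1) ((xv (k + 1) - tc • xv k) * swp k G)) =
      - dMinus k (dMinus (k + 1) ((xv (k + 1) - tc • xv k) * G))) (fun c hc b => ?_)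
    (fun F _ G _ => add F G) hG
  refine PSym_span (p := fun c => dMinus k (dMinus (k + 1) ((xv (k + 1) - tc • xv k) *
      swp k (c * xv (k + 1) ^ b))) =
      - dMinus k (dMinus (k + 1) ((xv (k + 1) - tc • xv k) * (c * xv (k + 1) ^ b))))
      (fun c hc a => ?_) (fun F _ G _ h1 h2 => ?_) hc
  · have e : swp k (c * xv k ^ a * xv (k + 1) ^ b) = c * xv k ^ b * xv (k + 1) ^ a := by
      rw [map_mul, map_mul, map_pow, map_pow, swp_of_mem hc le_rfl, swp_xv_left, swp_xv_right,
        mul_right_comm]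
    rw [e, key c hc, key c hc]
    ring
  · rw [add_mul]
    exact add _ _ h1 h2

/-- `(∂^-)^2 T_{k-1} = (∂^-)^2`. -/
theorem dMinus_dMinus_calT {k : ℕ} {F : PInf} (hF : F ∈ PSym (k + 2)) :
    dMinus k (dMinus (k + 1) (calT k F)) = dMinus k (dMinus (k + 1) F) := by
  obtain ⟨G, hG, hs, e⟩ := exists_calT_sub_eq hF
  -- Since `G` is invariant, the image of `(T - 1) F` under `(∂^-)^2` is its own negative, hence
  -- zero in characteristic zero.
  have h := dMinus_dMinus_antisymm hG
  rw [hs, ← e, map_sub, map_sub] at h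
  have h2 : (2 : QTQ) • (dMinus k (dMinus (k + 1) (calT k F)) -
      dMinus k (dMinus (k + 1) F)) = 0 := by
    rw [two_smul]
    nth_rewrite 1 [h]
    rw [neg_add_cancel]
  have two_ne : (2 : QTQ) ≠ 0 := by
    intro h0
    have : algebraMap (MvPolynomial (Fin 2) ℚ) QTQ 2 = algebraMap (MvPolynomial (Fin 2) ℚ) QTQ 0 := by
      rw [map_ofNat, h0, map_zero]
    exact two_ne_zero (algebraMap_QTQ_injective this)
  exact sub_eq_zero.mp ((smul_eq_zero.mp h2).resolve_left two_ne)

/-! ### The commutators -/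

/-- `[∂^*, ∂^-]` on `𝒫(k+1)^+`. -/
def commStar (k : ℕ) : PInf →ₗ[QTQ] PInf :=
  (om (k + 1)).toLinearMap ∘ₗ dMinus k - dMinus (k + 1) ∘ₗ (om (k + 2)).toLinearMap

theorem commStar_apply (k : ℕ) (F : PInf) :
    commStar k F = om (k + 1) (dMinus k F) - dMinus (k + 1) (om (k + 2) F) := rfl

theorem commStar_mem {k : ℕ} {F : PInf} (hF : F ∈ PSym (k + 1)) : commStar k F ∈ PSym (k + 1) :=
  (PSym (k + 1)).sub_mem (om_succ_mem (dMinus_mem hF)) (dMinus_mem (om_succ_mem hF))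

theorem commStar_of_mem {k : ℕ} {c : PInf} (hc : c ∈ PSym k) : commStar k c = 0 := by
  rw [commStar_apply, dMinus_of_mem hc, om_stable hc, dMinus_of_mem (om_succ_mem hc), sub_self]

theorem commStar_mul {k : ℕ} {c F : PInf} (hc : c ∈ PSym k) (hF : F ∈ PSym (k + 1)) :
    commStar k (c * F) = om (k + 1) c * commStar k F := by
  rw [commStar_apply, dMinus_mul hc hF, map_mul, map_mul, om_stable hc,
    dMinus_mul (om_succ_mem hc) (om_succ_mem hF), commStar_apply]
  ring

theorem commStar_calT {k i : ℕ} (h : i + 1 < k) {F : PInf} (hF : F ∈ PSym (k + 1)) :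
    commStar k (calT i F) = calT (i + 1) (commStar k F) := by
  rw [commStar_apply, dMinus_calT h hF, calT_om (by omega), calT_om (by omega),
    dMinus_calT (by omega) (om_succ_mem hF), commStar_apply, map_sub]

/-- The recursion for `Q_n` transported by the cyclic shift, under which `x_{k+1}` becomes `q x_1`.
The factor `t` in front of the second term is the one in the recursion. -/
theorem commStar_xv_mul {k : ℕ} {F : PInf} (hF : F ∈ PSym (k + 1)) :
    commStar k (xv k * F) =
      qc • (xv 0 * (om (k + 1) (dMinus k F) - tc • dMinus (k + 1) (om (k + 2) F))) := by
  refine PSym_span (p := fun F => commStar k (xv k * F) =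
      qc • (xv 0 * (om (k + 1) (dMinus k F) - tc • dMinus (k + 1) (om (k + 2) F))))
    (fun c hc n => ?_) (fun F _ G _ h1 h2 => ?_) hF
  · have e : ∀ n, om (k + 2) (c * xv k ^ n) = om (k + 1) c * xv (k + 1) ^ n := fun n => by
      rw [map_mul, map_pow, om_stable hc, om_xv_of_lt (by omega)]
    have e2 : xv k * (c * xv k ^ n) = c * xv k ^ (n + 1) := by ring
    rw [e2, commStar_apply, e, e, dMinus_mul_pow hc, dMinus_mul_pow hc,
      dMinus_mul_pow (om_succ_mem hc), dMinus_mul_pow (om_succ_mem hc), map_mul, map_mul]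
    have := om_qFn_succ k n
    simp only [Algebra.smul_def] at *
    linear_combination om (k + 1) c * this
  · simp only [mul_add, map_add, h1, h2, smul_add, mul_sub, smul_sub]
    abel

/-- `t ∂^- [∂^*, ∂^-] = [∂^*, ∂^-] ∂^- T_{k-1}`. -/
theorem dMinus_commStar {k : ℕ} {F : PInf} (hF : F ∈ PSym (k + 2)) :
    tc • dMinus (k + 1) (commStar (k + 1) F) = commStar k (dMinus (k + 1) (calT k F)) := by
  refine PSym_induction (p := fun F => tc • dMinus (k + 1) (commStar (k + 1) F) =
    commStar k (dMinus (k + 1) (calT k F))) (fun F hF => ?_) (fun F _ G _ h1 h2 => ?_)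
    (fun F hF h => ?_) hF
  · rw [commStar_of_mem hF, map_zero, smul_zero, dMinus_succ_calT hF,
      commStar_of_mem (dMinus_mem hF)]
  · simp only [map_add, smul_add, h1, h2]
  · have hTF : calT k F ∈ PSym (k + 2) := calT_mem (by omega) hF
    have hDF := dMinus_mem hF
    have hDTF := dMinus_mem hTF
    have hH : calT k F + (tc - 1) • F ∈ PSym (k + 2) :=
      (PSym (k + 2)).add_mem hTF ((PSym (k + 2)).smul_mem hF _)
    have ha : om (k + 2) (dMinus (k + 1) F) ∈ PSym (k + 2) := om_succ_mem hDF
    have hb : dMinus (k + 2) (om (k + 3) F) ∈ PSym (k + 2) := dMinus_mem (om_succ_mem hF)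
    have hab : om (k + 2) (dMinus (k + 1) F) - tc • dMinus (k + 2) (om (k + 3) F) ∈ PSym (k + 2) :=
      (PSym (k + 2)).sub_mem ha ((PSym (k + 2)).smul_mem hb _)
    -- Multiplication by `x_{k+2}` becomes multiplication by `q x_1` on both sides. Once `(∂^-)^2`
    -- has absorbed the Hecke operator, what remains is `q t x_1` times the induction hypothesis.
    rw [commStar_xv_mul hF, calT_xv_succ_mul, dMinus_mul (xv_mem (by omega)) hH,
      commStar_xv_mul (dMinus_mem hH), map_smul, dMinus_mul (xv_mem (by omega)) hab]
    simp only [map_add, map_sub, map_smul, dMinus_dMinus_calT hF]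
    rw [commStar_apply, commStar_apply, map_sub, dMinus_dMinus_calT hF] at h
    simp only [Algebra.smul_def, map_sub, map_one] at *
    linear_combination algebraMap QTQ PInf qc * xv 0 * algebraMap QTQ PInf tc * h

theorem calT_om_om {k : ℕ} {F : PInf} (hF : F ∈ PSym k) :
    calT 0 (om (k + 2) (om (k + 1) F)) = om (k + 2) (om (k + 1) F) := by
  rw [calT_eq_self_iff_swp, swp_om_om, swp_of_mem hF le_rfl]

/-- `t [∂^*, ∂^-] ∂^* = T_1 ∂^* [∂^*, ∂^-]`. -/
theorem commStar_om {k : ℕ} {F : PInf} (hF : F ∈ PSym (k + 1)) :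
    tc • commStar (k + 1) (om (k + 2) F) = calT 0 (om (k + 2) (commStar k F)) := by
  refine PSym_induction (p := fun F => tc • commStar (k + 1) (om (k + 2) F) =
    calT 0 (om (k + 2) (commStar k F))) (fun F hF => ?_) (fun F _ G _ h1 h2 => ?_)
    (fun F hF h => ?_) hF
  · rw [om_stable hF, commStar_of_mem (om_succ_mem hF), commStar_of_mem hF, map_zero, map_zero,
      smul_zero]
  · simp only [map_add, smul_add, h1, h2]
  · rw [map_mul, om_xv_of_lt (by omega), commStar_xv_mul (om_succ_mem hF), commStar_xv_mul hF,
      map_smul, map_mul, om_xv_of_lt (by omega), map_smul, calT_xv_succ_mul]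
    simp only [map_sub, map_smul, calT_om_om (dMinus_mem hF)]
    rw [commStar_apply, commStar_apply, map_sub, map_sub, calT_om_om (dMinus_mem hF)] at h
    simp only [Algebra.smul_def, map_sub, map_one] at *
    linear_combination algebraMap QTQ PInf qc * xv 0 * algebraMap QTQ PInf tc * h

/-- `[∂^*, ∂^-] T_k = [∂^*, ∂^-]` from `𝒫(k)^+` to `𝒫(k+1)^+`. -/
theorem commStar_succ_calT {k : ℕ} {F : PInf} (hF : F ∈ PSym (k + 1)) :
    commStar (k + 1) (calT k F) = commStar k F := by
  rw [commStar_apply, dMinus_succ_calT hF, om_stable (dMinus_mem hF), calT_om (by omega),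
    om_stable hF, dMinus_succ_calT (om_succ_mem hF), commStar_apply]

/-- The operator `∂_k = -T_1 ⋯ T_k x_{k+1}`. -/
def dPlus (k : ℕ) : PInf →ₗ[QTQ] PInf := -(calTAsc k ∘ₗ calX k)

theorem dPlus_apply (k : ℕ) (F : PInf) : dPlus k F = -calTAsc k (xv k * F) := rfl

/-! ### Relations for `∂` and its commutator with `∂^-` -/

theorem dPlus_calT {k i : ℕ} (h : i + 1 < k) (F : PInf) :
    dPlus k (calT i F) = calT (i + 1) (dPlus k F) := by
  rw [dPlus_apply, ← calT_xv_mul_of_ne (by omega) (by omega), calTAsc_calT h, dPlus_apply, map_neg]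

/-- The composite is `(T_1 ⋯ T_{k+1}) (T_1 ⋯ T_k)` applied to `x_{k+2} x_{k+1} F`. The outer `T_1`
turns into a `T_{k+1}` on the right, which fixes this symmetric argument. -/
theorem calT_dPlus_dPlus {k : ℕ} {F : PInf} (hF : F ∈ PSym k) :
    calT 0 (dPlus (k + 1) (dPlus k F)) = dPlus (k + 1) (dPlus k F) := by
  have e : dPlus (k + 1) (dPlus k F) =
      calTAsc (k + 1) (calTAsc k (xv (k + 1) * xv k * F)) := by
    rw [dPlus_apply, dPlus_apply, mul_neg, map_neg, neg_neg, ← calTAsc_xv_mul (by omega), mul_assoc]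
  have h : calT k (xv (k + 1) * xv k * F) = xv (k + 1) * xv k * F := by
    rw [calT_eq_self_iff_swp, map_mul, map_mul, swp_xv_left, swp_xv_right, swp_of_mem hF le_rfl,
      mul_comm (xv k)]
  rw [e, calT_calTAsc_calTAsc, h]

/-- `[∂, ∂^-] = (t - 1) T_1 ⋯ T_k x_{k+1}` on `𝒫(k+1)^+`. -/
theorem commPlus_eq {k : ℕ} {F : PInf} (hF : F ∈ PSym (k + 1)) :
    dPlus k (dMinus k F) - dMinus (k + 1) (dPlus (k + 1) F) =
      (tc - 1) • calTAsc k (xv k * F) := by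
  have hxF : xv (k + 1) * F ∈ PSym (k + 2) :=
    (PSym (k + 2)).mul_mem (xv_mem (by omega)) (mem_succ hF)
  have hT : calT k F + (tc - 1) • F ∈ PSym (k + 2) :=
    (PSym (k + 2)).add_mem (calT_mem (by omega) (mem_succ hF))
      ((PSym (k + 2)).smul_mem (mem_succ hF) _)
  -- In `T_{k+1} x_{k+2} = x_{k+1} (T_{k+1} + t - 1)` the first summand cancels `∂ ∂^-`, because
  -- `∂^-` absorbs `T_{k+1}`; the second one, where `∂^-` acts as the identity, is the commutator.
  rw [dPlus_apply, dPlus_apply, map_neg, calTAsc_succ, dMinus_calTAsc (by omega)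
    (calT_mem (by omega) hxF), calT_xv_succ_mul, dMinus_mul (xv_mem (by omega)) hT, map_add,
    map_smul, dMinus_succ_calT hF, dMinus_of_mem hF, mul_add, map_add, mul_smul_comm, map_smul]
  abel

theorem dMinus_commPlus {k : ℕ} {F : PInf} (hF : F ∈ PSym (k + 2)) :
    dMinus (k + 1) ((tc - 1) • calTAsc (k + 1) (xv (k + 1) * calT k F)) =
      tc • (tc - 1) • calTAsc k (xv k * dMinus (k + 1) F) := by
  have e : calTAsc (k + 1) (xv (k + 1) * calT k F) = tc • calTAsc k (xv k * F) := by
    rw [calTAsc_succ, calT_xv_succ_mul, calT_quad]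
    have : (1 - tc) • calT k F + tc • F + (tc - 1) • calT k F = tc • F := by module
    rw [this, mul_smul_comm, map_smul]
  rw [e, map_smul, map_smul, dMinus_calTAsc (by omega)
    ((PSym (k + 2)).mul_mem (xv_mem (by omega)) hF), dMinus_mul (xv_mem (by omega)) hF, smul_comm]

theorem commPlus_dPlus {k : ℕ} (F : PInf) :
    calT 0 ((tc - 1) • calTAsc (k + 1) (xv (k + 1) * dPlus (k + 1) F)) =
      tc • dPlus (k + 1) ((tc - 1) • calTAsc k (xv k * F)) := by
  have e : xv (k + 1) * calTAsc (k + 1) (xv (k + 1) * F) =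
      calTAsc k (xv (k + 1) * calT k (xv (k + 1) * F)) := by
    rw [calTAsc_succ, calTAsc_xv_mul (by omega)]
  have e2 : calT k (xv (k + 1) * calT k (xv (k + 1) * F)) = tc • (xv (k + 1) * (xv k * F)) := by
    rw [calT_xv_succ_mul, calT_quad]
    have : (1 - tc) • calT k (xv (k + 1) * F) + tc • (xv (k + 1) * F) +
      (tc - 1) • calT k (xv (k + 1) * F) = tc • (xv (k + 1) * F) := by module
    rw [this, mul_smul_comm, mul_left_comm]
  rw [dPlus_apply, dPlus_apply, mul_neg, e, map_neg, smul_neg, map_neg, map_smul,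
    calT_calTAsc_calTAsc, e2, map_smul, map_smul, calTAsc_xv_mul (by omega), mul_smul_comm,
    map_smul, smul_neg, smul_comm]

/-! ### The operators `z_i` -/

/-- The operator by which `z_{i+1}` acts on `𝒫(k+1)^+`. -/
def zOp (k : ℕ) : ℕ → (PInf →ₗ[QTQ] PInf)
  | 0 => (tc ^ (k + 1) / (1 - tc)) • (commStar k ∘ₗ calTInvDesc k)
  | i + 1 => tc⁻¹ • (calT i ∘ₗ zOp k i ∘ₗ calT i)

theorem zOp_zero (k : ℕ) (F : PInf) :
    zOp k 0 F = (tc ^ (k + 1) / (1 - tc)) • commStar k (calTInvDesc k F) := rfl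

theorem zOp_succ (k i : ℕ) (F : PInf) :
    zOp k (i + 1) F = tc⁻¹ • calT i (zOp k i (calT i F)) := rfl

theorem zOp_mem {k i : ℕ} (hi : i ≤ k) {F : PInf} (hF : F ∈ PSym (k + 1)) :
    zOp k i F ∈ PSym (k + 1) := by
  induction i generalizing F with
  | zero =>
    rw [zOp_zero]
    exact (PSym (k + 1)).smul_mem (commStar_mem (calTInvDesc_mem (by omega) hF)) _
  | succ i ih =>
    rw [zOp_succ]
    exact (PSym (k + 1)).smul_mem (calT_mem (by omega) (ih (by omega) (calT_mem (by omega) hF))) _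

theorem calT_commStar_calTAsc {k n : ℕ} (h : n < k) {F : PInf} (hF : F ∈ PSym (k + 1)) :
    calT 0 (commStar k (calTAsc n F)) = calTAsc (n + 1) (commStar k F) := by
  induction n generalizing F with
  | zero => rfl
  | succ n ih =>
    rw [calTAsc_succ, ih (by omega) (calT_mem (by omega) hF), commStar_calT h hF]
    rfl

/-- Only `i = 0` needs work; larger indices follow by conjugation with Hecke operators, whose index
`∂` raises by one. -/
theorem dPlus_zOp {k i : ℕ} (hi : i ≤ k) {F : PInf} (hF : F ∈ PSym (k + 1)) :
    dPlus (k + 1) (zOp k i F) = zOp (k + 1) (i + 1) (dPlus (k + 1) F) := by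
  induction i generalizing F with
  | zero =>
    -- This substitution removes the inverse Hecke operators in `z_1`. On the other side, `T_1 ∂ F`
    -- is `-(T_1 ⋯ T_{k+1}) (T_1 ⋯ T_k) T_{k+1} x_{k+2} G`, whose first chain is cancelled as well.
    obtain ⟨G, rfl, hG⟩ : ∃ G, F = calTAsc k G ∧ G ∈ PSym (k + 1) :=
      ⟨_, (calTAsc_calTInvDesc k F).symm, calTInvDesc_mem (by omega) hF⟩
    have hT : calT k G + (tc - 1) • G ∈ PSym (k + 2) :=
      (PSym (k + 2)).add_mem (calT_mem (by omega) (mem_succ hG))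
        ((PSym (k + 2)).smul_mem (mem_succ hG) _)
    have hx : xv k * (calT k G + (tc - 1) • G) ∈ PSym (k + 2) :=
      (PSym (k + 2)).mul_mem (xv_mem (by omega)) hT
    -- The commutator at the next vertex kills `G`, so the term with `t - 1` disappears.
    have e : commStar (k + 1) (xv k * (calT k G + (tc - 1) • G)) = xv (k + 1) * commStar k G := by
      rw [commStar_mul (xv_mem (by omega)) hT, om_xv_of_lt (by omega), map_add, map_smul,
        commStar_of_mem hG, smul_zero, add_zero, commStar_succ_calT hG]
    rw [zOp_succ, zOp_zero, zOp_zero, calTInvDesc_calTAsc, dPlus_apply (k + 1) (calTAsc k G),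
      ← calTAsc_xv_mul (by omega), map_neg, calT_calTAsc_calTAsc, map_neg, calTInvDesc_calTAsc,
      calT_xv_succ_mul, map_neg, smul_neg, map_neg, map_smul (calT 0), calT_commStar_calTAsc (by omega) hx, e,
      map_smul, dPlus_apply, smul_neg, smul_neg, smul_smul]
    congr 2
    rw [pow_succ tc (k + 1)]
    field_simp [tc_ne_zero]
  | succ i ih =>
    rw [zOp_succ, map_smul, dPlus_calT (by omega), ih (by omega) (calT_mem (by omega) hF),
      dPlus_calT (by omega), zOp_succ (k + 1) (i + 1)]

theorem zOp_dPlus {k : ℕ} {F : PInf} (hF : F ∈ PSym k) :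
    zOp k 0 (dPlus k F) = -(qc * tc ^ (k + 1)) • (xv 0 * om (k + 1) F) := by
  rw [zOp_zero, dPlus_apply, map_neg, calTInvDesc_calTAsc, map_neg, commStar_xv_mul (mem_succ hF),
    dMinus_of_mem hF, om_stable hF, dMinus_of_mem (om_succ_mem hF)]
  have e : om (k + 1) F - tc • om (k + 1) F = (1 - tc) • om (k + 1) F := by module
  rw [e, mul_smul_comm, smul_neg, smul_smul, smul_smul, neg_smul]
  congr 2
  field_simp [one_sub_tc_ne_zero]

/-! ### The limit of the Cherednik operators -/

/-- The operator `∂^* ∂^- - t ∂^- ∂^*` on `𝒫(k+1)^+`. -/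
def tComm (k : ℕ) : PInf →ₗ[QTQ] PInf :=
  (om (k + 1)).toLinearMap ∘ₗ dMinus k - tc • (dMinus (k + 1) ∘ₗ (om (k + 2)).toLinearMap)

theorem tComm_apply (k : ℕ) (F : PInf) :
    tComm k F = om (k + 1) (dMinus k F) - tc • dMinus (k + 1) (om (k + 2) F) := rfl

theorem tComm_succ_calT {k : ℕ} {F : PInf} (hF : F ∈ PSym (k + 1)) :
    tComm (k + 1) (calT k F) = tComm k F := by
  rw [tComm_apply, dMinus_succ_calT hF, om_stable (dMinus_mem hF), calT_om (by omega),
    om_stable hF, dMinus_succ_calT (om_succ_mem hF), tComm_apply]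

/-- In `n + 1` variables the alphabet `x_{n+1} + ⋯` has a single letter, so `Q_a` is `(1 - t)
x_{n+1}^a`, while `x_{n+2} + ⋯` is empty. For `a = 0` both terms are `1` and contribute `1 - t` all
the same. -/
theorem proj_tComm {n : ℕ} {H : PInf} (hH : H ∈ PSym (n + 1)) :
    proj (tComm n H) (n + 1) = (1 - tc) • proj (om (n + 1) H) (n + 1) := by
  refine PSym_span (p := fun H => proj (tComm n H) (n + 1) =
    (1 - tc) • proj (om (n + 1) H) (n + 1)) (fun c hc a => ?_) (fun F _ G _ h1 h2 => ?_) hH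
  · have e : proj (om (n + 1) (qFn n a)) (n + 1) - tc • proj (qFn (n + 1) a) (n + 1) =
        (1 - tc) • proj ((qc • xv 0) ^ a) (n + 1) := by
      rcases eq_or_ne a 0 with rfl | ha
      · rw [qFn_zero, qFn_zero, map_one, pow_zero, proj_one]
        module
      · rw [proj_om le_rfl, proj_qFn_succ n a ha, proj_qFn_self (n + 1) a ha, smul_zero, sub_zero,
          map_smul, proj_pow, proj_smul, proj_xv_of_lt (by omega)]
        congr 1
        change (aeval fun j => if j + 1 < n + 1 then X (j + 1) else if j + 1 = n + 1 then qc • X 0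
          else X j : Poly →ₐ[QTQ] Poly) (X n ^ a) = _
        rw [map_pow, aeval_X, if_neg (by omega), if_pos rfl]
    rw [tComm_apply, dMinus_mul_pow hc, map_mul, map_mul (om (n + 2)), map_pow, om_stable hc,
      om_xv_of_lt (by omega), dMinus_mul_pow (om_succ_mem hc), map_mul, map_pow, om_xv_last]
    simp only [proj_sub, proj_smul, proj_mul, smul_eq_C_mul] at e ⊢
    linear_combination proj (om (n + 1) c) (n + 1) * e
  · rw [map_add, map_add, proj_add, proj_add, h1, h2, smul_add]

/-- `T_{k+r} ⋯ T_{k+2} T_{k+1}`. -/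
def calTChain (k : ℕ) : ℕ → (PInf →ₗ[QTQ] PInf)
  | 0 => LinearMap.id
  | r + 1 => calT (k + r) ∘ₗ calTChain k r

/-- `T_{k+r}⁻¹ ⋯ T_{k+2}⁻¹ T_{k+1}⁻¹`. -/
def calTInvChain (k : ℕ) : ℕ → (PInf →ₗ[QTQ] PInf)
  | 0 => LinearMap.id
  | r + 1 => calTInv (k + r) ∘ₗ calTInvChain k r

theorem calTChain_succ (k r : ℕ) (F : PInf) :
    calTChain k (r + 1) F = calT (k + r) (calTChain k r F) := rfl

theorem calTInvChain_succ (k r : ℕ) (F : PInf) :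
    calTInvChain k (r + 1) F = calTInv (k + r) (calTInvChain k r F) := rfl

theorem calTChain_mem {k : ℕ} (r : ℕ) {F : PInf} (hF : F ∈ PSym (k + 1)) :
    calTChain k r F ∈ PSym (k + r + 1) := by
  induction r with
  | zero => exact hF
  | succ r ih =>
    rw [calTChain_succ]
    exact calT_mem (by omega) (mem_succ ih)

theorem tComm_calTChain {k : ℕ} (r : ℕ) {F : PInf} (hF : F ∈ PSym (k + 1)) :
    tComm (k + r) (calTChain k r F) = tComm k F := by
  induction r with
  | zero => rfl
  | succ r ih =>
    rw [calTChain_succ, ← ih]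
    exact tComm_succ_calT (calTChain_mem r hF)

theorem calTInvChain_of_mem {k : ℕ} (r : ℕ) {c : PInf} (hc : c ∈ PSym k) :
    calTInvChain k r c = c := by
  induction r with
  | zero => rfl
  | succ r ih =>
    rw [calTInvChain_succ, ih, calTInv_apply, calT_of_mem hc (by omega),
      inv_smul_eq_iff₀ tc_ne_zero]
    module

/-- Iterates `t T_i⁻¹ x_i = x_{i+1} T_i`. -/
theorem calTInvChain_xv_mul (k r : ℕ) (F : PInf) :
    tc ^ r • calTInvChain k r (xv k * F) = xv (k + r) * calTChain k r F := by
  induction r with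
  | zero => simp [calTInvChain, calTChain]
  | succ r ih =>
    rw [calTInvChain_succ, pow_succ', mul_smul, ← map_smul (calTInv (k + r)), ih,
      tc_smul_calTInv, calT_xv_mul, calTChain_succ, add_assoc]
    have : (1 - tc) • (xv (k + r) * calTChain k r F) +
      (tc - 1) • (xv (k + r) * calTChain k r F) = 0 := by module
    rw [this, add_zero]
    rfl

theorem calTInvDesc_add (k r : ℕ) (F : PInf) :
    calTInvDesc (k + r) F = calTInvChain k r (calTInvDesc k F) := by
  induction r with
  | zero => rfl
  | succ r ih =>
    rw [calTInvChain_succ, ← ih]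
    rfl

theorem polyTInvDesc_proj {n m : ℕ} (h : n < m) (F : PInf) :
    polyTInvDesc n (proj F m) = proj (calTInvDesc n F) m := by
  induction n with
  | zero => rfl
  | succ n ih =>
    rw [polyTInvDesc, LinearMap.comp_apply, ih (by omega), calTInvDesc_succ, calTInv_apply,
      proj_smul, proj_add, proj_calT h]
    rfl

theorem swp_kill {i k : ℕ} (h : k < i) (F : PInf) : swp i (kill k F) = kill k (swp i F) := by
  refine subst_subst_comm _ _ _ _ (fun j => ?_) F
  simp only [aeval_X, Equiv.swap_apply_def]
  split_ifs <;> simp <;> grind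

theorem kill_mem {i k : ℕ} (h : i < k) {F : PInf} (hF : F ∈ PSym k) : kill i F ∈ PSym k :=
  mem_PSym.mpr fun j hj => by rw [swp_kill (by omega), swp_of_mem hF hj]

theorem prFirst_proj (F : PInf) (m : ℕ) : prFirst (proj F m) = proj (F - kill 0 F) m := by
  rw [proj_sub, proj_kill]
  rfl

theorem kill_xv (k : ℕ) : kill k (xv k) = 0 := by
  rw [kill, subst_xv, if_pos rfl]
  exact map_zero ofPolyHom

/-- Write `T_k⁻¹ ⋯ T_1⁻¹ F = c + x_{k+1} G` with `c` in `𝒫(k)^+`. The further inverse Hecke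
operators fix `c`, which leaves the error `t^m pr_1 ω^{-1} c`. On the other summand they move
`x_{k+1}` to the last variable, whose image `q x_1` makes `pr_1` act as the identity; the result is
independent of the rank. -/
theorem polyY_zero_proj {k : ℕ} {F : PInf} (hF : F ∈ PSym (k + 1)) :
    ∃ g ∈ PSym (k + 1), ∀ m, k + 1 ≤ m →
      polyY m 0 (proj F m) = proj (zOp k 0 F) m + tc ^ m • proj g m := by
  have hG0 : calTInvDesc k F ∈ PSym (k + 1) := calTInvDesc_mem (by omega) hF
  obtain ⟨G, hG, e⟩ := exists_decomp hG0
  set c := contract k (calTInvDesc k F) with hc0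
  have hc : c ∈ PSym k := contract_mem hG0
  have hoc : om (k + 1) c ∈ PSym (k + 1) := om_succ_mem hc
  refine ⟨om (k + 1) c - kill 0 (om (k + 1) c),
    (PSym (k + 1)).sub_mem hoc (kill_mem (by omega) hoc), fun m hm => ?_⟩
  obtain ⟨r, rfl⟩ : ∃ r, m = k + r + 1 := ⟨m - k - 1, by omega⟩
  have hz : zOp k 0 F = (tc ^ (k + 1) / (1 - tc)) • qc • (xv 0 * tComm k G) := by
    rw [zOp_zero, e, map_add, commStar_of_mem hc, zero_add, commStar_xv_mul hG, tComm_apply]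
  have h1 : polyY (k + r + 1) 0 (proj F (k + r + 1)) = tc ^ (k + 1) • tc ^ r •
      prFirst (proj (om (k + r + 1) (calTInvChain k r (calTInvDesc k F))) (k + r + 1)) := by
    rw [polyY, LinearMap.smul_apply, LinearMap.comp_apply, Nat.add_sub_cancel,
      polyTInvDesc_proj (by omega), varpi, LinearMap.comp_apply, proj_om le_rfl, calTInvDesc_add,
      smul_smul, ← pow_add]
    congr 2
    omega
  have h2 : tc ^ r • om (k + r + 1) (calTInvChain k r (calTInvDesc k F)) =
      tc ^ r • om (k + 1) c + qc • (xv 0 * om (k + r + 1) (calTChain k r G)) := by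
    rw [e, map_add, map_add, smul_add, calTInvChain_of_mem r hc, om_eq_of_le (by omega) hc,
      ← map_smul (om (k + r + 1)) (tc ^ r) (calTInvChain k r (xv k * G)), calTInvChain_xv_mul,
      map_mul, om_xv_last, smul_mul_assoc]
  -- At finite level the cyclic shift equals `tComm` up to the factor `1 - t`, and `tComm` absorbs
  -- the growing chain of Hecke operators.
  have h3 : proj (om (k + r + 1) (calTChain k r G)) (k + r + 1) =
      (1 - tc)⁻¹ • proj (tComm k G) (k + r + 1) := by
    rw [← tComm_calTChain r hG, proj_tComm (calTChain_mem r hG), inv_smul_smul₀ one_sub_tc_ne_zero]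
  rw [h1, ← map_smul prFirst, ← proj_smul, h2, prFirst_proj, hz]
  simp only [map_add, map_smul, map_mul, kill_xv, zero_mul, smul_zero, add_zero, proj_sub,
    proj_add, proj_smul, proj_mul, h3, smul_eq_C_mul, mul_comm]
  have e5 : tc ^ (k + r + 1) = tc ^ (k + 1) * tc ^ r := by rw [← pow_add]; congr 1; omega
  rw [e5, div_eq_mul_inv, C_mul, C_mul]
  ring

/-- Conjugation by `T_i` commutes with `Π_m` and does not affect the scalar `t^m`. -/
theorem polyY_proj {k i : ℕ} (hi : i ≤ k) {F : PInf} (hF : F ∈ PSym (k + 1)) :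
    ∃ g ∈ PSym (k + 1), ∀ m, k + 1 ≤ m →
      polyY m i (proj F m) = proj (zOp k i F) m + tc ^ m • proj g m := by
  induction i generalizing F with
  | zero => exact polyY_zero_proj hF
  | succ i ih =>
    obtain ⟨g, hg, h⟩ := ih (by omega) (calT_mem (show i + 1 < k + 1 by omega) hF)
    refine ⟨tc⁻¹ • calT i g, (PSym (k + 1)).smul_mem (calT_mem (by omega) hg) _, fun m hm => ?_⟩
    rw [polyY, LinearMap.smul_apply, LinearMap.comp_apply, LinearMap.comp_apply,
      ← proj_calT (by omega), h m hm, map_add, map_smul, ← proj_calT (by omega),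
      ← proj_calT (by omega), zOp_succ, proj_smul, proj_smul, smul_add, smul_comm]

theorem hasStableLimit_polyY {k i : ℕ} (hi : i ≤ k) {F : PInf} (hF : F ∈ PSym (k + 1)) :
    HasStableLimit (fun m => polyY m i (proj F m)) (zOp k i F) := by
  obtain ⟨g, hg, h⟩ := polyY_proj hi hF
  refine ⟨1, zOp k i F, fun _ => g, fun _ m => tc ^ m, fun _ => 0, fun _ => ⟨_, hg⟩,
    fun _ => coeffTendsto_tc_pow, ?_, by simp⟩
  filter_upwards [eventually_ge_atTop (k + 1)] with m hm
  rw [h m hm, Fin.sum_univ_one]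

theorem calY_of_mem {k i : ℕ} (hi : i ≤ k) {F : PInf} (hF : F ∈ PSym (k + 1)) :
    calY i F = zOp k i F :=
  calY_eq (hasStableLimit_polyY hi hF)

theorem hasStableLimit_calY (i : ℕ) {F : PInf} (hF : F ∈ PAs) :
    HasStableLimit (fun m => polyY m i (proj F m)) (calY i F) ∧ calY i F ∈ PAs := by
  obtain ⟨k, hk⟩ := hF
  -- `z_i` is only defined at vertices with at least as many variables as its index, so `F` is
  -- viewed in a larger space if necessary.
  have hFmax : F ∈ PSym (max k i + 1) := PSym_mono (by omega) hk
  rw [calY_of_mem (le_max_right k i) hFmax]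
  exact ⟨hasStableLimit_polyY (le_max_right k i) hFmax, _, zOp_mem (le_max_right k i) hFmax⟩

/-! ### A partial fraction identity -/

section PartialFractions

variable {L : Type*} [Field L] {ι : Type*} [Fintype ι] [DecidableEq ι]

/-- The difference of the two sides has degree below the number of the `x_j`, since the term with `t
^ card` cancels the top coefficient, and it vanishes at all the distinct points `x_j⁻¹`. -/
theorem prod_one_sub_eq_sum (t : L) {x : ι → L} (hx : Function.Injective x) (h0 : ∀ i, x i ≠ 0) :
    ∏ i, (1 - Polynomial.C (t * x i) * Polynomial.X) =
      Polynomial.C (t ^ Fintype.card ι) * ∏ i, (1 - Polynomial.C (x i) * Polynomial.X) +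
      ∑ j, Polynomial.C ((1 - t) * ∏ i ∈ Finset.univ.erase j, (t * x i - x j) / (x i - x j)) *
        ∏ i ∈ Finset.univ.erase j, (1 - Polynomial.C (x i) * Polynomial.X) := by
  have hdeg1 : ∀ a : L, (1 - Polynomial.C a * Polynomial.X).natDegree ≤ 1 := fun a => by
    refine (Polynomial.natDegree_sub_le _ _).trans (max_le (by simp) ?_)
    exact (Polynomial.natDegree_C_mul_le _ _).trans Polynomial.natDegree_X_le
  have hc1 : ∀ a : L, (1 - Polynomial.C a * Polynomial.X).coeff 1 = -a := fun a => by
    simp [Polynomial.coeff_one]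
  have hprod : ∀ (s : Finset ι) (a : ι → L),
      (∏ i ∈ s, (1 - Polynomial.C (a i) * Polynomial.X)).natDegree ≤ s.card := fun s a => by
    refine (Polynomial.natDegree_prod_le _ _).trans ?_
    simpa using Finset.sum_le_sum fun i (_ : i ∈ s) => hdeg1 (a i)
  have hcoeff : ∀ a : ι → L, (∏ i, (1 - Polynomial.C (a i) * Polynomial.X)).coeff
      (Fintype.card ι) = ∏ i, (-a i) := fun a => by
    have := Polynomial.coeff_prod_of_natDegree_le (s := Finset.univ)
      (f := fun i => 1 - Polynomial.C (a i) * Polynomial.X) 1 fun i _ => hdeg1 (a i)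
    rw [mul_one, Finset.card_univ] at this
    rw [this]
    exact Finset.prod_congr rfl fun i _ => hc1 (a i)
  rcases isEmpty_or_nonempty ι with hι | hι
  · simp
  rw [← sub_eq_zero]
  set p := ∏ i, (1 - Polynomial.C (t * x i) * Polynomial.X) - (
      Polynomial.C (t ^ Fintype.card ι) * ∏ i, (1 - Polynomial.C (x i) * Polynomial.X) +
      ∑ j, Polynomial.C ((1 - t) * ∏ i ∈ Finset.univ.erase j, (t * x i - x j) / (x i - x j)) *
        ∏ i ∈ Finset.univ.erase j, (1 - Polynomial.C (x i) * Polynomial.X)) with hp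
  have hcard : 0 < Fintype.card ι := Fintype.card_pos
  have hsum : ∀ j, (Polynomial.C ((1 - t) * ∏ i ∈ Finset.univ.erase j,
      (t * x i - x j) / (x i - x j)) *
        ∏ i ∈ Finset.univ.erase j, (1 - Polynomial.C (x i) * Polynomial.X)).natDegree <
        Fintype.card ι := fun j => by
    refine (Polynomial.natDegree_C_mul_le _ _).trans_lt ((hprod _ _).trans_lt ?_)
    rw [Finset.card_erase_of_mem (Finset.mem_univ _), Finset.card_univ]
    omega
  have hle : p.natDegree ≤ Fintype.card ι := by
    refine (Polynomial.natDegree_sub_le _ _).trans (max_le (hprod _ _) ?_)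
    refine (Polynomial.natDegree_add_le _ _).trans (max_le ?_ ?_)
    · exact (Polynomial.natDegree_C_mul_le _ _).trans (hprod _ _)
    · exact Polynomial.natDegree_sum_le_of_forall_le _ _ fun j _ => (hsum j).le
  have htop : p.coeff (Fintype.card ι) = 0 := by
    rw [hp, Polynomial.coeff_sub, Polynomial.coeff_add, hcoeff, Polynomial.coeff_C_mul, hcoeff,
      Polynomial.finsetSum_coeff,
      Finset.sum_eq_zero fun j _ => Polynomial.coeff_eq_zero_of_natDegree_lt (hsum j), add_zero,
      ← Finset.card_univ, ← Finset.prod_const, ← Finset.prod_mul_distrib, sub_eq_zero]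
    exact Finset.prod_congr rfl fun i _ => by ring
  have hlt : p.natDegree < Fintype.card ι := by
    refine lt_of_le_of_ne hle fun h => ?_
    rw [← h, Polynomial.coeff_natDegree, Polynomial.leadingCoeff_eq_zero] at htop
    rw [htop, Polynomial.natDegree_zero] at h
    omega
  refine Polynomial.eq_zero_of_natDegree_lt_card_of_eval_eq_zero p (f := fun i => (x i)⁻¹)
    (fun a b h => hx (inv_injective h)) (fun j => ?_) hlt
  have hz : ∏ i, (1 - x i * (x j)⁻¹) = 0 :=
    Finset.prod_eq_zero (Finset.mem_univ j) (by rw [mul_inv_cancel₀ (h0 j), sub_self])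
  rw [hp]
  simp only [Polynomial.eval_sub, Polynomial.eval_add, Polynomial.eval_mul, Polynomial.eval_C,
    Polynomial.eval_prod, Polynomial.eval_one, Polynomial.eval_X, Polynomial.eval_finsetSum, hz]
  have hz' : ∀ i, i ≠ j → ∏ l ∈ Finset.univ.erase i, (1 - x l * (x j)⁻¹) = 0 := fun i hij =>
    Finset.prod_eq_zero (Finset.mem_erase.mpr ⟨hij.symm, Finset.mem_univ j⟩)
      (by rw [mul_inv_cancel₀ (h0 j), sub_self])
  have hA : ∏ i, (1 - t * x i * (x j)⁻¹) =
      (1 - t) * ∏ i ∈ Finset.univ.erase j, (1 - t * x i * (x j)⁻¹) := by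
    rw [← Finset.mul_prod_erase Finset.univ (fun i => 1 - t * x i * (x j)⁻¹) (Finset.mem_univ j),
      mul_assoc t, mul_inv_cancel₀ (h0 j), mul_one]
  have hB : (∏ i ∈ Finset.univ.erase j, (t * x i - x j) / (x i - x j)) *
      ∏ i ∈ Finset.univ.erase j, (1 - x i * (x j)⁻¹) =
      ∏ i ∈ Finset.univ.erase j, (1 - t * x i * (x j)⁻¹) := by
    rw [← Finset.prod_mul_distrib]
    refine Finset.prod_congr rfl fun i hi => ?_
    have hij : x i - x j ≠ 0 := sub_ne_zero.mpr fun h => (Finset.mem_erase.mp hi).1 (hx h)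
    have := h0 j
    field_simp
    ring
  rw [Finset.sum_eq_single j (fun i _ hij => by rw [hz' i hij, mul_zero])
    (fun h => absurd (Finset.mem_univ j) h), hA, ← hB]
  ring

/-- The coefficients of `∏ (1 - t x_i u) / (1 - x_i u)` by partial fractions. -/
theorem coeff_prod_qFactor (t : L) {x : ι → L} (hx : Function.Injective x) (h0 : ∀ i, x i ≠ 0)
    (n : ℕ) :
    PowerSeries.coeff n (∏ i, PowerSeries.mk fun n => if n = 0 then 1 else (1 - t) * x i ^ n) =
      (if n = 0 then t ^ Fintype.card ι else 0) +
      (1 - t) * ∑ j, x j ^ n * ∏ i ∈ Finset.univ.erase j, (t * x i - x j) / (x i - x j) := by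
  have hgeo : ∀ a : L, (1 - PowerSeries.C a * PowerSeries.X) * PowerSeries.mk (fun n => a ^ n) = 1 :=
    fun a => by
    ext1 n
    rw [sub_mul, one_mul, mul_assoc, map_sub, PowerSeries.coeff_C_mul, PowerSeries.coeff_one]
    rcases n with _ | n
    · simp
    · rw [PowerSeries.coeff_succ_X_mul, PowerSeries.coeff_mk, PowerSeries.coeff_mk, pow_succ']
      simp
  have hfac : ∀ a : L, (1 - PowerSeries.C a * PowerSeries.X) *
      PowerSeries.mk (fun n => if n = 0 then 1 else (1 - t) * a ^ n) =
      1 - PowerSeries.C (t * a) * PowerSeries.X := fun a => by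
    have : PowerSeries.mk (fun n => if n = 0 then 1 else (1 - t) * a ^ n) =
        PowerSeries.C t + PowerSeries.C (1 - t) * PowerSeries.mk (fun n => a ^ n) := by
      ext1 n
      rw [map_add, PowerSeries.coeff_C_mul, PowerSeries.coeff_C, PowerSeries.coeff_mk,
        PowerSeries.coeff_mk]
      split_ifs with h
      · rw [h, pow_zero]; ring
      · ring
    rw [this]
    have h := hgeo a
    simp only [map_sub, map_mul, map_one]
    linear_combination (1 - PowerSeries.C t) * h
  have hne : ∏ i, (1 - PowerSeries.C (x i) * PowerSeries.X) ≠ 0 := by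
    refine Finset.prod_ne_zero_iff.mpr fun i _ h => ?_
    have := hgeo (x i)
    rw [h, zero_mul] at this
    exact zero_ne_one this
  have key : ∏ i, PowerSeries.mk (fun n => if n = 0 then 1 else (1 - t) * x i ^ n) =
      PowerSeries.C (t ^ Fintype.card ι) + ∑ j, PowerSeries.C ((1 - t) *
        ∏ i ∈ Finset.univ.erase j, (t * x i - x j) / (x i - x j)) *
        PowerSeries.mk (fun n => x j ^ n) := by
    apply mul_left_cancel₀ hne
    rw [← Finset.prod_mul_distrib, Finset.prod_congr rfl fun i _ => hfac (x i)]
    have h := congrArg (Polynomial.coeToPowerSeries.ringHom (R := L)) (prod_one_sub_eq_sum t hx h0)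
    obtain ⟨R, hR⟩ : ∃ R : ι → L, ∀ j, (1 - t) *
        ∏ i ∈ Finset.univ.erase j, (t * x i - x j) / (x i - x j) = R j := ⟨_, fun _ => rfl⟩
    simp only [hR] at h ⊢
    simp only [map_prod, map_sub, map_mul, map_one, map_add, map_sum, map_pow,
      Polynomial.coeToPowerSeries.ringHom_apply, Polynomial.coe_C, Polynomial.coe_X] at h ⊢
    rw [h, mul_add, mul_comm (PowerSeries.C t ^ _), Finset.mul_sum]
    congr 1
    refine Finset.sum_congr rfl fun j _ => ?_
    rw [← Finset.mul_prod_erase Finset.univ (fun i => 1 - PowerSeries.C (x i) * PowerSeries.X)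
      (Finset.mem_univ j)]
    linear_combination (-PowerSeries.C (R j) *
      ∏ i ∈ Finset.univ.erase j, (1 - PowerSeries.C (x i) * PowerSeries.X)) * hgeo (x j)
  rw [key, map_add, PowerSeries.coeff_C, map_sum, Finset.mul_sum]
  congr 1
  refine Finset.sum_congr rfl fun j _ => ?_
  rw [PowerSeries.coeff_C_mul, PowerSeries.coeff_mk]
  ring

end PartialFractions

/-! ### Hall–Littlewood sums -/

section HallLittlewood

variable {L : Type*} [Field L]

/-- The product `∏_{i<j} (y_i - s y_j)`. -/
def pairProd (s : L) {n : ℕ} (y : Fin n → L) : L := ∏ i : Fin n, ∏ j ∈ Finset.Ioi i, (y i - s * y j)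

theorem pairProd_eq (s : L) {n : ℕ} (y : Fin n → L) :
    pairProd s y = ∏ i, ∏ j, if i < j then y i - s * y j else 1 := by
  refine Finset.prod_congr rfl fun i _ => ?_
  rw [← Finset.prod_filter]
  refine Finset.prod_congr ?_ fun _ _ => rfl
  ext j
  simp

theorem pairProd_succ (s : L) {n : ℕ} (y : Fin (n + 1) → L) :
    pairProd s y = pairProd s (fun i : Fin n => y i.castSucc) *
      ∏ i : Fin n, (y i.castSucc - s * y (Fin.last n)) := by
  rw [pairProd_eq, pairProd_eq, Fin.prod_univ_castSucc]
  have h : (∏ j, if Fin.last n < j then y (Fin.last n) - s * y j else 1) = 1 :=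
    Finset.prod_eq_one fun j _ => if_neg (Fin.le_last j).not_gt
  rw [h, mul_one, ← Finset.prod_mul_distrib]
  refine Finset.prod_congr rfl fun i _ => ?_
  rw [Fin.prod_univ_castSucc]
  simp [Fin.castSucc_lt_last]

theorem pairProd_one_ne_zero {n : ℕ} {y : Fin n → L} (hy : Function.Injective y) :
    pairProd 1 y ≠ 0 := by
  refine Finset.prod_ne_zero_iff.mpr fun i _ => Finset.prod_ne_zero_iff.mpr fun j hj => ?_
  rw [one_mul, sub_ne_zero]
  exact fun h => (Finset.mem_Ioi.mp hj).ne (hy h)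

theorem pairProd_one_comp {n : ℕ} (y : Fin n → L) (w : Equiv.Perm (Fin n)) :
    pairProd 1 (y ∘ w) = ((Equiv.Perm.sign w : ℤ) : L) * pairProd 1 y := by
  have h : ∀ y : Fin n → L, pairProd 1 y =
      (∏ i : Fin n, ∏ j ∈ Finset.Ioi i, (-1)) * (Matrix.vandermonde y).det := fun y => by
    rw [Matrix.det_vandermonde, ← Finset.prod_mul_distrib]
    refine Finset.prod_congr rfl fun i _ => ?_
    rw [← Finset.prod_mul_distrib]
    exact Finset.prod_congr rfl fun j _ => by ring
  have h2 : Matrix.vandermonde (y ∘ w) = (Matrix.vandermonde y).submatrix w id := rfl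
  rw [h, h, h2, Matrix.det_permute]
  ring

/-- The summand `y^μ ∏_{i<j} (y_i - s y_j) / (y_i - y_j)`. -/
def hlTerm (s : L) (μ : ℕ → ℕ) {n : ℕ} (y : Fin n → L) : L :=
  (∏ i : Fin n, y i ^ μ i) * pairProd s y / pairProd 1 y

theorem hlTerm_succ (s : L) {μ : ℕ → ℕ} {n : ℕ} (hμ : μ n = 0) (y : Fin (n + 1) → L) :
    hlTerm s μ y = hlTerm s μ (fun i : Fin n => y i.castSucc) *
      ∏ i : Fin n, (y i.castSucc - s * y (Fin.last n)) / (y i.castSucc - y (Fin.last n)) := by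
  rw [hlTerm, hlTerm, pairProd_succ, pairProd_succ, Fin.prod_univ_castSucc, Finset.prod_div_distrib,
    Fin.val_last, hμ, pow_zero, mul_one, div_mul_div_comm]
  simp only [one_mul, Fin.val_castSucc]
  congr 1
  ring

/-- The denominator `∏ (y_i - y_j)` is alternating, so it accounts for the sign. -/
theorem sum_sign_eq (s : L) (μ : ℕ → ℕ) {n : ℕ} {y : Fin n → L} (hy : Function.Injective y) :
    ∑ w : Equiv.Perm (Fin n), ((Equiv.Perm.sign w : ℤ) : L) *
      ((∏ i : Fin n, y (w i) ^ μ i) * pairProd s (y ∘ w)) =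
    (∑ w : Equiv.Perm (Fin n), hlTerm s μ (y ∘ w)) * pairProd 1 y := by
  rw [Finset.sum_mul]
  refine Finset.sum_congr rfl fun w _ => ?_
  have hne := pairProd_one_ne_zero hy
  have hs : ((Equiv.Perm.sign w : ℤ) : L) * ((Equiv.Perm.sign w : ℤ) : L) = 1 := by
    rw [← Int.cast_mul, ← Units.val_mul, Int.units_mul_self, Units.val_one, Int.cast_one]
  have hs0 : ((Equiv.Perm.sign w : ℤ) : L) ≠ 0 := left_ne_zero_of_mul_eq_one hs
  rw [hlTerm, pairProd_one_comp, div_mul_eq_mul_div, eq_div_iff (mul_ne_zero hs0 hne)]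
  simp only [Function.comp]
  linear_combination ((∏ i : Fin n, y (w i) ^ μ i) * pairProd s (y ∘ w) * pairProd 1 y) * hs

/-- Permutations are grouped by the index `j` that occupies the last position, where `μ` vanishes.
The rotation is inserted because `decomposeFin` records the image of the first index rather than the
last. -/
theorem sum_hlTerm_succ (s : L) {μ : ℕ → ℕ} {n : ℕ} (hμ : μ n = 0) (x : Fin (n + 1) → L) :
    ∑ w : Equiv.Perm (Fin (n + 1)), hlTerm s μ (x ∘ w) =
      ∑ j : Fin (n + 1), (∑ w : Equiv.Perm (Fin n),
        hlTerm s μ ((fun i : Fin n => x (Equiv.swap 0 j i.succ)) ∘ w)) *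
        ∏ i : Fin n, (x (Equiv.swap 0 j i.succ) - s * x j) / (x (Equiv.swap 0 j i.succ) - x j) := by
  rw [← Equiv.sum_comp (Equiv.mulRight (finRotate (n + 1))),
    ← Equiv.sum_comp Equiv.Perm.decomposeFin.symm, Fintype.sum_prod_type]
  refine Finset.sum_congr rfl fun j _ => ?_
  rw [Finset.sum_mul]
  refine Finset.sum_congr rfl fun w _ => ?_
  rw [hlTerm_succ s hμ]
  have e1 : ∀ i : Fin n, (Equiv.mulRight (finRotate (n + 1)) (Equiv.Perm.decomposeFin.symm (j, w)))
      i.castSucc = Equiv.swap 0 j (w i).succ := fun i => by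
    rw [Equiv.coe_mulRight, Equiv.Perm.mul_apply, finRotate_apply, Fin.coeSucc_eq_succ,
      Equiv.Perm.decomposeFin_symm_apply_succ]
  have e2 : (Equiv.mulRight (finRotate (n + 1)) (Equiv.Perm.decomposeFin.symm (j, w)))
      (Fin.last n) = j := by
    rw [Equiv.coe_mulRight, Equiv.Perm.mul_apply, finRotate_last,
      Equiv.Perm.decomposeFin_symm_apply_zero]
  simp only [Function.comp, e1, e2]
  congr 1
  exact Equiv.prod_comp w fun i =>
    (x (Equiv.swap 0 j i.succ) - s * x j) / (x (Equiv.swap 0 j i.succ) - x j)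

theorem prod_erase_eq_prod_swap {n : ℕ} (j : Fin (n + 1)) (f : Fin (n + 1) → L) :
    ∏ i ∈ Finset.univ.erase j, f i = ∏ i : Fin n, f (Equiv.swap 0 j i.succ) := by
  have h : ∏ i ∈ Finset.univ.erase j, f i = ∏ i ∈ Finset.univ.erase 0, f (Equiv.swap 0 j i) := by
    refine Finset.prod_equiv (Equiv.swap 0 j) (fun i => ?_) fun i _ => ?_
    · simp only [Finset.mem_erase, Finset.mem_univ, and_true, Equiv.swap_apply_def]
      grind
    · rw [Equiv.swap_apply_self]
  rw [h, Fin.univ_succ, Finset.erase_cons, Finset.prod_map]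
  rfl

end HallLittlewood

/-! ### The normalization of Hall–Littlewood functions -/

theorem sum_inv_tc_pow_ne_zero (i : ℕ) : ∑ j ∈ Finset.range (i + 1), tc⁻¹ ^ j ≠ 0 := by
  intro h
  have h2 := geom_sum_mul tc⁻¹ (i + 1)
  rw [h, zero_mul, eq_comm, sub_eq_zero, inv_pow, inv_eq_one] at h2
  exact tc_pow_ne_one (by omega) h2

theorem vFact_ne_zero (m : ℕ) : vFact tc⁻¹ m ≠ 0 :=
  Finset.prod_ne_zero_iff.mpr fun i _ => sum_inv_tc_pow_ne_zero i

/-- The factor `v_μ(s)` in `n` variables. -/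
def hlNorm (s : QTQ) (μ : ℕ → ℕ) (n : ℕ) : QTQ :=
  ∏ a ∈ (Finset.range n).image μ, vFact s ((Finset.range n).filter (fun i => μ i = a)).card

theorem hlNorm_eq (s : QTQ) {μ : ℕ → ℕ} {ℓ : ℕ} (hμ : ∀ i, μ i = 0 ↔ ℓ ≤ i) {n : ℕ} (hn : ℓ ≤ n) :
    hlNorm s μ n = vFact s (n - ℓ) * hlNorm s μ ℓ := by
  have h0 : (0 : ℕ) ∉ (Finset.range ℓ).image μ := by
    simp only [Finset.mem_image, Finset.mem_range, not_exists, not_and]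
    intro i hi h
    have := (hμ i).mp h
    omega
  have hcard : ((Finset.range n).filter (fun i => μ i = 0)).card = n - ℓ := by
    have : (Finset.range n).filter (fun i => μ i = 0) = Finset.Ico ℓ n := by
      ext i
      simp only [Finset.mem_filter, Finset.mem_range, Finset.mem_Ico, hμ]
      omega
    rw [this, Nat.card_Ico]
  have hne : ∀ a ∈ (Finset.range ℓ).image μ,
      vFact s ((Finset.range n).filter (fun i => μ i = a)).card =
        vFact s ((Finset.range ℓ).filter (fun i => μ i = a)).card := by
    intro a ha
    congr 2
    ext i
    simp only [Finset.mem_filter, Finset.mem_range]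
    constructor
    · rintro ⟨h1, rfl⟩
      refine ⟨?_, rfl⟩
      by_contra h
      exact h0 ((hμ i).mpr (by omega) ▸ ha)
    · rintro ⟨h1, h2⟩
      exact ⟨by omega, h2⟩
  rcases hn.eq_or_lt with rfl | hlt
  · simp [vFact]
  · have him : (Finset.range n).image μ = insert 0 ((Finset.range ℓ).image μ) := by
      ext a
      simp only [Finset.mem_image, Finset.mem_range, Finset.mem_insert]
      constructor
      · rintro ⟨i, hi, rfl⟩
        by_cases h : i < ℓ
        · exact Or.inr ⟨i, h, rfl⟩
        · exact Or.inl ((hμ i).mpr (by omega))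
      · rintro (rfl | ⟨i, hi, rfl⟩)
        · exact ⟨ℓ, hlt, (hμ ℓ).mpr le_rfl⟩
        · exact ⟨i, by omega, rfl⟩
    rw [hlNorm, him, Finset.prod_insert h0, hcard, Finset.prod_congr rfl hne]
    rfl

theorem hlNorm_ne_zero (μ : ℕ → ℕ) (n : ℕ) : hlNorm tc⁻¹ μ n ≠ 0 :=
  Finset.prod_ne_zero_iff.mpr fun _ _ => vFact_ne_zero _

theorem hlNorm_succ (s : QTQ) {μ : ℕ → ℕ} {ℓ : ℕ} (hμ : ∀ i, μ i = 0 ↔ ℓ ≤ i) {n : ℕ}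
    (hn : ℓ ≤ n) :
    hlNorm s μ (n + 1) = (∑ j ∈ Finset.range (n - ℓ + 1), s ^ j) * hlNorm s μ n := by
  rw [hlNorm_eq s hμ hn, hlNorm_eq s hμ (show ℓ ≤ n + 1 by omega), Nat.succ_sub hn, vFact,
    Finset.prod_range_succ, vFact]
  ring

/-- The geometric sum is the ratio of the normalizations in `n + 1` and `n` variables. Telescoping
makes the eigenvalue of `ℬ_0` independent of the number of variables. -/
theorem tc_pow_add_sum {ℓ n : ℕ} (hn : ℓ ≤ n) :
    tc ^ (n + 1) + (1 - tc) * (tc ^ n * ∑ j ∈ Finset.range (n - ℓ + 1), tc⁻¹ ^ j) = tc ^ ℓ := by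
  obtain ⟨r, rfl⟩ := Nat.exists_eq_add_of_le hn
  rw [Nat.add_sub_cancel_left]
  have ht := tc_ne_zero
  induction r with
  | zero => simp; ring
  | succ r ih =>
    have := ih (by omega)
    have h : tc ^ (ℓ + (r + 1)) * tc⁻¹ ^ (r + 1) = tc ^ ℓ := by
      rw [pow_add, inv_pow, mul_inv_cancel_right₀ (pow_ne_zero _ ht)]
    rw [Finset.sum_range_succ]
    linear_combination tc * this + (1 - tc) * h

/-! ### Shifts of the alphabet -/

theorem admissible_shift (k : ℕ) : Admissible (fun j => X (j + k)) :=
  admissible_of_X 0 fun j => Or.inl ⟨j + k, by omega, rfl⟩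

/-- The alphabet shift as an algebra homomorphism. -/
def shf (k : ℕ) : PInf →ₐ[QTQ] PInf := subst _ (admissible_shift k)

theorem shift_eq_shf (k : ℕ) (F : PInf) : shift k F = shf k F := by
  refine PInf.ext fun m => ?_
  rw [shf, proj_subst (n := m - k) _ fun j hj => trunc_X_of_le (by omega)]
  rw [← trunc_proj (shift k F) le_rfl]
  congr 1
  have h : (rename (fun j => j + k) : Poly →ₐ[QTQ] Poly) = aeval fun j => X (j + k) :=
    MvPolynomial.algHom_ext fun j => by rw [rename_X, aeval_X]
  rw [← h]
  rfl

theorem proj_shf (k m : ℕ) (F : PInf) :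
    proj (shf k F) m = rename (fun j => j + k) (proj F (m - k)) := by
  rw [← shift_eq_shf]
  rfl

theorem shf_xv (k j : ℕ) : shf k (xv j) = xv (j + k) := subst_xv _ _

theorem shf_shf (k l : ℕ) (F : PInf) : shf k (shf l F) = shf (l + k) F :=
  subst_subst _ _ _ (fun j => by rw [aeval_X, add_assoc]) F

theorem swp_shf (i k : ℕ) (F : PInf) : swp (i + k) (shf k F) = shf k (swp i F) := by
  refine subst_subst_comm _ _ _ _ (fun j => ?_) F
  simp only [aeval_X, Equiv.swap_apply_def]
  grind

theorem swp_shf_of_lt {i k : ℕ} (h : i + 1 < k) (F : PInf) : swp i (shf k F) = shf k F :=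
  subst_subst _ _ _ (fun j => by
    rw [aeval_X, Equiv.swap_apply_of_ne_of_ne (by omega) (by omega)]) F

theorem om_shf (k : ℕ) (F : PInf) : om k (shf k F) = shf k F :=
  subst_subst _ _ _ (fun j => by rw [aeval_X, if_neg (by omega), if_neg (by omega)]) F

theorem shf_mem {l : ℕ} (k : ℕ) {F : PInf} (hF : F ∈ PSym l) : shf k F ∈ PSym (l + k) :=
  mem_PSym.mpr fun i hi => by
    obtain ⟨j, rfl⟩ : ∃ j, i = j + k := ⟨i - k, by omega⟩
    rw [swp_shf, swp_of_mem hF (by omega)]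

theorem shf_qFn (k n : ℕ) : shf k (qFn 0 n) = qFn k n := by
  refine PInf.ext_of_le k fun m hm => ?_
  rw [proj_shf, proj_qFn, proj_qFn]
  change (rename (R := QTQ) fun j : ℕ => j + k).toRingHom _ = _
  rw [← PowerSeries.coeff_map, qSeries, map_prod, qSeries,
    Finset.prod_congr rfl fun i _ => map_qFactor (rename fun j => j + k) (rename_X _ i),
    Finset.prod_Ico_add' (fun i => qFactor i) 0 (m - k) k, zero_add, Nat.sub_add_cancel hm]

theorem dMinus_shf (k : ℕ) {F : PInf} (hF : F ∈ PSym 1) :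
    dMinus k (shf k F) = shf k (dMinus 0 F) := by
  refine PSym_span (k := 0) (p := fun F => dMinus k (shf k F) = shf k (dMinus 0 F))
    (fun c hc n => ?_) (fun F _ G _ h1 h2 => ?_) hF
  · have hc' : shf k c ∈ PSym k := by
      have := shf_mem k hc
      rwa [zero_add] at this
    have e : shf k (c * xv 0 ^ n) = shf k c * xv k ^ n := by
      rw [map_mul, map_pow, shf_xv, zero_add]
    rw [e, dMinus_mul_pow hc', dMinus_mul_pow hc, map_mul, shf_qFn]
  · rw [map_add, map_add, map_add, map_add, h1, h2]

theorem shf_one_mem {F : PInf} (hF : F ∈ PSym 0) : shf 1 F ∈ PSym 1 := shf_mem 1 hF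

/-! ### The operators `ℬ_n` -/

/-- The operator `ℬ_0`: the composite of the shift of the alphabet with `∂^-_1`. -/
def opB0 : Module.End QTQ SymFn where
  toFun F := ⟨dMinus 0 (shf 1 F.1), dMinus_mem (shf_one_mem F.2)⟩
  map_add' F G := Subtype.ext (by
    change dMinus 0 (shf 1 (F.1 + G.1)) = _
    rw [map_add, map_add]
    rfl)
  map_smul' c F := Subtype.ext (by
    change dMinus 0 (shf 1 (c • F.1)) = _
    rw [map_smul, map_smul]
    rfl)

theorem shf_e1 : shf 1 e1.1 = e1.1 - xv 0 := by
  refine PInf.ext_of_le 1 fun m hm => ?_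
  obtain ⟨n, rfl⟩ := Nat.exists_eq_add_of_le' hm
  rw [proj_shf, proj_sub, proj_xv_of_lt hm]
  change rename _ (∑ i ∈ Finset.range n, X i) = ∑ i ∈ Finset.range (n + 1), X i - X 0
  rw [map_sum, Finset.sum_range_succ', add_sub_cancel_right]
  exact Finset.sum_congr rfl fun i _ => rename_X _ _

/-- In `[e_1, ℬ_n]` the factor `e_1` passes through `∂^-` on the left, while on the right it is
first shifted to `e_1 - x_1`. The difference leaves exactly one more factor `x_1`. -/
theorem hlOp_apply (n : ℕ) (F : SymFn) :
    (hlOp opB0 n F).1 = dMinus 0 (xv 0 ^ n * shf 1 F.1) := by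
  induction n generalizing F with
  | zero => rw [pow_zero, one_mul]; rfl
  | succ n ih =>
    have hx : xv 0 ^ n * shf 1 F.1 ∈ PSym 1 :=
      (PSym 1).mul_mem ((PSym 1).pow_mem (xv_mem (by omega)) n) (shf_one_mem F.2)
    have h1 : (hlOp opB0 (n + 1) F).1 =
        e1.1 * (hlOp opB0 n F).1 - (hlOp opB0 n (e1 * F)).1 := rfl
    have h2 : xv 0 ^ n * shf 1 (e1 * F).1 =
        e1.1 * (xv 0 ^ n * shf 1 F.1) - xv 0 ^ (n + 1) * shf 1 F.1 := by
      change xv 0 ^ n * shf 1 (e1.1 * F.1) = _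
      rw [map_mul, shf_e1]
      ring
    rw [h1, ih, ih, h2, map_sub, dMinus_mul e1.2 hx]
    ring

theorem ofPoly_mem {k : ℕ} {p : Poly} (hp : p ∈ PolyLT k) : ofPoly p ∈ PSym k := by
  have h : PolyLT k ≤ (PSym k).comap ofPolyHom := by
    rw [PolyLT, supported_eq_adjoin_X]
    refine Algebra.adjoin_le ?_
    rintro _ ⟨j, hj, rfl⟩
    exact xv_mem hj
  exact h hp

/-- Reconciles the two descriptions of `∂^-`: `x_{k+1}^n G[x_{k+2} + ⋯]` is a shift of `x_1^n G[x_2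
+ ⋯]`, and `∂^-` commutes with shifts. -/
theorem dMinus_ofPoly_mul {k : ℕ} {p : Poly} (hp : p ∈ PolyLT k) (n : ℕ) (G : SymFn) :
    dMinus k (ofPoly p * xv k ^ n * shift (k + 1) G.1) =
      ofPoly p * shift k (hlOp opB0 n G).1 := by
  have hx : xv 0 ^ n * shf 1 G.1 ∈ PSym 1 :=
    (PSym 1).mul_mem ((PSym 1).pow_mem (xv_mem (by omega)) n) (shf_one_mem G.2)
  have e : xv k ^ n * shf (k + 1) G.1 = shf k (xv 0 ^ n * shf 1 G.1) := by
    rw [map_mul, map_pow, shf_xv, zero_add, shf_shf, add_comm 1 k]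
  have hm : shf k (xv 0 ^ n * shf 1 G.1) ∈ PSym (k + 1) := by
    have := shf_mem k hx
    rwa [add_comm] at this
  rw [shift_eq_shf, shift_eq_shf, mul_assoc, e, dMinus_mul (ofPoly_mem hp) hm, dMinus_shf k hx,
    hlOp_apply]

theorem om_ofPoly_mul (k : ℕ) (p : Poly) (G : PInf) :
    om k (ofPoly p * shift k G) = ofPoly (omegaInv k p) * shift k G := by
  rw [shift_eq_shf, map_mul, om_shf, om, subst_ofPoly]
  rfl

theorem calT_ofPoly (i : ℕ) (p : Poly) : calT i (ofPoly p) = ofPoly (polyT i p) := by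
  refine PInf.ext_of_le (i + 2) fun m hm => ?_
  rw [proj_calT (by omega), proj_ofPoly, proj_ofPoly, trunc_polyT (by omega)]

theorem calTAsc_ofPoly (n : ℕ) (p : Poly) : calTAsc n (ofPoly p) = ofPoly (polyTAsc n p) := by
  induction n generalizing p with
  | zero => rfl
  | succ n ih =>
    rw [calTAsc_succ, calT_ofPoly, ih]
    rfl

theorem calTAsc_ofPoly_mul (k : ℕ) (p : Poly) (G : PInf) :
    calTAsc k (xv k * (ofPoly p * shift (k + 1) G)) =
      ofPoly (omegaTildeInv (k + 1) p) * shift (k + 1) G := by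
  have e : xv k * (ofPoly p * shf (k + 1) G) = shf (k + 1) G * ofPoly (X k * p) := by
    have : ofPoly (X k * p) = xv k * ofPoly p := map_mul ofPolyHom _ _
    rw [this]
    ring
  rw [shift_eq_shf, e, calTAsc_mul fun i hi => swp_shf_of_lt (by omega) G, calTAsc_ofPoly, mul_comm]
  rfl

/-! ### The eigenvalues of `ℬ_0` -/

theorem contract_shf (F : PInf) : contract 0 (shf 1 F) = F := by
  rw [contract, shf, subst_subst _ _ admissible_X fun j => ?_, subst_X]
  rw [aeval_X, if_neg (by omega), if_neg (by omega), Nat.add_sub_cancel]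

theorem contract_xv (k : ℕ) : contract k (xv k) = 0 := by
  rw [contract, subst_xv, if_neg (lt_irrefl k), if_pos rfl]
  exact map_zero ofPolyHom

theorem rename_swap_proj {c : PInf} (hc : c ∈ PSym 0) {j m : ℕ} (hj : j < m) :
    rename (Equiv.swap 0 j) (proj c m) = proj c m := by
  have hs : ∀ i, i + 1 < m → rename (Equiv.swap i (i + 1)) (proj c m) = proj c m := fun i hi => by
    change swapVar i _ = _
    rw [← proj_swp hi, swp_of_mem hc (Nat.zero_le i)]
  induction j with
  | zero => rw [Equiv.swap_self, Equiv.coe_refl, rename_id_apply]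
  | succ j ih =>
    rcases Nat.eq_zero_or_pos j with rfl | h0
    · exact hs 0 hj
    · have e : (Equiv.swap 0 (j + 1) : ℕ → ℕ) =
          Equiv.swap j (j + 1) ∘ Equiv.swap 0 j ∘ Equiv.swap j (j + 1) := by
        funext a
        simp only [Function.comp, Equiv.swap_apply_def]
        grind
      rw [e, ← rename_rename, ← rename_rename, hs j hj, ih (by omega), hs j hj]

/-- The variables in the field of rational functions. -/
def xFrac (n : ℕ) (i : Fin n) : FractionRing Poly := algebraMap Poly _ (X (i : ℕ))

theorem xFrac_injective (n : ℕ) : Function.Injective (xFrac n) := fun _ _ h =>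
  Fin.ext (X_injective (IsFractionRing.injective Poly (FractionRing Poly) h))

theorem xFrac_ne_zero (n : ℕ) (i : Fin n) : xFrac n i ≠ 0 := fun h =>
  X_ne_zero (R := QTQ) (i : ℕ)
    (IsFractionRing.injective Poly (FractionRing Poly) (h.trans (map_zero _).symm))

theorem algebraMap_proj_qFn (m n : ℕ) :
    algebraMap Poly (FractionRing Poly) (proj (qFn 0 n) m) =
      (if n = 0 then algebraMap Poly (FractionRing Poly) (C tc) ^ m else 0) +
      (1 - algebraMap Poly (FractionRing Poly) (C tc)) * ∑ j : Fin m, xFrac m j ^ n *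
        ∏ i ∈ Finset.univ.erase j, (algebraMap Poly (FractionRing Poly) (C tc) * xFrac m i -
          xFrac m j) / (xFrac m i - xFrac m j) := by
  have h := coeff_prod_qFactor (algebraMap Poly (FractionRing Poly) (C tc)) (xFrac_injective m)
    (xFrac_ne_zero m) n
  rw [Fintype.card_fin] at h
  rw [← h, proj_qFn, ← PowerSeries.coeff_map, qSeries, map_prod, Nat.Ico_zero_eq_range,
    Finset.prod_range]
  congr 1
  refine Finset.prod_congr rfl fun i _ => ?_
  ext1 r
  rw [PowerSeries.coeff_map, qFactor, PowerSeries.coeff_mk, PowerSeries.coeff_mk]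
  split_ifs
  · exact map_one _
  · rw [smul_eq_C_mul, map_mul, map_pow, C_sub, C_1, map_sub, map_one]
    rfl

/-- By linearity it suffices to take `c x_1^n` with `c` symmetric, where this is the partial
fraction formula for `Q_n`. The extra term `t^m` occurs only for `n = 0`, and `contract 0` selects
that coefficient. -/
theorem algebraMap_proj_dMinus (m : ℕ) {F : PInf} (hF : F ∈ PSym 1) :
    algebraMap Poly (FractionRing Poly) (proj (dMinus 0 F) m) =
      algebraMap Poly (FractionRing Poly) (C tc) ^ m *
        algebraMap Poly (FractionRing Poly) (proj (contract 0 F) m) +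
      (1 - algebraMap Poly (FractionRing Poly) (C tc)) * ∑ j : Fin m,
        algebraMap Poly (FractionRing Poly) (rename (Equiv.swap 0 (j : ℕ)) (proj F m)) *
        ∏ i ∈ Finset.univ.erase j, (algebraMap Poly (FractionRing Poly) (C tc) * xFrac m i -
          xFrac m j) / (xFrac m i - xFrac m j) := by
  set R : Fin m → FractionRing Poly := fun j => ∏ i ∈ Finset.univ.erase j,
    (algebraMap Poly (FractionRing Poly) (C tc) * xFrac m i - xFrac m j) /
      (xFrac m i - xFrac m j) with hR
  refine PSym_span (k := 0) (p := fun F =>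
    algebraMap Poly (FractionRing Poly) (proj (dMinus 0 F) m) =
      algebraMap Poly (FractionRing Poly) (C tc) ^ m *
        algebraMap Poly (FractionRing Poly) (proj (contract 0 F) m) +
      (1 - algebraMap Poly (FractionRing Poly) (C tc)) * ∑ j : Fin m,
        algebraMap Poly (FractionRing Poly) (rename (Equiv.swap 0 (j : ℕ)) (proj F m)) * R j)
    (fun c hc n => ?_) (fun F _ G _ h1 h2 => ?_) hF
  · have hxj : ∀ j : Fin m, rename (Equiv.swap 0 (j : ℕ)) (proj (xv 0 : PInf) m) = X (j : ℕ) := by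
      intro j
      rw [proj_xv_of_lt (by have := j.2; omega), rename_X, Equiv.swap_apply_left]
    have h1 : ∀ j : Fin m, algebraMap Poly (FractionRing Poly)
        (rename (Equiv.swap 0 (j : ℕ)) (proj (c * xv 0 ^ n) m)) =
        algebraMap Poly (FractionRing Poly) (proj c m) * xFrac m j ^ n := fun j => by
      rw [proj_mul, proj_pow, map_mul, map_pow, hxj, rename_swap_proj hc j.2, map_mul, map_pow]
      rfl
    rw [dMinus_mul_pow hc, proj_mul, map_mul, algebraMap_proj_qFn, map_mul, map_pow, contract_xv,
      contract_of_mem hc]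
    simp only [h1]
    rw [mul_add, Finset.mul_sum, Finset.mul_sum, Finset.mul_sum]
    congr 1
    · split_ifs with hn
      · rw [hn, pow_zero, mul_one, mul_comm]
      · rw [zero_pow hn, mul_zero, mul_zero, proj_zero, map_zero, mul_zero]
    · exact Finset.sum_congr rfl fun j _ => by simp only [hR]; ring
  · simp only [map_add, proj_add, h1, h2, add_mul, Finset.sum_add_distrib]
    ring

theorem IsHallLittlewood.sum_hlTerm {s : QTQ} {μ : ℕ → ℕ} {ℓ : ℕ} {F : SymFn}
    (hF : IsHallLittlewood s μ ℓ F) {n : ℕ} (hn : ℓ ≤ n) {L : Type*} [Field L] (φ : Poly →+* L)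
    {y : Fin n → L} (hy : ∀ i : Fin n, φ (X (i : ℕ)) = y i) (hinj : Function.Injective y) :
    φ (C (hlNorm s μ n)) * φ (proj F.1 n) =
      ∑ w : Equiv.Perm (Fin n), hlTerm (φ (C s)) μ (y ∘ w) := by
  have h := congrArg φ (hF n hn)
  apply mul_right_cancel₀ (pairProd_one_ne_zero hinj)
  rw [← sum_sign_eq _ _ hinj]
  rw [smul_eq_C_mul] at h
  simp only [map_mul, map_prod, map_sum, map_sub, map_pow, map_intCast, hy] at h
  rw [← mul_assoc] at h
  simp only [pairProd, one_mul, hlNorm, Function.comp]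
  rw [← h]
  simp only [map_prod]

theorem val_swap_succ {m : ℕ} (j : Fin (m + 1)) (i : Fin m) :
    ((Equiv.swap 0 j i.succ : Fin (m + 1)) : ℕ) = Equiv.swap 0 (j : ℕ) ((i : ℕ) + 1) := by
  simp only [Equiv.swap_apply_def, Fin.ext_iff]
  split_ifs <;> simp_all

/-- In `n + 1` variables, the sum over `j` for the shifted function consists of Hall–Littlewood sums
in the remaining `n` variables and reassembles to a multiple of `P_μ`. The ratio of normalizations
and the separate `t^{n+1}` term then combine to `t^ℓ`. -/
theorem isHLZero_opB0 : IsHLZero opB0 := by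
  intro μ ℓ _ hμ F hF
  apply Subtype.ext
  change dMinus 0 (shf 1 F.1) = tc ^ ℓ • F.1
  refine PInf.ext_of_le (ℓ + 1) fun m hm => ?_
  obtain ⟨n, rfl⟩ : ∃ n, m = n + 1 := ⟨m - 1, by omega⟩
  have hn : ℓ ≤ n := by omega
  apply IsFractionRing.injective Poly (FractionRing Poly)
  rw [algebraMap_proj_dMinus (n + 1) (shf_one_mem F.2), contract_shf]
  set τ := algebraMap Poly (FractionRing Poly) (C tc) with hτ
  set σ := algebraMap Poly (FractionRing Poly) (C tc⁻¹) with hσ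
  have hτσ : τ * σ = 1 := by
    rw [hτ, hσ, ← map_mul, ← C_mul, mul_inv_cancel₀ tc_ne_zero, C_1, map_one]
  set x := xFrac (n + 1) with hx
  have hlarge := hF.sum_hlTerm (show ℓ ≤ n + 1 by omega) (algebraMap Poly (FractionRing Poly))
    (y := x) (fun i => rfl) (xFrac_injective _)
  have hsmall : ∀ j : Fin (n + 1), algebraMap Poly (FractionRing Poly) (C (hlNorm tc⁻¹ μ n)) *
      algebraMap Poly (FractionRing Poly)
        (rename (Equiv.swap 0 (j : ℕ)) (proj (shf 1 F.1) (n + 1))) =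
      ∑ w : Equiv.Perm (Fin n), hlTerm σ μ ((fun i : Fin n => x (Equiv.swap 0 j i.succ)) ∘ w) := by
    intro j
    have h := hF.sum_hlTerm hn ((algebraMap Poly (FractionRing Poly)).comp
      (rename fun i => Equiv.swap 0 (j : ℕ) (i + 1)).toRingHom)
      (y := fun i : Fin n => x (Equiv.swap 0 j i.succ)) (fun i => ?_) fun a b hab => ?_
    · have e : rename (Equiv.swap 0 (j : ℕ)) (proj (shf 1 F.1) (n + 1)) =
          rename (fun i => Equiv.swap 0 (j : ℕ) (i + 1)) (proj F.1 n) := by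
        rw [proj_shf, rename_rename]
        rfl
      rw [e]
      have e2 : ∀ c : QTQ, ((algebraMap Poly (FractionRing Poly)).comp
          (rename fun i => Equiv.swap 0 (j : ℕ) (i + 1)).toRingHom) (C c) =
          algebraMap Poly (FractionRing Poly) (C c) := fun c =>
        congrArg (algebraMap Poly (FractionRing Poly)) (rename_C _ _)
      rw [e2, e2] at h
      exact h
    · rw [hx, xFrac, val_swap_succ]
      exact congrArg (algebraMap Poly (FractionRing Poly)) (rename_X _ _)
    · exact Fin.succ_injective _ ((Equiv.swap 0 j).injective (xFrac_injective _ hab))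
  have hsucc := sum_hlTerm_succ σ ((hμ n).mpr hn) x
  rw [← hlarge] at hsucc
  -- From `t x_i - x_j = t (x_i - t⁻¹ x_j)`; this is where the Hall–Littlewood parameter `t⁻¹` comes
  -- from.
  have hterm : ∀ j : Fin (n + 1), ∏ i ∈ Finset.univ.erase j, (τ * x i - x j) / (x i - x j) =
      τ ^ n * ∏ i : Fin n, (x (Equiv.swap 0 j i.succ) - σ * x j) /
        (x (Equiv.swap 0 j i.succ) - x j) := by
    intro j
    rw [prod_erase_eq_prod_swap]
    have hc : τ ^ n = ∏ _i : Fin n, τ := by rw [Finset.prod_const, Finset.card_univ, Fintype.card_fin]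
    rw [hc, ← Finset.prod_mul_distrib]
    refine Finset.prod_congr rfl fun i _ => ?_
    rw [← mul_div_assoc]
    congr 1
    linear_combination (x j) * hτσ
  have hnorm := hlNorm_succ tc⁻¹ hμ hn
  have hv0 : algebraMap Poly (FractionRing Poly) (C (hlNorm tc⁻¹ μ n)) ≠ 0 := by
    intro h0
    have := IsFractionRing.injective Poly (FractionRing Poly) (h0.trans (map_zero _).symm)
    exact hlNorm_ne_zero μ n (C_eq_zero.mp this)
  apply mul_left_cancel₀ hv0
  have hsum : algebraMap Poly (FractionRing Poly) (C (hlNorm tc⁻¹ μ n)) * ∑ j : Fin (n + 1),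
      algebraMap Poly (FractionRing Poly)
        (rename (Equiv.swap 0 (j : ℕ)) (proj (shf 1 F.1) (n + 1))) *
        ∏ i ∈ Finset.univ.erase j, (τ * x i - x j) / (x i - x j) =
      τ ^ n * (algebraMap Poly (FractionRing Poly) (C (hlNorm tc⁻¹ μ (n + 1))) *
        algebraMap Poly (FractionRing Poly) (proj F.1 (n + 1))) := by
    rw [hsucc, Finset.mul_sum, Finset.mul_sum]
    refine Finset.sum_congr rfl fun j _ => ?_
    rw [hterm, ← hsmall]
    ring
  have hscal := congrArg (fun c => algebraMap Poly (FractionRing Poly) (C c)) (tc_pow_add_sum hn)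
  simp only [map_add, map_mul, map_sub, map_pow, map_one] at hscal
  rw [hnorm, C_mul, map_mul] at hsum
  rw [proj_smul, smul_eq_C_mul, map_mul, C_pow, map_pow]
  linear_combination (1 - τ) * hsum + algebraMap Poly (FractionRing Poly)
    (C (hlNorm tc⁻¹ μ n)) * algebraMap Poly (FractionRing Poly) (proj F.1 (n + 1)) * hscal

/-! ### Operators on `𝒫_•` -/

theorem PBullet.map_mul_map {k l m : ℕ} (φ : PSym l →ₗ[QTQ] PSym m) (ψ : PSym k →ₗ[QTQ] PSym l) :
    PBullet.map φ * PBullet.map ψ = PBullet.map (φ ∘ₗ ψ) := by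
  refine LinearMap.ext fun v => ?_
  change PBullet.single m (φ (DirectSum.component QTQ ℕ (fun k => PSym k) l
    (DirectSum.lof QTQ ℕ (fun k => PSym k) l _))) = _
  rw [DirectSum.component.lof_self]
  rfl

theorem PBullet.map_mul_map_of_ne {k l l' m : ℕ} (h : l ≠ l') (φ : PSym l →ₗ[QTQ] PSym m)
    (ψ : PSym k →ₗ[QTQ] PSym l') : PBullet.map φ * PBullet.map ψ = 0 := by
  refine LinearMap.ext fun v => ?_
  change PBullet.single m (φ (DirectSum.component QTQ ℕ (fun k => PSym k) l
    (DirectSum.lof QTQ ℕ (fun k => PSym k) l' _))) = 0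
  rw [DirectSum.component.of, dif_neg (Ne.symm h), map_zero, map_zero]

/-- The operator `Φ` on `𝒫_•` maps `𝒫(k)^+` to `𝒫(l)^+` by the restriction of `f`, and is zero on the
other summands. -/
def MapsBy (Φ : Module.End QTQ PBullet) (k l : ℕ) (f : PInf → PInf) : Prop :=
  ∃ φ : PSym k →ₗ[QTQ] PSym l, (∀ F : PSym k, (φ F).1 = f F.1) ∧ Φ = PBullet.map φ

namespace MapsBy

variable {Φ Ψ : Module.End QTQ PBullet} {k l m : ℕ} {f g : PInf → PInf}

theorem mul (h : MapsBy Φ l m f) (h' : MapsBy Ψ k l g) : MapsBy (Φ * Ψ) k m fun F => f (g F) := by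
  obtain ⟨φ, hφ, rfl⟩ := h
  obtain ⟨ψ, hψ, rfl⟩ := h'
  exact ⟨φ ∘ₗ ψ, fun F => by rw [LinearMap.comp_apply, hφ, hψ], PBullet.map_mul_map φ ψ⟩

theorem add (h : MapsBy Φ k l f) (h' : MapsBy Ψ k l g) : MapsBy (Φ + Ψ) k l fun F => f F + g F := by
  obtain ⟨φ, hφ, rfl⟩ := h
  obtain ⟨ψ, hψ, rfl⟩ := h'
  refine ⟨φ + ψ, fun F => ?_, ?_⟩
  · beta_reduce
    rw [← hφ, ← hψ]
    rfl
  · rw [PBullet.map, PBullet.map, PBullet.map, LinearMap.add_comp, LinearMap.comp_add]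

theorem smul (c : QTQ) (h : MapsBy Φ k l f) : MapsBy (c • Φ) k l fun F => c • f F := by
  obtain ⟨φ, hφ, rfl⟩ := h
  refine ⟨c • φ, fun F => ?_, ?_⟩
  · beta_reduce
    rw [← hφ]
    rfl
  · rw [PBullet.map, PBullet.map, LinearMap.smul_comp, LinearMap.comp_smul]

theorem sub (h : MapsBy Φ k l f) (h' : MapsBy Ψ k l g) : MapsBy (Φ - Ψ) k l fun F => f F - g F := by
  obtain ⟨φ, hφ, rfl⟩ := h
  obtain ⟨ψ, hψ, rfl⟩ := h'
  refine ⟨φ - ψ, fun F => ?_, ?_⟩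
  · beta_reduce
    rw [← hφ, ← hψ]
    rfl
  · rw [PBullet.map, PBullet.map, PBullet.map, LinearMap.sub_comp, LinearMap.comp_sub]

theorem congr (h : MapsBy Φ k l f) (hfg : ∀ F ∈ PSym k, f F = g F) : MapsBy Φ k l g := by
  obtain ⟨φ, hφ, rfl⟩ := h
  exact ⟨φ, fun F => by rw [hφ, hfg F.1 F.2], rfl⟩

theorem eq (h : MapsBy Φ k l f) (h' : MapsBy Ψ k l g) (hfg : ∀ F ∈ PSym k, f F = g F) : Φ = Ψ := by
  obtain ⟨φ, hφ, rfl⟩ := h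
  obtain ⟨ψ, hψ, rfl⟩ := h'
  congr 1
  exact LinearMap.ext fun F => Subtype.ext (by rw [hφ, hψ, hfg F.1 F.2])

theorem eq_zero (h : MapsBy Φ k l f) (hf : ∀ F ∈ PSym k, f F = 0) : Φ = 0 := by
  have := h.eq (h.smul 0) fun F hF => by rw [hf F hF, smul_zero]
  rwa [zero_smul] at this

end MapsBy

/-! ### The representation -/

/-- The restriction of an operator on `𝒫_∞^+` to `𝒫(k)^+ → 𝒫(l)^+`. -/
def restr {k l : ℕ} (f : PInf →ₗ[QTQ] PInf) (h : ∀ F ∈ PSym k, f F ∈ PSym l) :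
    PSym k →ₗ[QTQ] PSym l where
  toFun F := ⟨f F.1, h F.1 F.2⟩
  map_add' F G := Subtype.ext (map_add f F.1 G.1)
  map_smul' c F := Subtype.ext (map_smul f c F.1)

/-- The extension of `ω̃⁻¹` to `𝒫(k+1)^+`. -/
def omTildeSym (k : ℕ) : PSym (k + 1) →ₗ[QTQ] PSym (k + 1) :=
  restr (calTAsc k ∘ₗ calX k) fun _ hF =>
    calTAsc_mem (Nat.lt_succ_self k) ((PSym (k + 1)).mul_mem (xv_mem (Nat.lt_succ_self k)) hF)

/-- The extension of `ω⁻¹` to `𝒫(k+1)^+`. -/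
def omSym (k : ℕ) : PSym (k + 1) →ₗ[QTQ] PSym (k + 1) :=
  restr (om (k + 1)).toLinearMap fun _ hF => om_mem hF

/-- The operator `∂^-` from `𝒫(k+1)^+` to `𝒫(k)^+`. -/
def dMinusSym (k : ℕ) : PSym (k + 1) →ₗ[QTQ] PSym k :=
  restr (dMinus k) fun _ hF => dMinus_mem hF

/-- The action of the arrows of the quiver on `𝒫_•`. -/
def arrowMap : {k l : ℕ} → Arrow k l → (PSym k →ₗ[QTQ] PSym l)
  | _, _, .dPlus k => -(omTildeSym k ∘ₗ incl k)
  | _, _, .dStar k => omSym k ∘ₗ incl k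
  | _, _, .dMinus k => dMinusSym k
  | _, _, .loopT _ i h => restr (calT i) fun _ hF => calT_mem h hF

/-- The action of the generators of the path algebra on `𝒫_•`. -/
def genMap : Gen → Module.End QTQ PBullet
  | .vertex k => PBullet.map (LinearMap.id : PSym k →ₗ[QTQ] PSym k)
  | .arrow a => PBullet.map (arrowMap a)

/-- The action of the free algebra on `𝒫_•`. -/
def freeAction : FreeGen →ₐ[QTQ] Module.End QTQ PBullet := FreeAlgebra.lift QTQ genMap

theorem freeAction_ι (g : Gen) : freeAction (FreeAlgebra.ι QTQ g) = genMap g :=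
  FreeAlgebra.lift_ι_apply _ _

/-! ### Action of the generators and of the commutators -/

namespace FreeGen

theorem mapsBy_e (k : ℕ) : MapsBy (freeAction (e k)) k k fun F => F :=
  ⟨LinearMap.id, fun _ => rfl, freeAction_ι _⟩

theorem mapsBy_dP (k : ℕ) : MapsBy (freeAction (dP k)) k (k + 1) (dPlus k) :=
  ⟨_, fun _ => rfl, freeAction_ι _⟩

theorem mapsBy_dS (k : ℕ) : MapsBy (freeAction (dS k)) k (k + 1) (om (k + 1)) :=
  ⟨_, fun _ => rfl, freeAction_ι _⟩

theorem mapsBy_dM (k : ℕ) : MapsBy (freeAction (dM k)) (k + 1) k (dMinus k) :=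
  ⟨_, fun _ => rfl, freeAction_ι _⟩

theorem mapsBy_T {k i : ℕ} (h : i + 1 < k) : MapsBy (freeAction (T k i)) k k (calT i) := by
  rw [T, dif_pos h]
  exact ⟨_, fun _ => rfl, freeAction_ι _⟩

theorem mapsBy_TInv {k i : ℕ} (h : i + 1 < k) : MapsBy (freeAction (TInv k i)) k k (calTInv i) := by
  rw [TInv, map_smul, map_add, map_smul]
  exact ((mapsBy_T h).add ((mapsBy_e k).smul _)).smul _

/-- The empty product is the adjoined unit, which acts on all summands and not at one vertex only.
The left factor `Φ` confines the product to a single vertex. -/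
theorem mapsBy_mul_TDesc {k l n : ℕ} (h : n ≤ k) {Φ : Module.End QTQ PBullet} {f : PInf → PInf}
    (hΦ : MapsBy Φ (k + 1) l f) :
    MapsBy (Φ * freeAction (TDesc (k + 1) n)) (k + 1) l fun F => f (calTDesc n F) := by
  induction n generalizing Φ f with
  | zero =>
    rw [TDesc, map_one, mul_one]
    exact hΦ
  | succ n ih =>
    rw [TDesc, map_mul, ← mul_assoc]
    exact ih (by omega) (hΦ.mul (mapsBy_T (by omega)))

theorem mapsBy_mul_TInvDesc {k l n : ℕ} (h : n ≤ k) {Φ : Module.End QTQ PBullet} {f : PInf → PInf}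
    (hΦ : MapsBy Φ (k + 1) l f) :
    MapsBy (Φ * freeAction (TInvDesc (k + 1) n)) (k + 1) l fun F => f (calTInvDesc n F) := by
  induction n generalizing Φ f with
  | zero =>
    rw [TInvDesc, map_one, mul_one]
    exact hΦ
  | succ n ih =>
    rw [TInvDesc, map_mul, ← mul_assoc]
    exact ih (by omega) (hΦ.mul (mapsBy_TInv (by omega)))

theorem mapsBy_commP (k : ℕ) : MapsBy (freeAction (commP k)) (k + 1) (k + 1)
    fun F => (tc - 1) • calTAsc k (xv k * F) := by
  rw [commP, map_sub, map_mul, map_mul]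
  exact (((mapsBy_dP k).mul (mapsBy_dM k)).sub ((mapsBy_dM (k + 1)).mul (mapsBy_dP (k + 1)))).congr
    fun F hF => commPlus_eq hF

theorem mapsBy_commS (k : ℕ) : MapsBy (freeAction (commS k)) (k + 1) (k + 1) (commStar k) := by
  rw [commS, map_sub, map_mul, map_mul]
  exact ((mapsBy_dS k).mul (mapsBy_dM k)).sub ((mapsBy_dM (k + 1)).mul (mapsBy_dS (k + 1)))

end FreeGen

theorem tc_smul_calTInv_xv_mul_calTInv (i : ℕ) (F : PInf) :
    tc • calTInv i (xv i * calTInv i F) = xv (i + 1) * F := by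
  rw [← calTInv_calT i (xv (i + 1) * F), calT_xv_succ_mul, ← tc_smul_calTInv, mul_smul_comm, map_smul]

namespace FreeGen

theorem mapsBy_y {k i : ℕ} (h : i ≤ k) :
    MapsBy (freeAction (y k i)) (k + 1) (k + 1) fun F => xv i * F := by
  induction i with
  | zero =>
    rw [y, map_smul, map_mul]
    refine ((mapsBy_mul_TDesc le_rfl (mapsBy_commP k)).smul _).congr fun F _ => ?_
    have h1 : tc - 1 ≠ 0 := by
      rw [← neg_ne_zero, neg_sub]
      exact one_sub_tc_ne_zero
    rw [calTAsc_xv_calTDesc, smul_smul (tc - 1), mul_comm (tc - 1),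
      inv_smul_smul₀ (mul_ne_zero (pow_ne_zero _ tc_ne_zero) h1)]
  | succ i ih =>
    rw [y, map_smul, map_mul, map_mul]
    exact (((mapsBy_TInv (by omega)).mul (ih (by omega))).mul (mapsBy_TInv (by omega))).smul tc |>.congr
      fun F _ => tc_smul_calTInv_xv_mul_calTInv i F

theorem mapsBy_z {k i : ℕ} (h : i ≤ k) : MapsBy (freeAction (z k i)) (k + 1) (k + 1) (zOp k i) := by
  induction i with
  | zero =>
    rw [z, map_smul, map_mul]
    exact (mapsBy_mul_TInvDesc le_rfl (mapsBy_commS k)).smul _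
  | succ i ih =>
    rw [z, map_smul, map_mul, map_mul]
    exact (((mapsBy_T (by omega)).mul (ih (by omega))).mul (mapsBy_T (by omega))).smul _

/-! ### Verification of the defining relations -/

theorem Rel.freeAction_eq {a b : FreeGen} (h : Rel a b) : freeAction a = freeAction b := by
  induction h with
  | vertex_sq k =>
    rw [map_mul]
    exact ((mapsBy_e k).mul (mapsBy_e k)).eq (mapsBy_e k) fun _ _ => rfl
  | vertex_ne k l h =>
    rw [map_mul, map_zero]
    simp only [e, freeAction_ι]
    exact PBullet.map_mul_map_of_ne h _ _
  | source a =>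
    rw [map_mul]
    simp only [e, freeAction_ι]
    exact PBullet.map_mul_map _ _
  | target a =>
    rw [map_mul]
    simp only [e, freeAction_ι]
    exact PBullet.map_mul_map _ _
  | T_comm k i j hij hj =>
    rw [map_mul, map_mul]
    have hi := mapsBy_T (show i + 1 < k by omega)
    exact (hi.mul (mapsBy_T hj)).eq ((mapsBy_T hj).mul hi) fun F _ => calT_comm (Or.inl hij) F
  | T_braid k i hi =>
    simp only [map_mul]
    have h1 := mapsBy_T (show i + 1 < k by omega)
    have h2 := mapsBy_T (show i + 1 + 1 < k by omega)
    exact ((h1.mul h2).mul h1).eq ((h2.mul h1).mul h2) fun F _ => calT_braid i F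
  | T_quad k i hi =>
    rw [map_mul, map_sub, map_add, map_smul, map_zero]
    refine (((mapsBy_T hi).sub (mapsBy_e k)).mul
      ((mapsBy_T hi).add ((mapsBy_e k).smul tc))).eq_zero fun F _ => ?_
    rw [map_add, map_smul, calT_quad]
    module
  | dM_dM_T k =>
    simp only [map_mul]
    have h := (mapsBy_dM k).mul (mapsBy_dM (k + 1))
    exact (h.mul (mapsBy_T (by omega))).eq h fun F hF => dMinus_dMinus_calT hF
  | T_dM k i hi =>
    simp only [map_mul]
    exact ((mapsBy_T hi).mul (mapsBy_dM k)).eq ((mapsBy_dM k).mul (mapsBy_T (by omega)))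
      fun F hF => (dMinus_calT hi hF).symm
  | T_dP_dP k =>
    simp only [map_mul]
    exact (((mapsBy_T (by omega)).mul (mapsBy_dP (k + 1))).mul (mapsBy_dP k)).eq
      ((mapsBy_dP (k + 1)).mul (mapsBy_dP k)) fun F hF => calT_dPlus_dPlus hF
  | dP_T k i hi =>
    simp only [map_mul]
    exact ((mapsBy_dP k).mul (mapsBy_T hi)).eq ((mapsBy_T (by omega)).mul (mapsBy_dP k))
      fun F _ => dPlus_calT hi F
  | dM_commP k =>
    simp only [map_mul, map_smul]
    exact (((mapsBy_dM (k + 1)).mul (mapsBy_commP (k + 1))).mul (mapsBy_T (by omega))).eq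
      (((mapsBy_commP k).mul (mapsBy_dM (k + 1))).smul tc) fun F hF => dMinus_commPlus hF
  | commP_dP k =>
    simp only [map_mul, map_smul]
    exact (((mapsBy_T (by omega)).mul (mapsBy_commP (k + 1))).mul (mapsBy_dP (k + 1))).eq
      (((mapsBy_dP (k + 1)).mul (mapsBy_commP k)).smul tc) fun F _ => commPlus_dPlus F
  | T_dS_dS k =>
    simp only [map_mul]
    exact (((mapsBy_T (by omega)).mul (mapsBy_dS (k + 1))).mul (mapsBy_dS k)).eq
      ((mapsBy_dS (k + 1)).mul (mapsBy_dS k)) fun F hF => calT_om_om hF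
  | dS_T k i hi =>
    simp only [map_mul]
    exact ((mapsBy_dS k).mul (mapsBy_T hi)).eq ((mapsBy_T (by omega)).mul (mapsBy_dS k))
      fun F _ => calT_om (by omega) F
  | dM_commS k =>
    simp only [map_mul, map_smul]
    exact (((mapsBy_dM (k + 1)).mul (mapsBy_commS (k + 1))).smul tc).eq
      (((mapsBy_commS k).mul (mapsBy_dM (k + 1))).mul (mapsBy_T (by omega)))
      fun F hF => dMinus_commStar hF
  | commS_dS k =>
    simp only [map_mul, map_smul]
    exact (((mapsBy_commS (k + 1)).mul (mapsBy_dS (k + 1))).smul tc).eq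
      (((mapsBy_T (by omega)).mul (mapsBy_dS (k + 1))).mul (mapsBy_commS k))
      fun F hF => commStar_om hF
  | dP_z k i hi =>
    simp only [map_mul]
    exact ((mapsBy_dP (k + 1)).mul (mapsBy_z hi.le)).eq
      ((mapsBy_z (by omega)).mul (mapsBy_dP (k + 1))) fun F hF => dPlus_zOp hi.le hF
  | dS_y k i hi =>
    simp only [map_mul]
    exact ((mapsBy_dS (k + 1)).mul (mapsBy_y hi.le)).eq
      ((mapsBy_y (by omega)).mul (mapsBy_dS (k + 1)))
      fun F _ => by rw [map_mul, om_xv_of_lt (by omega)]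
  | z_dP k =>
    simp only [map_mul, map_smul]
    exact ((mapsBy_z (Nat.zero_le k)).mul (mapsBy_dP k)).eq
      (((mapsBy_y (Nat.zero_le k)).mul (mapsBy_dS k)).smul _) fun F hF => zOp_dPlus hF

end FreeGen

/-- The action of the double Dyck path algebra on `𝒫_•`. -/
def ddpaAction : DDPA →ₐ[QTQ] Module.End QTQ PBullet :=
  RingQuot.liftAlgHom QTQ ⟨freeAction, fun _ _ h => h.freeAction_eq⟩

theorem ddpaAction_mk (a : FreeGen) : ddpaAction (DDPA.mk a) = freeAction a :=
  RingQuot.liftAlgHom_mkAlgHom_apply _ _ _ _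

end StableDAHA

end

open StableDAHA

theorem mainTheorem2 :
    (∀ (i : ℕ), ∀ F ∈ PAs,
      HasStableLimit (fun m => polyY m i (proj F m)) (calY i F) ∧ calY i F ∈ PAs) ∧
    ∃ (B₀ : Module.End QTQ SymFn)
      (ωt ω : (k : ℕ) → PSym (k + 1) →ₗ[QTQ] PSym (k + 1))
      (δ : (k : ℕ) → PSym (k + 1) →ₗ[QTQ] PSym k),
      IsHLZero B₀ ∧
      (∀ k, IsSymLinearExt (k + 1) (omegaTildeInv (k + 1)) (ωt k)) ∧
      (∀ k, IsSymLinearExt (k + 1) (omegaInv (k + 1)) (ω k)) ∧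
      (∀ k, IsPartialMinus (hlOp B₀) k (δ k)) ∧
      ∃ ρ : DDPA →ₐ[QTQ] Module.End QTQ PBullet,
        (∀ k, ρ (DDPA.mk (FreeGen.e k)) = PBullet.map (LinearMap.id : PSym k →ₗ[QTQ] PSym k)) ∧
        (∀ k, ρ (DDPA.mk (FreeGen.dP k)) = PBullet.map (-(ωt k ∘ₗ incl k))) ∧
        (∀ k, ρ (DDPA.mk (FreeGen.dS k)) = PBullet.map (ω k ∘ₗ incl k)) ∧
        (∀ k, ρ (DDPA.mk (FreeGen.dM k)) = PBullet.map (δ k)) ∧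
        (∀ k i, i + 1 < k → ActsGloballyBy (ρ (DDPA.mk (FreeGen.T k i))) k (calT i)) ∧
        (∀ k i, i ≤ k → ActsGloballyBy (ρ (DDPA.mk (FreeGen.y k i))) (k + 1) (calX i)) ∧
        (∀ k i, i ≤ k → ActsGloballyBy (ρ (DDPA.mk (FreeGen.z k i))) (k + 1) (calY i)) := by
  refine ⟨fun i F hF => hasStableLimit_calY i hF, opB0, omTildeSym, omSym, dMinusSym,
    isHLZero_opB0, fun k p _ G F hF => ?_, fun k p _ G F hF => ?_, fun k p hp n G F hF => ?_,
    ddpaAction, fun k => ?_, fun k => ?_, fun k => ?_, fun k => ?_, fun k i h => ?_,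
    fun k i h => ?_, fun k i h => ?_⟩
  · change calTAsc k (xv k * F.1) = _
    rw [hF, calTAsc_ofPoly_mul]
  · change om (k + 1) F.1 = _
    rw [hF, om_ofPoly_mul]
  · change dMinus k F.1 = _
    rw [hF]
    exact dMinus_ofPoly_mul hp n G
  · rw [ddpaAction_mk]
    exact freeAction_ι _
  · rw [ddpaAction_mk]
    exact freeAction_ι _
  · rw [ddpaAction_mk]
    exact freeAction_ι _
  · rw [ddpaAction_mk]
    exact freeAction_ι _
  · rw [ddpaAction_mk]
    exact FreeGen.mapsBy_T h
  · rw [ddpaAction_mk]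
    exact FreeGen.mapsBy_y h
  · rw [ddpaAction_mk]
    exact (FreeGen.mapsBy_z h).congr fun F hF => (calY_of_mem h hF).symm
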